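/- Let $m\ge 3$, let $\sigma_n=2\pi^{n/2}/\Gamma(n/2)$, and let $\Xi$ be the set of $(m-2)$-dimensional totally geodesic sub-spheres of the unit sphere $\mathbb S^{m-1}\subset\mathbb R^m$, i.e. of the sets $\xi_\omega=\{y\in\mathbb S^{m-1}:\langle y,\omega\rangle=0\}$, $\omega\in\mathbb S^{m-1}$. For $f:\mathbb S^{m-1}\to\mathbb C$ let $\hat f(\xi)=\int_\xi f\,dS$ be its spherical Radon transform, where $dS$ is the $(m-2)$-dimensional Euclidean surface measure on $\xi\in\Xi$. For a function $\phi$ on $\Xi$, $x\in\mathbb S^{m-1}$ and $0\le r\le\pi/2$ let $$\phi^{\vee}_r(x)=\int_{\{\xi\in\Xi\,:\,d(x,\xi)=r\}}\phi(\xi)\,d\mu(\xi)$$ be the average of $\phi$ over the sub-spheres at geodesic distance $r$ from $x$, where $\mu$ is the normalized measure on $\{\xi:d(x,\xi)=r\}$ invariant under the isometries fixing $x$. **Theorem.** Let $f\in L^2(\mathbb S^{m-1})$ be even, i.e. $f(-x)=f(x)$ for almost every $x$. Then $f$ is integrable over $\xi_\omega$ for almost every $\omega\in\mathbb S^{m-1}$,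 and for almost every $x\in\mathbb S^{m-1}$ $$f(x)=\frac{2^{m-2}}{(m-3)!\,\sigma_{m-1}}\left(\frac{d}{dt^2}\right)^{m-2}\left[\int_0^t(\hat f)^{\vee}_{\arccos q}(x)\,q^{m-2}\,(t^2-q^2)^{\frac{m-4}{2}}\,dq\right]_{t=1}.$$ If moreover $f$ is continuous, this holds for every $x\in\mathbb S^{m-1}$. At each of these $x$ the right-hand side is well defined: $\hat f$ is integrable over $\{\xi:d(x,\xi)=\arccos q\}$ for almost every $q\in(0,1)$, the integral over $q$ converges absolutely for every $t\in(0,1]$, and the resulting function of $u=t^2\in(0,1]$ is $m-3$ times continuously differentiable on $(0,1]$, its $(m-3)$-rd derivative being differentiable (from the left) at $u=1$. The $(m-2)$-nd derivative at $t=1$ is this one-sided derivative. -/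

import Mathlib

open MeasureTheory Set Metric
open scoped Pointwise

noncomputable section

/-- Euclidean space `ℝ^m`. -/
abbrev Euc (m : ℕ) : Type := EuclideanSpace ℝ (Fin m)

/-- The unit sphere `S^{m-1}` of `ℝ^m`. -/
abbrev USphere (m : ℕ) : Type := sphere (0 : Euc m) 1

/-- The Lebesgue surface measure on the unit sphere of a finite-dimensional Euclidean space `V`
(e.g. a linear subspace of `ℝ^m`): the mass of `s` is `dim V` times the Lebesgue volume of the
cone `{t • y | 0 < t < 1, y ∈ s}`. -/
def surfaceMeasure (V : Type*) [NormedAddCommGroup V] [InnerProductSpace ℝ V]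
    [FiniteDimensional ℝ V] [MeasurableSpace V] [BorelSpace V] : Measure (sphere (0 : V) 1) :=
  (volume : Measure V).toSphere

/-- `σ_n = 2 π^{n/2} / Γ(n/2)`, the surface area of `S^{n-1}`. -/
def sphereArea (n : ℕ) : ℝ := 2 * Real.pi ^ ((n : ℝ) / 2) / Real.Gamma ((n : ℝ) / 2)

/-- The set `Ξ` of `(m-2)`-dimensional totally geodesic sub-spheres `ξ` of `S^{m-1}`. Such a `ξ` is
the unit sphere of a unique hyperplane through the origin, and is represented by it. -/
@[ext]
structure GreatSubsphere (m : ℕ) where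
  /-- The linear hyperplane spanned by `ξ`. -/
  plane : Submodule ℝ (Euc m)
  finrank_plane : Module.finrank ℝ plane + 1 = m

namespace GreatSubsphere

variable {m : ℕ}

/-- The points of `ξ`, as a subset of `S^{m-1}`. -/
def carrier (ξ : GreatSubsphere m) : Set (USphere m) := {y | (y : Euc m) ∈ ξ.plane}

/-- A point of `ξ` as a point of `S^{m-1}`. -/
def incl (ξ : GreatSubsphere m) (y : sphere (0 : ξ.plane) 1) : USphere m :=
  ⟨((y : ξ.plane) : Euc m), by
    have h : ‖(y : ξ.plane)‖ = 1 := norm_eq_of_mem_sphere y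
    rw [mem_sphere_zero_iff_norm]
    exact h⟩

theorem range_incl (ξ : GreatSubsphere m) : range ξ.incl = ξ.carrier := by
  ext y
  constructor
  · rintro ⟨z, rfl⟩
    exact (z : ξ.plane).2
  · intro hy
    refine ⟨⟨⟨y, hy⟩, ?_⟩, rfl⟩
    rw [mem_sphere_zero_iff_norm]
    exact norm_eq_of_mem_sphere y

/-- The double covering `ω ↦ S_{0,ω} = {y ∈ S^{m-1} | ⟨y, ω⟩ = 0}` of `Ξ` by `S^{m-1}`. -/
def ofNormal (ω : USphere m) : GreatSubsphere m :=
  ⟨(ℝ ∙ (ω : Euc m))ᗮ, by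
    have hne : (ω : Euc m) ≠ 0 := ne_zero_of_mem_unit_sphere ω
    have h := (ℝ ∙ (ω : Euc m)).finrank_add_finrank_orthogonal
    rw [finrank_span_singleton hne, finrank_euclideanSpace_fin] at h
    omega⟩

theorem mem_carrier_ofNormal (ω y : USphere m) :
    y ∈ (ofNormal ω).carrier ↔ inner ℝ (y : Euc m) (ω : Euc m) = 0 := by
  rw [real_inner_comm]
  exact Submodule.mem_orthogonal_singleton_iff_inner_right

/-- The Borel structure of `Ξ`, as the quotient of `S^{m-1}` under the double covering. -/
instance : MeasurableSpace (GreatSubsphere m) := MeasurableSpace.map ofNormal inferInstance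

/-- The geodesic distance `d(x, ξ)` on `S^{m-1}`; the geodesic distance of two points of the
sphere is the angle between them. -/
def geoDist (x : USphere m) (ξ : GreatSubsphere m) : ℝ :=
  sInf ((fun y : USphere m => InnerProductGeometry.angle (x : Euc m) (y : Euc m)) '' ξ.carrier)

/-- The unit vector `sin r • x + cos r • η`, for `η` a unit vector orthogonal to `x`. For fixed
`r ∈ [0, π/2]` these are the unit vectors `ω` with `⟨x, ω⟩ = sin r`. -/
def tilt (x : USphere m) (r : ℝ) (η : sphere (0 : (ofNormal x).plane) 1) : USphere m :=
  ⟨Real.sin r • (x : Euc m) + Real.cos r • ((ofNormal x).incl η : Euc m), by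
    have h0 : inner ℝ (x : Euc m) ((ofNormal x).incl η : Euc m) = (0 : ℝ) :=
      Submodule.mem_orthogonal_singleton_iff_inner_right.1 (η : (ofNormal x).plane).2
    have hx : ‖(x : Euc m)‖ = 1 := norm_eq_of_mem_sphere x
    have hη : ‖((ofNormal x).incl η : Euc m)‖ = 1 := norm_eq_of_mem_sphere _
    rw [mem_sphere_zero_iff_norm, ← sq_eq_sq₀ (norm_nonneg _) zero_le_one, norm_add_sq_real,
      norm_smul, norm_smul, inner_smul_left, inner_smul_right, h0, hx, hη]
    simp⟩

/-- The uniform probability measure on the unit sphere `S_{0,x}` of the hyperplane `x^⊥`. -/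
def equatorMeasure (x : USphere m) : Measure (sphere (0 : (ofNormal x).plane) 1) :=
  (surfaceMeasure (ofNormal x).plane univ)⁻¹ • surfaceMeasure (ofNormal x).plane

/-- The normalized measure `μ` on `{ξ ∈ Ξ | d(x, ξ) = r}`, for `0 ≤ r ≤ π/2`, that is invariant
under the isometries fixing `x`: the law of the sub-sphere with unit normal `sin r • x + cos r • η`
when `η` is uniform on `S_{0,x}`. -/
def avgMeasure (x : USphere m) (r : ℝ) : Measure (GreatSubsphere m) :=
  (equatorMeasure x).map (fun η => ofNormal (tilt x r η))

/-- The image of a sub-sphere under a linear isometry. -/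
def mapIsometry (g : Euc m ≃ₗᵢ[ℝ] Euc m) (ξ : GreatSubsphere m) : GreatSubsphere m :=
  ⟨ξ.plane.map (g.toLinearEquiv : Euc m →ₗ[ℝ] Euc m), by
    rw [LinearEquiv.finrank_map_eq]
    exact ξ.finrank_plane⟩


theorem geoDist_ofNormal (hm : 2 ≤ m) (x ω : USphere m) :
    geoDist x (ofNormal ω) = Real.arcsin |inner ℝ (x : Euc m) (ω : Euc m)| := by
  set s : ℝ := inner ℝ (x : Euc m) (ω : Euc m) with hs
  have hx : ‖(x : Euc m)‖ = 1 := norm_eq_of_mem_sphere x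
  have hω : ‖(ω : Euc m)‖ = 1 := norm_eq_of_mem_sphere ω
  have hωω : inner ℝ (ω : Euc m) (ω : Euc m) = (1 : ℝ) := by
    rw [real_inner_self_eq_norm_sq, hω, one_pow]
  set v : Euc m := (x : Euc m) - s • (ω : Euc m) with hv
  have hvω : inner ℝ v (ω : Euc m) = (0 : ℝ) := by
    rw [hv, inner_sub_left, inner_smul_left, hωω, ← hs]
    simp
  have hvn2 : ‖v‖ ^ 2 = 1 - |s| ^ 2 := by
    rw [hv, norm_sub_sq_real, norm_smul, inner_smul_right, ← hs, hx, hω, Real.norm_eq_abs,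
      sq_abs, mul_one, sq_abs]
    ring
  have hvn : ‖v‖ = Real.sqrt (1 - |s| ^ 2) := by
    rw [← hvn2, Real.sqrt_sq (norm_nonneg _)]
  have hinner : ∀ y : USphere m, y ∈ (ofNormal ω).carrier →
      inner ℝ (x : Euc m) (y : Euc m) = (inner ℝ v (y : Euc m) : ℝ) := by
    intro y hy
    rw [mem_carrier_ofNormal, real_inner_comm] at hy
    rw [hv, inner_sub_left, inner_smul_left, hy]
    simp
  have hangle : ∀ y : USphere m,
      InnerProductGeometry.angle (x : Euc m) (y : Euc m)
        = Real.arccos (inner ℝ (x : Euc m) (y : Euc m)) := by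
    intro y
    have hy : ‖(y : Euc m)‖ = 1 := norm_eq_of_mem_sphere y
    rw [InnerProductGeometry.angle, hx, hy, mul_one, div_one]
  rw [Real.arcsin_eq_arccos (abs_nonneg s), ← hvn, geoDist]
  refine IsLeast.csInf_eq ⟨?_, ?_⟩
  · by_cases hv0 : v = 0
    · have hd := (ofNormal ω).finrank_plane
      have hnt : Nontrivial (ofNormal ω).plane :=
        Module.nontrivial_of_finrank_pos (R := ℝ) (by omega)
      obtain ⟨z, hz⟩ := exists_norm_eq (ofNormal ω).plane zero_le_one
      refine ⟨⟨(z : Euc m), ?_⟩, z.2, ?_⟩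
      · rw [mem_sphere_zero_iff_norm]
        exact hz
      · simp only
        rw [hangle ⟨(z : Euc m), by rw [mem_sphere_zero_iff_norm]; exact hz⟩, hinner _ z.2, hv0]
        simp
    · have hvp : ‖v‖ ≠ 0 := norm_ne_zero_iff.2 hv0
      have hmem : ‖v‖⁻¹ • v ∈ sphere (0 : Euc m) 1 := by
        rw [mem_sphere_zero_iff_norm, norm_smul, norm_inv, norm_norm, inv_mul_cancel₀ hvp]
      have hc : (⟨‖v‖⁻¹ • v, hmem⟩ : USphere m) ∈ (ofNormal ω).carrier := by
        rw [mem_carrier_ofNormal, inner_smul_left, hvω, mul_zero]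
      refine ⟨_, hc, ?_⟩
      simp only
      rw [hangle ⟨‖v‖⁻¹ • v, hmem⟩, hinner _ hc, inner_smul_right, real_inner_self_eq_norm_sq, sq,
        inv_mul_cancel_left₀ hvp]
  · rintro _ ⟨y, hy, rfl⟩
    have hyn : ‖(y : Euc m)‖ = 1 := norm_eq_of_mem_sphere y
    simp only
    rw [hangle, hinner y hy]
    refine Real.arccos_le_arccos ?_
    have := real_inner_le_norm v (y : Euc m)
    rwa [hyn, mul_one] at this

theorem measurable_geoDist (hm : 2 ≤ m) (x : USphere m) : Measurable (geoDist x) := by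
  intro s hs
  change MeasurableSet (ofNormal ⁻¹' (geoDist x ⁻¹' s))
  have h : (fun ω => geoDist x (ofNormal ω)) =
      fun ω : USphere m => Real.arcsin |inner ℝ (x : Euc m) (ω : Euc m)| :=
    funext fun ω => geoDist_ofNormal hm x ω
  have hc : Measurable (fun ω => geoDist x (ofNormal ω)) := by
    rw [h]
    exact (Real.continuous_arcsin.comp (by fun_prop)).measurable
  exact hc hs

theorem measurable_ofNormal_tilt (x : USphere m) (r : ℝ) :
    Measurable (fun η => ofNormal (tilt x r η)) := by
  have h1 : Measurable (ofNormal : USphere m → GreatSubsphere m) := fun s hs => hs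
  refine h1.comp (Continuous.measurable ?_)
  unfold tilt incl
  fun_prop

theorem isProbabilityMeasure_avgMeasure (hm : 2 ≤ m) (x : USphere m) (r : ℝ) :
    IsProbabilityMeasure (avgMeasure x r) := by
  have h : IsProbabilityMeasure (equatorMeasure x) := by
    have hd := (ofNormal x).finrank_plane
    have hnt : Nontrivial (ofNormal x).plane := Module.nontrivial_of_finrank_pos (R := ℝ) (by omega)
    refine ⟨?_⟩
    have hfin : IsFiniteMeasure (surfaceMeasure (ofNormal x).plane) := by
      unfold surfaceMeasure; infer_instance
    rw [equatorMeasure, Measure.smul_apply, smul_eq_mul]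
    refine ENNReal.inv_mul_cancel ?_ (measure_ne_top _ _)
    rw [Ne, Measure.measure_univ_eq_zero]
    exact Measure.toSphere_ne_zero _
  exact Measure.isProbabilityMeasure_map (measurable_ofNormal_tilt x r).aemeasurable

theorem ae_avgMeasure_geoDist (hm : 2 ≤ m) (x : USphere m) {r : ℝ} (h0 : 0 ≤ r)
    (h1 : r ≤ Real.pi / 2) : ∀ᵐ ξ ∂(avgMeasure x r), geoDist x ξ = r := by
  have hs : MeasurableSet {ξ : GreatSubsphere m | geoDist x ξ = r} :=
    measurable_geoDist hm x (measurableSet_singleton r)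
  rw [avgMeasure, ae_map_iff (measurable_ofNormal_tilt x r).aemeasurable hs]
  refine Filter.Eventually.of_forall fun η => ?_
  rw [geoDist_ofNormal hm]
  have h0' : inner ℝ (x : Euc m) ((ofNormal x).incl η : Euc m) = (0 : ℝ) :=
    Submodule.mem_orthogonal_singleton_iff_inner_right.1 (η : (ofNormal x).plane).2
  have hx : inner ℝ (x : Euc m) (x : Euc m) = (1 : ℝ) := by
    rw [real_inner_self_eq_norm_sq, norm_eq_of_mem_sphere x, one_pow]
  have : inner ℝ (x : Euc m) (tilt x r η : Euc m) = Real.sin r := by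
    rw [tilt, inner_add_right, inner_smul_right, inner_smul_right, h0', hx]
    simp
  rw [this, abs_of_nonneg (Real.sin_nonneg_of_nonneg_of_le_pi h0 (by linarith [Real.pi_pos])),
    Real.arcsin_sin (by linarith) h1]

/-- The map induced on the unit sphere by a linear isometry. -/
def sphereMap {V : Type*} [NormedAddCommGroup V] [InnerProductSpace ℝ V] (e : V ≃ₗᵢ[ℝ] V)
    (y : sphere (0 : V) 1) : sphere (0 : V) 1 :=
  ⟨e y, by rw [mem_sphere_zero_iff_norm, e.norm_map]; exact norm_eq_of_mem_sphere y⟩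

theorem map_surfaceMeasure {V : Type*} [NormedAddCommGroup V] [InnerProductSpace ℝ V]
    [FiniteDimensional ℝ V] [MeasurableSpace V] [BorelSpace V] (e : V ≃ₗᵢ[ℝ] V) :
    (surfaceMeasure V).map (sphereMap e) = surfaceMeasure V := by
  have hc : Continuous (sphereMap e) := by
    unfold sphereMap
    exact (e.continuous.comp continuous_subtype_val).subtype_mk _
  ext s hs
  rw [Measure.map_apply hc.measurable hs, surfaceMeasure,
    Measure.toSphere_apply' _ (hc.measurable hs), Measure.toSphere_apply' _ hs]
  congr 1
  have hset : Ioo (0 : ℝ) 1 • ((↑) '' (sphereMap e ⁻¹' s) : Set V)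
      = e ⁻¹' (Ioo (0 : ℝ) 1 • ((↑) '' s : Set V)) := by
    ext z
    simp only [mem_smul, mem_image, mem_preimage]
    constructor
    · rintro ⟨t, ht, _, ⟨y, hy, rfl⟩, rfl⟩
      exact ⟨t, ht, e y, ⟨sphereMap e y, hy, rfl⟩, (e.map_smul t (y : V)).symm⟩
    · rintro ⟨t, ht, _, ⟨y, hy, rfl⟩, hz⟩
      have hy' : e.symm (y : V) ∈ sphere (0 : V) 1 := by
        rw [mem_sphere_zero_iff_norm, e.symm.norm_map]
        exact norm_eq_of_mem_sphere y
      refine ⟨t, ht, e.symm y, ⟨⟨e.symm y, hy'⟩, ?_, rfl⟩, ?_⟩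
      · have : sphereMap e ⟨e.symm y, hy'⟩ = y := Subtype.ext (e.apply_symm_apply _)
        rwa [this]
      · rw [← e.symm.map_smul, hz, e.symm_apply_apply]
  rw [hset]
  exact (LinearIsometryEquiv.measurePreserving e).measure_preimage_equiv
    (f := e.toHomeomorph.toMeasurableEquiv) _

/-- A linear isometry maps the sub-sphere orthogonal to `ω` to the one orthogonal to `g ω`. -/
theorem mapIsometry_ofNormal (g : Euc m ≃ₗᵢ[ℝ] Euc m) (ω : USphere m) :
    mapIsometry g (ofNormal ω) = ofNormal (sphereMap g ω) := by
  refine GreatSubsphere.ext ?_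
  have h := Submodule.map_orthogonal_equiv (ℝ ∙ (ω : Euc m)) g
  refine h.trans ?_
  change _ = (ℝ ∙ (g (ω : Euc m)))ᗮ
  rw [Submodule.map_span, image_singleton]
  rfl

/-- `avgMeasure x r` is invariant under all linear isometries that fix `x`. -/
theorem map_mapIsometry_avgMeasure (x : USphere m) (r : ℝ) (g : Euc m ≃ₗᵢ[ℝ] Euc m)
    (hg : g (x : Euc m) = x) : (avgMeasure x r).map (mapIsometry g) = avgMeasure x r := by
  have hgx : sphereMap g x = x := Subtype.ext hg
  have hW : (ofNormal x).plane.map (g.toLinearEquiv : Euc m →ₗ[ℝ] Euc m) = (ofNormal x).plane := by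
    have := congrArg plane (mapIsometry_ofNormal g x)
    rwa [hgx] at this
  let e : (ofNormal x).plane ≃ₗᵢ[ℝ] (ofNormal x).plane :=
    (LinearIsometryEquiv.submoduleMap (ofNormal x).plane g).trans (LinearIsometryEquiv.ofEq _ _ hW)
  have he : ∀ η, mapIsometry g (ofNormal (tilt x r η)) = ofNormal (tilt x r (sphereMap e η)) := by
    intro η
    rw [mapIsometry_ofNormal]
    congr 1
    refine Subtype.ext ?_
    change g (Real.sin r • (x : Euc m) + Real.cos r • ((η : (ofNormal x).plane) : Euc m)) = _
    rw [map_add, map_smul, map_smul, hg]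
    rfl
  have hmap : Measurable (mapIsometry g : GreatSubsphere m → GreatSubsphere m) := by
    intro s hs
    change MeasurableSet (ofNormal ⁻¹' (mapIsometry g ⁻¹' s))
    have : ofNormal ⁻¹' (mapIsometry g ⁻¹' s) = sphereMap g ⁻¹' (ofNormal ⁻¹' s) := by
      ext ω
      simp only [mem_preimage, mapIsometry_ofNormal]
    rw [this]
    have hc : Continuous (sphereMap g) := by
      unfold sphereMap
      exact (g.continuous.comp continuous_subtype_val).subtype_mk _
    exact hc.measurable hs
  have hce : Measurable (sphereMap e) := by
    unfold sphereMap
    exact ((e.continuous.comp continuous_subtype_val).subtype_mk _).measurable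
  have hinv : (equatorMeasure x).map (sphereMap e) = equatorMeasure x := by
    rw [equatorMeasure, Measure.map_smul, map_surfaceMeasure]
  rw [avgMeasure, Measure.map_map hmap (measurable_ofNormal_tilt x r)]
  conv_rhs => rw [← hinv, Measure.map_map (measurable_ofNormal_tilt x r) hce]
  congr 1
  exact funext he

end GreatSubsphere

open GreatSubsphere

/-- The spherical Radon transform `f̂(ξ) = ∫_ξ f dS`. -/
def radon {m : ℕ} (f : USphere m → ℂ) (ξ : GreatSubsphere m) : ℂ :=
  ∫ y, f (ξ.incl y) ∂(surfaceMeasure ξ.plane)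

/-- The average `φ^∨_r(x)` of `φ` over the great sub-spheres at geodesic distance `r` from `x`. -/
def dualRadon {m : ℕ} (φ : GreatSubsphere m → ℂ) (r : ℝ) (x : USphere m) : ℂ :=
  ∫ ξ, φ ξ ∂(avgMeasure x r)

/-- The integrand `(f̂)^∨_{arccos q}(x) q^{m-2} (t² - q²)^{(m-4)/2}`. -/
def inversionIntegrand {m : ℕ} (f : USphere m → ℂ) (x : USphere m) (t q : ℝ) : ℂ :=
  dualRadon (radon f) (Real.arccos q) x *
    ((q ^ (m - 2) * (t ^ 2 - q ^ 2) ^ (((m : ℝ) - 4) / 2) : ℝ) : ℂ)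

/-- `t ↦ ∫_0^t (f̂)^∨_{arccos q}(x) q^{m-2} (t² - q²)^{(m-4)/2} dq`, a function on `(0, 1]`. -/
def inversionIntegral {m : ℕ} (f : USphere m → ℂ) (x : USphere m) (t : ℝ) : ℂ :=
  ∫ q in (0 : ℝ)..t, inversionIntegrand f x t q

/-- `(d/dt²)^n [H(t)]` at `t = 1`, for `H` defined on `(0, 1]`: the `n`-th (one-sided) derivative at
`u = 1` of `H` as a function of `u = t²`. -/
def sqDerivAtOne (n : ℕ) (H : ℝ → ℂ) : ℂ :=
  iteratedDerivWithin n (fun u : ℝ => H (Real.sqrt u)) (Ioc 0 1) 1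

/-- `H`, defined on `(0, 1]`, is `n` times differentiable in `u = t²` at `t = 1` from the left: the
derivatives of order `< n` exist and are continuous on `(0, 1]`, and are differentiable at `1`. -/
def SqDifferentiableAtOne (n : ℕ) (H : ℝ → ℂ) : Prop :=
  ∀ k < n, ContDiffOn ℝ k (fun u : ℝ => H (Real.sqrt u)) (Ioc 0 1) ∧
    DifferentiableWithinAt ℝ (iteratedDerivWithin k (fun u : ℝ => H (Real.sqrt u)) (Ioc 0 1))
      (Ioc 0 1) 1

/-- The right-hand side of the inversion formula for `f` is meaningful at `x`: for almost every `q`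
the average of `f̂` over the sub-spheres at distance `arccos q` from `x` is the integral of an
integrable function, the integral over `q ∈ (0, t)` converges for all `t ∈ (0, 1]`, and it can be
differentiated `m - 2` times with respect to `t²` at `t = 1`. -/
def InversionDefinedAt {m : ℕ} (f : USphere m → ℂ) (x : USphere m) : Prop :=
  (∀ᵐ q : ℝ, q ∈ Ioo (0 : ℝ) 1 → Integrable (radon f) (avgMeasure x (Real.arccos q))) ∧
  (∀ t ∈ Ioc (0 : ℝ) 1, IntervalIntegrable (inversionIntegrand f x t) volume 0 t) ∧
  SqDifferentiableAtOne (m - 2) (inversionIntegral f x)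

end

/-! Fix a point `x` of the sphere and let `F v` be the mean of `f` over the parallel
`{y | ⟨x, y⟩ = v}`. The formula holds because its right-hand side only depends on `F`, and recovers
`F 1 = f x` from it.

*The dual transform.* Average `∫_ξ f dS` over the `ξ` at distance `arccos q` from `x`. Rotating a
single such `ξ` about the axis `x` (a random rotation taken from Haar measure on the orthogonal
group of `x^⊥`) replaces `f` by its means over parallels. On `ξ` the function `⟨x, ·⟩` is
`q ⟨e, ·⟩` with a unit vector `e`, and the law of a coordinate on a sphere is known, so that the
average is `σ_{m-2} ∫_{-1}^1 F(q s) (1 - s²)^{(m-4)/2} ds` (`lintegral_equatorKernel_tilt`). For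
even `f` this is `2 σ_{m-2} q^{3-m} ∫_0^q F(v) (q² - v²)^{(m-4)/2} dv` (`dualRadon_radon`).
Measurability in `ξ` comes from a formula for `∫_ξ f dS` as a Gaussian integral over the whole of
`ℝ^m` (`lintegral_incl`).

*Abel transforms.* The integral over `q` in the theorem then composes two Abel type transforms. By
Fubini and a Beta integral it equals `C ∫_0^t F(v) (t² - v²)^{m-3} dv` with
`C = σ_{m-2} B((m-2)/2, (m-2)/2)` (`abel_composition`). With `u = t²`, the derivative of order
`m - 3` is `C (m-3)! ∫_0^{√u} F`, a continuous function of `u`, and its derivative at `u = 1` is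
`C (m-3)! F(1) / 2`, as soon as `F` tends to `F 1` in the mean
(`hasDerivWithinAt_truncMoment_zero`). The constant `2^{m-3} C = σ_{m-1}` is the duplication
formula for the Gamma function (`sphereArea_succ_succ`). This is `inversion_of_mean`.

*The points `x`.* The mean convergence of `F` holds where `f` is continuous, and at every Lebesgue
point of `f` (`mean_of_lebesgue_point`); almost all points of the sphere are Lebesgue points, as
one sees from the homogeneous extension of `f` to `ℝ^m` (`ae_lebesgue_point`). Finally `f` may be
replaced by a measurable function that is even without exceptions: for *every* `x` and
`q ∈ (0, 1)`, a null set of the sphere meets almost all `ξ` at distance `arccos q` from `x` in a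
null set (`inversion_congr`).

The dimension is written `m = k + 3` (or `k + 2` where `m = 2` is allowed), which avoids truncated
subtraction; then `(m - 4) / 2 = (k - 1) / 2` and `m - 3 = k`. Integrals of nonnegative functions
are taken in `ℝ≥0∞` throughout, so that no integrability has to be known in advance. -/

open scoped ENNReal

namespace SphericalRadon
open GreatSubsphere ProbabilityTheory Filter Topology

/-! ### Integration over the unit sphere of a Euclidean space -/

section Sphere

universe u

variable {V : Type u} [NormedAddCommGroup V] [InnerProductSpace ℝ V] [FiniteDimensional ℝ V]

theorem continuous_sphereMap_apply :
    Continuous fun p : unitary (V →L[ℝ] V) × sphere (0 : V) 1 =>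
      GreatSubsphere.sphereMap (Unitary.linearIsometryEquiv p.1) p.2 := by
  have : Continuous fun p : unitary (V →L[ℝ] V) × sphere (0 : V) 1 =>
      (p.1 : V →L[ℝ] V) (p.2 : V) := by fun_prop
  exact this.subtype_mk _

/-- The orthogonal group acts transitively on the unit sphere, already by reflections. -/
theorem exists_isometry_map_eq (y z : sphere (0 : V) 1) :
    ∃ k : unitary (V →L[ℝ] V),
      GreatSubsphere.sphereMap (Unitary.linearIsometryEquiv k) y = z := by
  refine ⟨Unitary.linearIsometryEquiv.symm (ℝ ∙ ((y : V) - z))ᗮ.reflection, Subtype.ext ?_⟩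
  rw [MulEquiv.apply_symm_apply]
  refine Submodule.reflection_sub ?_
  rw [norm_eq_of_mem_sphere y, norm_eq_of_mem_sphere z]

variable [MeasurableSpace V] [BorelSpace V]

instance : IsFiniteMeasure (surfaceMeasure V) := by
  unfold surfaceMeasure; infer_instance

/-- Integration in polar coordinates. -/
theorem lintegral_polar [Nontrivial V] {Ψ : V → ℝ≥0∞} (hΨ : Measurable Ψ) :
    ∫⁻ v, Ψ v = ∫⁻ y : sphere (0 : V) 1, (∫⁻ r in Ioi (0 : ℝ),
      ENNReal.ofReal (r ^ (Module.finrank ℝ V - 1)) * Ψ (r • (y : V))) ∂(surfaceMeasure V) := by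
  have h := (volume : Measure V).measurePreserving_homeomorphUnitSphereProd
  have h0 : ∫⁻ v, Ψ v = ∫⁻ v : ({0}ᶜ : Set V), Ψ v ∂((volume : Measure V).comap (↑)) := by
    rw [lintegral_subtype_comap (measurableSet_singleton _).compl, restrict_compl_singleton]
  have hf : Measurable fun p : sphere (0 : V) 1 × Ioi (0 : ℝ) => Ψ ((p.2 : ℝ) • (p.1 : V)) :=
    hΨ.comp (by fun_prop)
  have h1 := h.lintegral_comp hf
  have h2 : ∀ v : ({0}ᶜ : Set V), ((homeomorphUnitSphereProd V v).2 : ℝ) •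
      ((homeomorphUnitSphereProd V v).1 : V) = v := fun v =>
    congrArg Subtype.val ((homeomorphUnitSphereProd V).symm_apply_apply v)
  simp only [h2] at h1
  rw [h0, h1, lintegral_prod _ hf.aemeasurable]
  refine lintegral_congr fun y => ?_
  have hy : Measurable fun r : Ioi (0 : ℝ) => Ψ ((r : ℝ) • (y : V)) := hΨ.comp (by fun_prop)
  rw [Measure.volumeIoiPow, lintegral_withDensity_eq_lintegral_mul _ (by fun_prop) hy,
    ← lintegral_subtype_comap measurableSet_Ioi]
  rfl

theorem surfaceMeasure_univ [Nontrivial V] :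
    surfaceMeasure V univ = ENNReal.ofReal (sphereArea (Module.finrank ℝ V)) := by
  have hn : 0 < Module.finrank ℝ V := Module.finrank_pos
  have hn' : (0 : ℝ) < Module.finrank ℝ V := by exact_mod_cast hn
  have hG : Real.Gamma ((Module.finrank ℝ V : ℝ) / 2) ≠ 0 :=
    (Real.Gamma_pos_of_pos (by positivity)).ne'
  rw [surfaceMeasure, Measure.toSphere_apply_univ, InnerProductSpace.volume_ball,
    ENNReal.ofReal_one, one_pow, one_mul, ← ENNReal.ofReal_natCast, ← ENNReal.ofReal_mul hn'.le,
    sphereArea, Real.Gamma_add_one (by positivity), Real.sqrt_eq_rpow, ← Real.rpow_natCast,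
    ← Real.rpow_mul Real.pi_pos.le]
  congr 1
  rw [one_div_mul_eq_div]
  field_simp

theorem sphereArea_pos {n : ℕ} (hn : 0 < n) : 0 < sphereArea n := by
  have : (0 : ℝ) < n := by exact_mod_cast hn
  have := Real.Gamma_pos_of_pos (show (0 : ℝ) < n / 2 by positivity)
  unfold sphereArea
  positivity

/-- Fubini's theorem for the splitting of the space into the line of a unit vector `e` and `e^⊥`. -/
theorem lintegral_orthogonal {e : V} (he : ‖e‖ = 1) {Φ : V → ℝ≥0∞} (hΦ : Measurable Φ) :
    ∫⁻ w, Φ w = ∫⁻ a : ℝ, ∫⁻ v : (ℝ ∙ e)ᗮ, Φ (a • e + v) := by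
  have h1 := (ℝ ∙ e).orthogonalDecomposition.symm.measurePreserving
  have h2 := WithLp.volume_preserving_toLp (ℝ ∙ e) (ℝ ∙ e)ᗮ
  have h3 := (LinearIsometryEquiv.toSpanUnitSingleton (𝕜 := ℝ) e he).measurePreserving
  have h4 := h1.comp (h2.comp (h3.prod (MeasurePreserving.id (volume : Measure (ℝ ∙ e)ᗮ))))
  have h5 := h4.lintegral_comp hΦ
  rw [← h5, lintegral_prod]
  · refine lintegral_congr fun a => lintegral_congr fun v => ?_
    simp
  · exact (hΦ.comp h4.measurable).aemeasurable

/-- The radial Gaussian moment `∫_0^∞ rⁿ e^{-r²} dr`. Its value plays no role, only that it is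
neither `0` nor `∞`. -/
noncomputable def gaussianMoment (n : ℕ) : ℝ≥0∞ :=
  ∫⁻ r in Ioi (0 : ℝ), ENNReal.ofReal (r ^ n) * ENNReal.ofReal (Real.exp (-r ^ 2))

theorem gaussianMoment_ne_zero (n : ℕ) : gaussianMoment n ≠ 0 := by
  rw [gaussianMoment, Ne, lintegral_eq_zero_iff (by fun_prop)]
  intro h
  have h' : ∀ᵐ r : ℝ ∂volume.restrict (Ioi (0 : ℝ)), False := by
    filter_upwards [h, ae_restrict_mem measurableSet_Ioi] with r hr (hr0 : 0 < r)
    rw [Pi.zero_apply, ← ENNReal.ofReal_mul (by positivity), ENNReal.ofReal_eq_zero] at hr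
    have : 0 < r ^ n * Real.exp (-r ^ 2) := by positivity
    linarith
  have h0 : volume (Ioi (0 : ℝ)) = 0 := by
    rw [← Measure.restrict_apply_univ]
    exact (ae_iff (p := fun _ : ℝ => False)).1 h' ▸ by simp
  simp at h0

theorem gaussianMoment_ne_top (n : ℕ) : gaussianMoment n ≠ ⊤ := by
  have h := (integrable_rpow_mul_exp_neg_mul_sq (b := 1) one_pos (s := n)
    (by linarith [n.cast_nonneg (α := ℝ)])).integrableOn (s := Ioi 0)
  have h2 := h.hasFiniteIntegral
  refine ne_of_lt (lt_of_le_of_lt (lintegral_mono fun r => ?_) h2)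
  rw [← ofReal_norm, ← ENNReal.ofReal_mul' (Real.exp_nonneg _)]
  refine ENNReal.ofReal_le_ofReal ?_
  simpa [Real.rpow_natCast] using le_abs_self (r ^ n * Real.exp (-r ^ 2))

/-- Integrals over the sphere as Gaussian integrals of homogeneous functions of degree `0`. -/
theorem lintegral_sphere_mul_gaussianMoment [Nontrivial V] {n : ℕ}
    (hn : Module.finrank ℝ V = n + 1) {h : V → ℝ≥0∞} (hh : Measurable h)
    (hom : ∀ r : ℝ, 0 < r → ∀ v, h (r • v) = h v) :
    (∫⁻ y : sphere (0 : V) 1, h y ∂(surfaceMeasure V)) * gaussianMoment n =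
      ∫⁻ v, h v * ENNReal.ofReal (Real.exp (-‖v‖ ^ 2)) := by
  rw [lintegral_polar (by fun_prop), ← lintegral_mul_const _ (by fun_prop)]
  refine lintegral_congr fun y => ?_
  rw [gaussianMoment, ← lintegral_const_mul _ (by fun_prop)]
  refine setLIntegral_congr_fun measurableSet_Ioi fun r (hr : 0 < r) => ?_
  have hy : ‖(y : V)‖ = 1 := norm_eq_of_mem_sphere y
  simp only [hom r hr, hn, Nat.add_sub_cancel, norm_smul, hy, mul_one, Real.norm_eq_abs, sq_abs]
  ring

/-- The integral over the half plane `r > 0` in polar coordinates `a = R cos θ`, `r = R sin θ`,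
followed by the substitution `s = cos θ`. -/
theorem lintegral_halfPlane_gaussian {H : ℝ → ℝ≥0∞} (hH : Measurable H) (n : ℕ) :
    ∫⁻ a : ℝ, ∫⁻ r in Ioi (0 : ℝ), ENNReal.ofReal (r ^ n) *
      (H (a / √(a ^ 2 + r ^ 2)) * ENNReal.ofReal (Real.exp (-(a ^ 2 + r ^ 2)))) =
    gaussianMoment (n + 1) * ∫⁻ s in Ioo (-1 : ℝ) 1, H s *
      ENNReal.ofReal ((1 - s ^ 2) ^ (((n : ℝ) - 1) / 2)) := by
  set f : ℝ × ℝ → ℝ≥0∞ := fun p => (Ioi (0 : ℝ)).indicator (fun r => ENNReal.ofReal (r ^ n) *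
      (H (p.1 / √(p.1 ^ 2 + r ^ 2)) * ENNReal.ofReal (Real.exp (-(p.1 ^ 2 + r ^ 2))))) p.2 with hf
  have hfm : Measurable f := by
    have : f = ((fun p : ℝ × ℝ => p.2) ⁻¹' Ioi 0).indicator (fun p => ENNReal.ofReal (p.2 ^ n) *
      (H (p.1 / √(p.1 ^ 2 + p.2 ^ 2)) * ENNReal.ofReal (Real.exp (-(p.1 ^ 2 + p.2 ^ 2))))) := by
      ext p
      simp [hf, indicator]
    rw [this]
    exact Measurable.indicator (by fun_prop) (measurable_snd measurableSet_Ioi)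
  have h1 : ∫⁻ a : ℝ, ∫⁻ r in Ioi (0 : ℝ), ENNReal.ofReal (r ^ n) *
      (H (a / √(a ^ 2 + r ^ 2)) * ENNReal.ofReal (Real.exp (-(a ^ 2 + r ^ 2)))) = ∫⁻ p, f p := by
    rw [Measure.volume_eq_prod, lintegral_prod _ hfm.aemeasurable]
    refine lintegral_congr fun a => ?_
    rw [← lintegral_indicator measurableSet_Ioi]
  have h2 : ∀ p ∈ polarCoord.target, ENNReal.ofReal p.1 • f (polarCoord.symm p) =
      (Ioo 0 Real.pi).indicator (fun θ => ENNReal.ofReal (Real.sin θ ^ n) * H (Real.cos θ)) p.2 *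
      (ENNReal.ofReal (p.1 ^ (n + 1)) * ENNReal.ofReal (Real.exp (-p.1 ^ 2))) := by
    rintro ⟨R, θ⟩ ⟨hR, hθ⟩
    simp only [mem_Ioi, mem_Ioo] at hR hθ
    simp only [polarCoord_symm_apply, hf, smul_eq_mul]
    by_cases h0 : 0 < θ
    · have hs := Real.sin_pos_of_pos_of_lt_pi h0 hθ.2
      rw [indicator_of_mem (show R * Real.sin θ ∈ Ioi (0 : ℝ) from mul_pos hR hs),
        indicator_of_mem (show θ ∈ Ioo 0 Real.pi from ⟨h0, hθ.2⟩)]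
      have e1 : (R * Real.cos θ) ^ 2 + (R * Real.sin θ) ^ 2 = R ^ 2 := by
        linear_combination R ^ 2 * Real.cos_sq_add_sin_sq θ
      rw [e1, Real.sqrt_sq hR.le, mul_div_cancel_left₀ _ hR.ne', mul_pow, pow_succ R n,
        ENNReal.ofReal_mul (by positivity), ENNReal.ofReal_mul (by positivity)]
      ring
    · have hs : Real.sin θ ≤ 0 := Real.sin_nonpos_of_nonpos_of_neg_pi_le (by linarith) hθ.1.le
      rw [indicator_of_notMem, indicator_of_notMem (fun h => h0 h.1)]
      · simp
      · simp only [mem_Ioi, not_lt]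
        exact mul_nonpos_of_nonneg_of_nonpos hR.le hs
  have h3 : ∫⁻ s in Ioo (-1 : ℝ) 1, H s * ENNReal.ofReal ((1 - s ^ 2) ^ (((n : ℝ) - 1) / 2)) =
      ∫⁻ θ in Ioo 0 Real.pi, ENNReal.ofReal (Real.sin θ ^ n) * H (Real.cos θ) := by
    have him : Real.cos '' Ioo 0 Real.pi = Ioo (-1) 1 := by
      ext s
      constructor
      · rintro ⟨θ, hθ, rfl⟩
        have hs := Real.sin_pos_of_pos_of_lt_pi hθ.1 hθ.2
        have := Real.cos_sq_add_sin_sq θ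
        exact abs_lt.1 (by rw [← sq_lt_one_iff_abs_lt_one]; nlinarith)
      · rintro ⟨h1, h2⟩
        exact ⟨Real.arccos s, ⟨Real.arccos_pos.2 h2, by
          rw [lt_iff_le_and_ne]
          exact ⟨Real.arccos_le_pi s, fun h => by
            rw [Real.arccos_eq_pi] at h; linarith⟩⟩, Real.cos_arccos h1.le h2.le⟩
    rw [← him, lintegral_image_eq_lintegral_abs_deriv_mul measurableSet_Ioo
      (fun θ _ => (Real.hasDerivAt_cos θ).hasDerivWithinAt)
      (Real.injOn_cos.mono Ioo_subset_Icc_self)]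
    refine setLIntegral_congr_fun measurableSet_Ioo fun θ hθ => ?_
    have hs := Real.sin_pos_of_pos_of_lt_pi hθ.1 hθ.2
    have e1 : 1 - Real.cos θ ^ 2 = Real.sin θ ^ (2 : ℝ) := by
      rw [Real.rpow_two]; linarith [Real.cos_sq_add_sin_sq θ]
    rw [abs_neg, abs_of_pos hs, e1, ← Real.rpow_mul hs.le, mul_left_comm,
      ← ENNReal.ofReal_mul hs.le, mul_comm]
    congr 2
    rw [← Real.rpow_natCast]
    nth_rewrite 1 [← Real.rpow_one (Real.sin θ)]
    rw [← Real.rpow_add hs]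
    congr 1
    ring
  rw [h1, ← lintegral_comp_polarCoord_symm, setLIntegral_congr_fun
    polarCoord.open_target.measurableSet h2, polarCoord_target, Measure.volume_eq_prod,
    ← Measure.prod_restrict]
  have hm1 : Measurable ((Ioo 0 Real.pi).indicator
      (fun θ => ENNReal.ofReal (Real.sin θ ^ n) * H (Real.cos θ))) :=
    Measurable.indicator (by fun_prop) measurableSet_Ioo
  rw [lintegral_prod _ (by fun_prop)]
  simp only
  have h4 : ∀ R : ℝ, ∫⁻ θ in Ioo (-Real.pi) Real.pi, (Ioo 0 Real.pi).indicator
      (fun θ => ENNReal.ofReal (Real.sin θ ^ n) * H (Real.cos θ)) θ *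
      (ENNReal.ofReal (R ^ (n + 1)) * ENNReal.ofReal (Real.exp (-R ^ 2))) =
      (ENNReal.ofReal (R ^ (n + 1)) * ENNReal.ofReal (Real.exp (-R ^ 2))) *
      ∫⁻ θ in Ioo 0 Real.pi, ENNReal.ofReal (Real.sin θ ^ n) * H (Real.cos θ) := by
    intro R
    rw [lintegral_mul_const _ hm1, mul_comm, setLIntegral_indicator measurableSet_Ioo]
    congr 3
    exact inter_eq_left.2 (Ioo_subset_Ioo_left (by linarith [Real.pi_pos]))
  simp only [h4]
  rw [lintegral_mul_const _ (by fun_prop), ← h3, gaussianMoment]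

/-- The law of a coordinate `⟨e, y⟩` on the unit sphere of dimension `n + 1`. -/
theorem lintegral_sphere_inner {n : ℕ} (hn : Module.finrank ℝ V = n + 2) {e : V} (he : ‖e‖ = 1)
    {H : ℝ → ℝ≥0∞} (hH : Measurable H) :
    ∫⁻ y : sphere (0 : V) 1, H (inner ℝ e (y : V)) ∂(surfaceMeasure V) =
      ENNReal.ofReal (sphereArea (n + 1)) * ∫⁻ s in Ioo (-1 : ℝ) 1, H s *
        ENNReal.ofReal ((1 - s ^ 2) ^ (((n : ℝ) - 1) / 2)) := by
  have hne : e ≠ 0 := fun h => by simp [h] at he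
  have : Nontrivial V := Module.nontrivial_of_finrank_pos (R := ℝ) (by omega)
  have hfr : Module.finrank ℝ (ℝ ∙ e)ᗮ = n + 1 := by
    have h := (ℝ ∙ e).finrank_add_finrank_orthogonal
    rw [finrank_span_singleton hne] at h
    omega
  have : Nontrivial (ℝ ∙ e)ᗮ := Module.nontrivial_of_finrank_pos (R := ℝ) (by omega)
  have h1 := lintegral_sphere_mul_gaussianMoment (V := V) (n := n + 1) hn
    (h := fun v => H (inner ℝ e v / ‖v‖)) (by fun_prop) (by
      intro r hr v
      rw [inner_smul_right, norm_smul, Real.norm_of_nonneg hr.le, mul_div_mul_left _ _ hr.ne'])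
  have h2 : ∀ y : sphere (0 : V) 1, ‖(y : V)‖ = 1 := fun y => norm_eq_of_mem_sphere y
  simp only [h2, div_one] at h1
  rw [lintegral_orthogonal he (by fun_prop)] at h1
  have hee : inner ℝ e e = (1 : ℝ) := by rw [real_inner_self_eq_norm_sq, he, one_pow]
  have h3 : ∀ (a : ℝ) (v : (ℝ ∙ e)ᗮ), H (inner ℝ e (a • e + (v : V)) / ‖a • e + (v : V)‖) *
      ENNReal.ofReal (Real.exp (-‖a • e + (v : V)‖ ^ 2)) =
      H (a / √(a ^ 2 + ‖v‖ ^ 2)) * ENNReal.ofReal (Real.exp (-(a ^ 2 + ‖v‖ ^ 2))) := by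
    intro a v
    have hev : inner ℝ e (v : V) = (0 : ℝ) :=
      Submodule.mem_orthogonal_singleton_iff_inner_right.1 v.2
    have hsq : ‖a • e + (v : V)‖ ^ 2 = a ^ 2 + ‖v‖ ^ 2 := by
      rw [norm_add_sq_real, inner_smul_left, hev, norm_smul, he, mul_one, Real.norm_eq_abs, sq_abs]
      simp
    rw [hsq, ← hsq, Real.sqrt_sq (norm_nonneg _), hsq, inner_add_right, inner_smul_right, hev, hee,
      mul_one, add_zero]
  have h4 : ∀ a : ℝ, ∫⁻ v : (ℝ ∙ e)ᗮ, H (a / √(a ^ 2 + ‖v‖ ^ 2)) *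
      ENNReal.ofReal (Real.exp (-(a ^ 2 + ‖v‖ ^ 2))) = ENNReal.ofReal (sphereArea (n + 1)) *
      ∫⁻ r in Ioi (0 : ℝ), ENNReal.ofReal (r ^ n) *
      (H (a / √(a ^ 2 + r ^ 2)) * ENNReal.ofReal (Real.exp (-(a ^ 2 + r ^ 2)))) := by
    intro a
    rw [lintegral_polar (by fun_prop), mul_comm, ← hfr, ← surfaceMeasure_univ,
      ← setLIntegral_const, setLIntegral_univ]
    refine lintegral_congr fun y => setLIntegral_congr_fun measurableSet_Ioi
      fun r (hr : 0 < r) => ?_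
    have hy : ‖(y : (ℝ ∙ e)ᗮ)‖ = 1 := norm_eq_of_mem_sphere y
    simp only [norm_smul, hy, mul_one, Real.norm_eq_abs, sq_abs, hfr, Nat.add_sub_cancel]
  simp only [h3, h4] at h1
  rw [lintegral_const_mul' _ _ ENNReal.ofReal_ne_top, lintegral_halfPlane_gaussian hH,
    mul_left_comm, mul_comm] at h1
  exact (ENNReal.mul_right_inj (gaussianMoment_ne_zero _) (gaussianMoment_ne_top _)).1 h1

theorem lintegral_sphereMap (e : V ≃ₗᵢ[ℝ] V) {h : sphere (0 : V) 1 → ℝ≥0∞} (hh : Measurable h) :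
    ∫⁻ z, h (GreatSubsphere.sphereMap e z) ∂(surfaceMeasure V) =
      ∫⁻ z, h z ∂(surfaceMeasure V) := by
  have hc : Continuous (GreatSubsphere.sphereMap e) :=
    (e.continuous.comp continuous_subtype_val).subtype_mk _
  conv_rhs => rw [← GreatSubsphere.map_surfaceMeasure e]
  rw [lintegral_map hh hc.measurable]

/-- There is a random linear isometry of `V` that moves every unit vector to a uniformly
distributed one: take it distributed according to the Haar measure of the orthogonal group. -/
theorem exists_random_isometry [Nontrivial V] :
    ∃ (Ω : Type u) (_ : MeasurableSpace Ω) (κ : Measure Ω) (g : Ω → V ≃ₗᵢ[ℝ] V),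
      IsProbabilityMeasure κ ∧ Measurable (fun p : Ω × V => g p.1 p.2) ∧
      ∀ h : sphere (0 : V) 1 → ℝ≥0∞, Measurable h → ∀ y,
        ∫⁻ k, h (GreatSubsphere.sphereMap (g k) y) ∂κ =
          (surfaceMeasure V univ)⁻¹ * ∫⁻ z, h z ∂(surfaceMeasure V) := by
  have hcomp : CompactSpace (unitary (V →L[ℝ] V)) := by
    refine isCompact_iff_compactSpace.1 (Metric.isCompact_of_isClosed_isBounded
      isClosed_unitary (isBounded_iff_forall_norm_le.2 ⟨1, fun k hk => ?_⟩))
    exact ContinuousLinearMap.opNorm_le_bound _ zero_le_one fun v => by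
      rw [one_mul, Unitary.norm_map ⟨k, hk⟩ v]
  set μ : Measure (unitary (V →L[ℝ] V)) := Measure.haarMeasure ⊤ with hμ
  have hμp : IsProbabilityMeasure μ := ⟨by
    have := Measure.haarMeasure_self (K₀ := (⊤ : TopologicalSpace.PositiveCompacts
      (unitary (V →L[ℝ] V))))
    simpa using this⟩
  have hs0 : surfaceMeasure V univ ≠ 0 := by
    rw [Ne, Measure.measure_univ_eq_zero]
    exact Measure.toSphere_ne_zero _
  refine ⟨unitary (V →L[ℝ] V), inferInstance, μ, fun k => Unitary.linearIsometryEquiv k⁻¹, hμp,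
    ?_, fun h hh y => ?_⟩
  · have : Continuous fun p : unitary (V →L[ℝ] V) × V => ((p.1⁻¹ : unitary (V →L[ℝ] V)) :
      V →L[ℝ] V) p.2 := by fun_prop
    exact this.measurable
  have hm : Measurable fun p : unitary (V →L[ℝ] V) × sphere (0 : V) 1 =>
      h (GreatSubsphere.sphereMap (Unitary.linearIsometryEquiv p.1⁻¹) p.2) :=
    hh.comp (continuous_sphereMap_apply.comp
      (continuous_fst.inv.prodMk continuous_snd)).measurable
  -- By left invariance, the average over the group does not depend on the starting point.
  have hconst : ∀ z, ∫⁻ k, h (GreatSubsphere.sphereMap (Unitary.linearIsometryEquiv k⁻¹) z) ∂μ =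
      ∫⁻ k, h (GreatSubsphere.sphereMap (Unitary.linearIsometryEquiv k⁻¹) y) ∂μ := by
    intro z
    obtain ⟨g, rfl⟩ := exists_isometry_map_eq y z
    rw [← lintegral_mul_left_eq_self _ g]
    refine lintegral_congr fun k => ?_
    congr 1
    refine Subtype.ext ?_
    simp only [GreatSubsphere.sphereMap, mul_inv_rev, map_mul, map_inv,
      LinearIsometryEquiv.coe_mul, Function.comp_apply]
    congr 1
    exact (Unitary.linearIsometryEquiv g).symm_apply_apply _
  have hswap := lintegral_lintegral_swap (μ := surfaceMeasure V) (ν := μ)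
    (f := fun z k => h (GreatSubsphere.sphereMap (Unitary.linearIsometryEquiv k⁻¹) z))
    (hm.comp measurable_swap).aemeasurable
  simp only [hconst, lintegral_sphereMap _ hh, lintegral_const, measure_univ, mul_one] at hswap
  rw [← hswap, mul_comm, mul_assoc,
    ENNReal.mul_inv_cancel hs0 (measure_ne_top _ _), mul_one]

end Sphere

/-! ### The direction of a vector -/

section Direction

variable {m : ℕ}

/-- The direction `v / |v|` of a vector, and a default direction `p` if `v = 0`. -/
noncomputable def direction (p : USphere m) (v : Euc m) : USphere m :=
  open Classical in
  if h : v = 0 then p else ⟨‖v‖⁻¹ • v, by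
    rw [mem_sphere_zero_iff_norm, norm_smul, norm_inv, norm_norm,
      inv_mul_cancel₀ (norm_ne_zero_iff.2 h)]⟩

theorem coe_direction (p : USphere m) {v : Euc m} (h : v ≠ 0) :
    (direction p v : Euc m) = ‖v‖⁻¹ • v := by
  rw [direction, dif_neg h]

theorem direction_zero (p : USphere m) : direction p 0 = p := dif_pos rfl

theorem measurable_direction : Measurable fun q : USphere m × Euc m => direction q.1 q.2 := by
  classical
  refine (MeasurableEmbedding.subtype_coe
    isClosed_sphere.measurableSet).measurable_comp_iff.1 ?_
  have : ((↑) ∘ fun q : USphere m × Euc m => direction q.1 q.2) =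
      fun q : USphere m × Euc m => if q.2 = 0 then (q.1 : Euc m) else ‖q.2‖⁻¹ • q.2 := by
    ext1 q
    by_cases h : q.2 = 0
    · simp [h, direction_zero]
    · simp [h, coe_direction]
  rw [this]
  exact Measurable.ite (measurable_snd (measurableSet_singleton 0)) (by fun_prop) (by fun_prop)

theorem direction_smul (p : USphere m) {r : ℝ} (hr : 0 < r) (v : Euc m) :
    direction p (r • v) = direction p v := by
  by_cases h : v = 0
  · simp [h]
  · refine Subtype.ext ?_
    rw [coe_direction _ h, coe_direction _ (smul_ne_zero hr.ne' h), norm_smul,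
      Real.norm_of_nonneg hr.le, mul_inv, smul_smul]
    congr 1
    field_simp

theorem direction_coe (p y : USphere m) : direction p (y : Euc m) = y := by
  refine Subtype.ext ?_
  rw [coe_direction _ (ne_zero_of_mem_unit_sphere y), norm_eq_of_mem_sphere y, inv_one, one_smul]

theorem direction_map (g : Euc m ≃ₗᵢ[ℝ] Euc m) (p : USphere m) (v : Euc m) :
    direction (sphereMap g p) (g v) = sphereMap g (direction p v) := by
  by_cases h : v = 0
  · simp [h, direction_zero]
  · have h' : g v ≠ 0 := by simpa using h
    refine Subtype.ext ?_
    rw [coe_direction _ h']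
    change _ = g (direction p v : Euc m)
    rw [coe_direction _ h, map_smul, g.norm_map]

end Direction

/-! ### Integration over great sub-spheres -/

section EquatorKernel

variable {m : ℕ}

theorem finrank_plane_ofNormal {n : ℕ} (ω : USphere (n + 1)) :
    Module.finrank ℝ (ofNormal ω).plane = n := by
  have := (ofNormal ω).finrank_plane
  omega

theorem continuous_incl (ξ : GreatSubsphere m) : Continuous ξ.incl := by
  unfold incl
  fun_prop

/-- The total mass of the weight `e^{-a²}` on the line. -/
noncomputable def gaussianMass : ℝ≥0∞ := ∫⁻ a : ℝ, ENNReal.ofReal (Real.exp (-a ^ 2))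

theorem gaussianMass_ne_zero : gaussianMass ≠ 0 := by
  rw [gaussianMass, Ne, lintegral_eq_zero_iff (by fun_prop)]
  intro h
  obtain ⟨a, ha⟩ := h.exists
  rw [Pi.zero_apply, ENNReal.ofReal_eq_zero] at ha
  linarith [Real.exp_pos (-a ^ 2)]

theorem gaussianMass_ne_top : gaussianMass ≠ ⊤ := by
  have h := (integrable_exp_neg_mul_sq (b := 1) one_pos).lintegral_lt_top
  simpa [gaussianMass] using h.ne

/-- Integration over the great sub-sphere orthogonal to `ω` as integration over `ℝ^m`, of the
projections to `ω^⊥`. The right-hand side depends on `ω` in a measurable way, and equivariantly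
under linear isometries. -/
theorem lintegral_incl {k : ℕ} (ω : USphere (k + 2)) {h : USphere (k + 2) → ℝ≥0∞}
    (hh : Measurable h) :
    ∫⁻ y, h ((ofNormal ω).incl y) ∂(surfaceMeasure (ofNormal ω).plane) =
      (gaussianMass * gaussianMoment k)⁻¹ * ∫⁻ w : Euc (k + 2),
        h (direction ω (w - inner ℝ (ω : Euc (k + 2)) w • (ω : Euc (k + 2)))) *
          ENNReal.ofReal (Real.exp (-‖w‖ ^ 2)) := by
  have hω : ‖(ω : Euc (k + 2))‖ = 1 := norm_eq_of_mem_sphere ω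
  have hωω : inner ℝ (ω : Euc (k + 2)) (ω : Euc (k + 2)) = (1 : ℝ) := by
    rw [real_inner_self_eq_norm_sq, hω, one_pow]
  have hfr : Module.finrank ℝ (ofNormal ω).plane = k + 1 := finrank_plane_ofNormal ω
  have : Nontrivial (ofNormal ω).plane := Module.nontrivial_of_finrank_pos (R := ℝ) (by omega)
  have hdm : Measurable fun v : Euc (k + 2) => direction ω v :=
    measurable_direction.comp (measurable_const.prodMk measurable_id)
  have h1 := lintegral_sphere_mul_gaussianMoment (V := (ofNormal ω).plane) hfr
    (h := fun v => h (direction ω (v : Euc (k + 2))))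
    (hh.comp (hdm.comp measurable_subtype_coe)) (fun r hr v => by
      rw [Submodule.coe_smul, direction_smul ω hr])
  have h1' : ∀ y : sphere (0 : (ofNormal ω).plane) 1,
      direction ω ((y : (ofNormal ω).plane) : Euc (k + 2)) = (ofNormal ω).incl y := fun y =>
    direction_coe ω ((ofNormal ω).incl y)
  simp only [h1'] at h1
  have h2 : ∫⁻ w : Euc (k + 2),
        h (direction ω (w - inner ℝ (ω : Euc (k + 2)) w • (ω : Euc (k + 2)))) *
          ENNReal.ofReal (Real.exp (-‖w‖ ^ 2)) = gaussianMass *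
      ∫⁻ v : (ofNormal ω).plane, h (direction ω (v : Euc (k + 2))) *
        ENNReal.ofReal (Real.exp (-‖v‖ ^ 2)) := by
    have hm : Measurable fun w : Euc (k + 2) =>
        h (direction ω (w - inner ℝ (ω : Euc (k + 2)) w • (ω : Euc (k + 2)))) :=
      hh.comp (hdm.comp (by fun_prop))
    rw [lintegral_orthogonal hω (by fun_prop), gaussianMass, ← lintegral_mul_const _ (by fun_prop)]
    refine lintegral_congr fun a => ?_
    have hm' : Measurable fun v : (ofNormal ω).plane => h (direction ω (v : Euc (k + 2))) :=
      hh.comp (hdm.comp measurable_subtype_coe)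
    rw [← lintegral_const_mul _ (by fun_prop)]
    refine lintegral_congr fun v => ?_
    have hev : inner ℝ (ω : Euc (k + 2)) (v : Euc (k + 2)) = (0 : ℝ) :=
      Submodule.mem_orthogonal_singleton_iff_inner_right.1 v.2
    have hsq : ‖a • (ω : Euc (k + 2)) + (v : Euc (k + 2))‖ ^ 2 = a ^ 2 + ‖v‖ ^ 2 := by
      rw [norm_add_sq_real, inner_smul_left, hev, norm_smul, hω, mul_one, Real.norm_eq_abs, sq_abs]
      simp
    rw [hsq, inner_add_right, inner_smul_right, hev, hωω, mul_one, add_zero, add_sub_cancel_left,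
      neg_add, Real.exp_add, ENNReal.ofReal_mul (Real.exp_nonneg _), mul_left_comm]
    rfl
  have h3 : gaussianMass * gaussianMoment k ≠ 0 :=
    mul_ne_zero gaussianMass_ne_zero (gaussianMoment_ne_zero k)
  have h4 : gaussianMass * gaussianMoment k ≠ ⊤ :=
    ENNReal.mul_ne_top gaussianMass_ne_top (gaussianMoment_ne_top k)
  rw [h2, ← h1, mul_comm (lintegral _ _) (gaussianMoment k), ← mul_assoc gaussianMass,
    ← mul_assoc, ENNReal.inv_mul_cancel h3 h4, one_mul]

theorem measurable_lintegral_incl {k : ℕ} {h : USphere (k + 2) → ℝ≥0∞} (hh : Measurable h) :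
    Measurable fun ω : USphere (k + 2) =>
      ∫⁻ y, h ((ofNormal ω).incl y) ∂(surfaceMeasure (ofNormal ω).plane) := by
  simp only [lintegral_incl _ hh]
  refine Measurable.const_mul ?_ _
  refine Measurable.lintegral_prod_right' (f := fun p : USphere (k + 2) × Euc (k + 2) =>
    h (direction p.1 (p.2 - inner ℝ (p.1 : Euc (k + 2)) p.2 • (p.1 : Euc (k + 2)))) *
          ENNReal.ofReal (Real.exp (-‖p.2‖ ^ 2))) ?_
  have h1 : Measurable fun p : USphere (k + 2) × Euc (k + 2) =>
      (p.1, p.2 - inner ℝ (p.1 : Euc (k + 2)) p.2 • (p.1 : Euc (k + 2))) :=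
    measurable_fst.prodMk (Continuous.measurable (by fun_prop))
  exact (hh.comp (measurable_direction.comp h1)).mul (by fun_prop)

theorem lintegral_incl_sphereMap {k : ℕ} (g : Euc (k + 2) ≃ₗᵢ[ℝ] Euc (k + 2)) (ω : USphere (k + 2))
    {h : USphere (k + 2) → ℝ≥0∞} (hh : Measurable h) :
    ∫⁻ y, h ((ofNormal (sphereMap g ω)).incl y)
        ∂(surfaceMeasure (ofNormal (sphereMap g ω)).plane) =
      ∫⁻ y, h (sphereMap g ((ofNormal ω).incl y)) ∂(surfaceMeasure (ofNormal ω).plane) := by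
  have hc : Continuous (sphereMap g) :=
    (g.continuous.comp continuous_subtype_val).subtype_mk _
  rw [lintegral_incl _ hh, lintegral_incl ω (h := fun y => h (sphereMap g y))
    (hh.comp hc.measurable)]
  congr 1
  rw [← g.measurePreserving.lintegral_comp_emb g.toHomeomorph.measurableEmbedding]
  refine lintegral_congr fun w => ?_
  have h1 : ((sphereMap g ω : USphere (k + 2)) : Euc (k + 2)) = g ω := rfl
  rw [h1, g.inner_map_map, g.norm_map, ← map_smul, ← map_sub, direction_map]

/-- Integration over the great sub-spheres, as a kernel `ω ↦ dS|_{ξ_ω}` on the sphere. -/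
noncomputable def equatorKernel (k : ℕ) : Kernel (USphere (k + 2)) (USphere (k + 2)) where
  toFun ω := (surfaceMeasure (ofNormal ω).plane).map (ofNormal ω).incl
  measurable' := by
    refine Measure.measurable_of_measurable_coe _ fun s hs => ?_
    have h := measurable_lintegral_incl (k := k)
      (h := s.indicator 1) (measurable_one.indicator hs)
    convert h using 2 with ω
    rw [← lintegral_map (measurable_one.indicator hs) (continuous_incl _).measurable,
      lintegral_indicator_one hs]

theorem equatorKernel_apply {k : ℕ} (ω : USphere (k + 2)) :
    equatorKernel k ω = (surfaceMeasure (ofNormal ω).plane).map (ofNormal ω).incl := rfl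

theorem lintegral_equatorKernel {k : ℕ} (ω : USphere (k + 2)) {h : USphere (k + 2) → ℝ≥0∞}
    (hh : Measurable h) : ∫⁻ y, h y ∂(equatorKernel k ω) =
      ∫⁻ y, h ((ofNormal ω).incl y) ∂(surfaceMeasure (ofNormal ω).plane) := by
  rw [equatorKernel_apply, lintegral_map hh (continuous_incl _).measurable]

theorem equatorKernel_univ {k : ℕ} (ω : USphere (k + 2)) :
    equatorKernel k ω univ = ENNReal.ofReal (sphereArea (k + 1)) := by
  have hfr : Module.finrank ℝ (ofNormal ω).plane = k + 1 := finrank_plane_ofNormal ω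
  have : Nontrivial (ofNormal ω).plane := Module.nontrivial_of_finrank_pos (R := ℝ) (by omega)
  rw [equatorKernel_apply, Measure.map_apply (continuous_incl _).measurable .univ, preimage_univ,
    surfaceMeasure_univ, hfr]

instance (k : ℕ) : IsFiniteKernel (equatorKernel k) :=
  ⟨⟨ENNReal.ofReal (sphereArea (k + 1)), ENNReal.ofReal_lt_top,
    fun ω => (equatorKernel_univ ω).le⟩⟩

end EquatorKernel

/-! ### Parallels of an axis -/

section Axis

variable {m : ℕ}

theorem inner_tilt (x : USphere m) (r : ℝ) (η : sphere (0 : (ofNormal x).plane) 1) :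
    inner ℝ (x : Euc m) (tilt x r η : Euc m) = Real.sin r := by
  have h0 : inner ℝ (x : Euc m) ((ofNormal x).incl η : Euc m) = (0 : ℝ) :=
    Submodule.mem_orthogonal_singleton_iff_inner_right.1 (η : (ofNormal x).plane).2
  have hx : inner ℝ (x : Euc m) (x : Euc m) = (1 : ℝ) := by
    rw [real_inner_self_eq_norm_sq, norm_eq_of_mem_sphere x, one_pow]
  rw [tilt, inner_add_right, inner_smul_right, inner_smul_right, h0, hx]
  simp

theorem norm_sq_smul_add (x : USphere m) (a : ℝ) (w : (ofNormal x).plane) :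
    ‖a • (x : Euc m) + (w : Euc m)‖ ^ 2 = a ^ 2 + ‖w‖ ^ 2 := by
  have h0 : inner ℝ (x : Euc m) (w : Euc m) = (0 : ℝ) :=
    Submodule.mem_orthogonal_singleton_iff_inner_right.1 w.2
  rw [norm_add_sq_real, inner_smul_left, h0, norm_smul, norm_eq_of_mem_sphere x, mul_one,
    Real.norm_eq_abs, sq_abs]
  simp

theorem coe_projection (x : USphere m) (v : Euc m) :
    (((ofNormal x).plane.orthogonalProjectionOnto v : (ofNormal x).plane) : Euc m) =
      v - inner ℝ (x : Euc m) v • (x : Euc m) := by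
  rw [Submodule.coe_orthogonalProjectionOnto_apply]
  refine (Submodule.starProjection_orthogonal_val (K := ℝ ∙ (x : Euc m)) v).trans ?_
  rw [Submodule.starProjection_unit_singleton ℝ (norm_eq_of_mem_sphere x)]

/-- The extension of a linear isometry of `x^⊥` to one of `ℝ^m` that fixes `x`. -/
noncomputable def extendIsometry (x : USphere m)
    (e : (ofNormal x).plane ≃ₗᵢ[ℝ] (ofNormal x).plane) : Euc m ≃ₗᵢ[ℝ] Euc m :=
  LinearIsometry.toLinearIsometryEquiv
    { toLinearMap := ((innerSL ℝ (x : Euc m)).smulRight (x : Euc m) +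
        (ofNormal x).plane.subtypeL ∘L (e : (ofNormal x).plane →L[ℝ] (ofNormal x).plane) ∘L
          (ofNormal x).plane.orthogonalProjectionOnto : Euc m →L[ℝ] Euc m)
      norm_map' := by
        intro v
        have h1 := norm_sq_smul_add x (inner ℝ (x : Euc m) v)
          (e ((ofNormal x).plane.orthogonalProjectionOnto v))
        have h2 := norm_sq_smul_add x (inner ℝ (x : Euc m) v)
          ((ofNormal x).plane.orthogonalProjectionOnto v)
        rw [coe_projection, add_sub_cancel] at h2
        rw [e.norm_map, ← h2] at h1
        exact (sq_eq_sq₀ (norm_nonneg _) (norm_nonneg _)).1 h1 } rfl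

theorem extendIsometry_apply (x : USphere m)
    (e : (ofNormal x).plane ≃ₗᵢ[ℝ] (ofNormal x).plane) (v : Euc m) :
    extendIsometry x e v = inner ℝ (x : Euc m) v • (x : Euc m) +
      (e ((ofNormal x).plane.orthogonalProjectionOnto v) : Euc m) := rfl

theorem sphereMap_extendIsometry_tilt (x : USphere m)
    (e : (ofNormal x).plane ≃ₗᵢ[ℝ] (ofNormal x).plane) (r : ℝ)
    (η : sphere (0 : (ofNormal x).plane) 1) :
    sphereMap (extendIsometry x e) (tilt x r η) = tilt x r (sphereMap e η) := by
  refine Subtype.ext ?_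
  change extendIsometry x e (tilt x r η : Euc m) = _
  rw [extendIsometry_apply, inner_tilt]
  have h : (ofNormal x).plane.orthogonalProjectionOnto (tilt x r η : Euc m) =
      Real.cos r • (η : (ofNormal x).plane) := by
    refine Subtype.ext ?_
    rw [coe_projection, inner_tilt]
    simp [tilt, incl]
  rw [h, map_smul]
  rfl

/-- Every point lies on the parallel given by its height over the equator of `x`. -/
theorem exists_eq_tilt (hm : 2 ≤ m) (x y : USphere m) :
    ∃ η, y = tilt x (Real.arcsin (inner ℝ (x : Euc m) (y : Euc m))) η := by
  have hd := (ofNormal x).finrank_plane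
  have hnt : Nontrivial (ofNormal x).plane := Module.nontrivial_of_finrank_pos (R := ℝ) (by omega)
  set a : ℝ := inner ℝ (x : Euc m) (y : Euc m) with ha
  have hx : ‖(x : Euc m)‖ = 1 := norm_eq_of_mem_sphere x
  have hy : ‖(y : Euc m)‖ = 1 := norm_eq_of_mem_sphere y
  have habs : |a| ≤ 1 := by
    have := abs_real_inner_le_norm (x : Euc m) (y : Euc m)
    rwa [hx, hy, one_mul] at this
  set w := (ofNormal x).plane.orthogonalProjectionOnto (y : Euc m) with hw
  have hsum : (y : Euc m) = a • (x : Euc m) + (w : Euc m) := by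
    rw [hw, coe_projection, add_sub_cancel]
  have hn := norm_sq_smul_add x a w
  rw [← hsum, hy] at hn
  have hcos : Real.cos (Real.arcsin a) = ‖w‖ := by
    rw [Real.cos_arcsin, show 1 - a ^ 2 = ‖w‖ ^ 2 by linarith, Real.sqrt_sq (norm_nonneg _)]
  have hsin : Real.sin (Real.arcsin a) = a :=
    Real.sin_arcsin (abs_le.1 habs).1 (abs_le.1 habs).2
  have key : ∀ η : sphere (0 : (ofNormal x).plane) 1, ‖w‖ • (η : (ofNormal x).plane) = w →
      y = tilt x (Real.arcsin a) η := by
    intro η hη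
    refine Subtype.ext ?_
    rw [hsum, tilt]
    simp only [hsin, hcos]
    congr 1
    conv_lhs => rw [← hη]
    rfl
  by_cases hw0 : w = 0
  · obtain ⟨z, hz⟩ := exists_norm_eq (ofNormal x).plane zero_le_one
    exact ⟨⟨z, by rwa [mem_sphere_zero_iff_norm]⟩, key _ (by simp [hw0])⟩
  · have hwn : ‖w‖ ≠ 0 := norm_ne_zero_iff.2 hw0
    refine ⟨⟨‖w‖⁻¹ • w, ?_⟩, key _ ?_⟩
    · rw [mem_sphere_zero_iff_norm, norm_smul, norm_inv, norm_norm, inv_mul_cancel₀ hwn]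
    · rw [smul_smul, mul_inv_cancel₀ hwn, one_smul]

theorem continuous_tilt (x : USphere m) :
    Continuous fun p : ℝ × sphere (0 : (ofNormal x).plane) 1 => tilt x p.1 p.2 := by
  unfold tilt incl
  fun_prop

theorem isProbabilityMeasure_equatorMeasure (hm : 2 ≤ m) (x : USphere m) :
    IsProbabilityMeasure (equatorMeasure x) := by
  have hd := (ofNormal x).finrank_plane
  have hnt : Nontrivial (ofNormal x).plane := Module.nontrivial_of_finrank_pos (R := ℝ) (by omega)
  refine ⟨?_⟩
  rw [equatorMeasure, Measure.smul_apply, smul_eq_mul]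
  refine ENNReal.inv_mul_cancel ?_ (measure_ne_top _ _)
  rw [Ne, Measure.measure_univ_eq_zero]
  exact Measure.toSphere_ne_zero _

instance (x : USphere (m + 2)) : IsProbabilityMeasure (equatorMeasure x) :=
  isProbabilityMeasure_equatorMeasure (by omega) x

/-- The mean of `h` over the parallel `{y | ⟨x, y⟩ = v}`. -/
noncomputable def parallelMean (x : USphere m) (h : USphere m → ℝ≥0∞) (v : ℝ) : ℝ≥0∞ :=
  ∫⁻ η, h (tilt x (Real.arcsin v) η) ∂(equatorMeasure x)

theorem measurable_tilt_arcsin (x : USphere m) :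
    Measurable fun p : ℝ × sphere (0 : (ofNormal x).plane) 1 =>
      tilt x (Real.arcsin p.1) p.2 :=
  ((continuous_tilt x).comp ((Real.continuous_arcsin.comp continuous_fst).prodMk
    continuous_snd)).measurable

theorem measurable_parallelMean (x : USphere (m + 2)) {h : USphere (m + 2) → ℝ≥0∞}
    (hh : Measurable h) : Measurable (parallelMean x h) :=
  Measurable.lintegral_prod_right' (hh.comp (measurable_tilt_arcsin x))

/-- There is a random rotation about the axis `x` that moves every point of the sphere to a
uniformly distributed point of its parallel. -/
theorem exists_random_rotation {k : ℕ} (x : USphere (k + 2)) :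
    ∃ (Ω : Type) (_ : MeasurableSpace Ω) (κ : Measure Ω)
      (g : Ω → Euc (k + 2) ≃ₗᵢ[ℝ] Euc (k + 2)),
      IsProbabilityMeasure κ ∧ Measurable (fun p : Ω × USphere (k + 2) => sphereMap (g p.1) p.2) ∧
      (∀ h : USphere (k + 2) → ℝ≥0∞, Measurable h → ∀ r η,
        ∫⁻ ρ, h (sphereMap (g ρ) (tilt x r η)) ∂κ =
          ∫⁻ η, h (tilt x r η) ∂(equatorMeasure x)) ∧
      ∀ h : USphere (k + 2) → ℝ≥0∞, Measurable h → ∀ y,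
        ∫⁻ ρ, h (sphereMap (g ρ) y) ∂κ =
          parallelMean x h (inner ℝ (x : Euc (k + 2)) (y : Euc (k + 2))) := by
  have hfr : Module.finrank ℝ (ofNormal x).plane = k + 1 := finrank_plane_ofNormal x
  have : Nontrivial (ofNormal x).plane := Module.nontrivial_of_finrank_pos (R := ℝ) (by omega)
  obtain ⟨Ω, hΩ, κ, g, hκ, hg, H⟩ := exists_random_isometry (V := (ofNormal x).plane)
  have H1 : ∀ h : USphere (k + 2) → ℝ≥0∞, Measurable h → ∀ r η,
        ∫⁻ ρ, h (sphereMap (extendIsometry x (g ρ)) (tilt x r η)) ∂κ =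
          ∫⁻ η, h (tilt x r η) ∂(equatorMeasure x) := by
    intro h hh r η
    simp only [sphereMap_extendIsometry_tilt]
    rw [equatorMeasure, lintegral_smul_measure, smul_eq_mul]
    exact H (fun η => h (tilt x r η)) (hh.comp ((continuous_tilt x).comp
      (continuous_const.prodMk continuous_id)).measurable) η
  refine ⟨Ω, hΩ, κ, fun ρ => extendIsometry x (g ρ), hκ, ?_, H1, fun h hh y => ?_⟩
  · have h1 : Measurable fun p : Ω × USphere (k + 2) =>
        (g p.1 ((ofNormal x).plane.orthogonalProjectionOnto (p.2 : Euc (k + 2)))) :=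
      hg.comp (measurable_fst.prodMk (by fun_prop))
    have h2 : Measurable fun p : Ω × USphere (k + 2) =>
        inner ℝ (x : Euc (k + 2)) (p.2 : Euc (k + 2)) • (x : Euc (k + 2)) +
        (g p.1 ((ofNormal x).plane.orthogonalProjectionOnto (p.2 : Euc (k + 2))) :
          Euc (k + 2)) := by
      fun_prop
    exact h2.subtype_mk
  · obtain ⟨η, hη⟩ := exists_eq_tilt (by omega) x y
    rw [parallelMean, ← H1 h hh _ η, ← hη]

/-- Integration over the sphere in geographic coordinates with axis `x`. -/
theorem lintegral_surfaceMeasure {k : ℕ} (x : USphere (k + 2)) {h : USphere (k + 2) → ℝ≥0∞}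
    (hh : Measurable h) :
    ∫⁻ y, h y ∂(surfaceMeasure (Euc (k + 2))) =
      ENNReal.ofReal (sphereArea (k + 1)) * ∫⁻ v in Ioo (-1 : ℝ) 1, parallelMean x h v *
        ENNReal.ofReal ((1 - v ^ 2) ^ (((k : ℝ) - 1) / 2)) := by
  obtain ⟨Ω, hΩ, κ, g, hκ, hg, -, H⟩ := exists_random_rotation x
  rw [← lintegral_sphere_inner (V := Euc (k + 2)) (by simp) (norm_eq_of_mem_sphere x)
    (measurable_parallelMean x hh)]
  simp only [← H h hh]
  rw [lintegral_lintegral_swap]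
  · simp only [lintegral_sphereMap _ hh, lintegral_const, measure_univ, mul_one]
  · exact (hh.comp (hg.comp measurable_swap)).aemeasurable

/-- The average of the integrals of `h` over the great sub-spheres at distance `arccos q` from `x`
depends only on the means of `h` over the parallels, and only those with `|⟨x, y⟩| < q` enter. -/
theorem lintegral_equatorKernel_tilt {k : ℕ} (x : USphere (k + 3)) {q : ℝ} (hq : q ∈ Icc (-1) 1)
    {h : USphere (k + 3) → ℝ≥0∞} (hh : Measurable h) :
    ∫⁻ η, ∫⁻ y, h y ∂(equatorKernel (k + 1) (tilt x (Real.arccos q) η)) ∂(equatorMeasure x) =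
      ENNReal.ofReal (sphereArea (k + 1)) * ∫⁻ s in Ioo (-1 : ℝ) 1, parallelMean x h (q * s) *
        ENNReal.ofReal ((1 - s ^ 2) ^ (((k : ℝ) - 1) / 2)) := by
  obtain ⟨Ω, hΩ, κ, g, hκ, hg, H1, H⟩ := exists_random_rotation x
  have hfr : Module.finrank ℝ (ofNormal x).plane = k + 2 := finrank_plane_ofNormal x
  have : Nontrivial (ofNormal x).plane := Module.nontrivial_of_finrank_pos (R := ℝ) (by omega)
  obtain ⟨z, hz⟩ := exists_norm_eq (ofNormal x).plane zero_le_one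
  set η₀ : sphere (0 : (ofNormal x).plane) 1 := ⟨z, by rwa [mem_sphere_zero_iff_norm]⟩
  set ω := tilt x (Real.arccos q) η₀ with hω
  rw [← H1 (fun ω => ∫⁻ y, h y ∂(equatorKernel (k + 1) ω)) (hh.lintegral_kernel) _ η₀, ← hω]
  simp only [lintegral_equatorKernel _ hh, lintegral_incl_sphereMap _ _ hh]
  rw [lintegral_lintegral_swap]
  swap
  · exact (hh.comp (hg.comp (measurable_fst.prodMk ((continuous_incl _).measurable.comp
      measurable_snd)))).aemeasurable
  simp only [H h hh]
  -- On `ω^⊥`, the linear form `⟨x, ·⟩` is `q ⟨e, ·⟩` with the unit vector `e` below.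
  set p : ℝ := √(1 - q ^ 2) with hp
  have hp2 : p ^ 2 = 1 - q ^ 2 := Real.sq_sqrt (by nlinarith [hq.1, hq.2])
  have hωc : (ω : Euc (k + 3)) = p • (x : Euc (k + 3)) + q • (z : Euc (k + 3)) := by
    rw [hω, tilt]
    simp only [Real.sin_arccos, Real.cos_arccos hq.1 hq.2]
    rfl
  have hxx : inner ℝ (x : Euc (k + 3)) (x : Euc (k + 3)) = (1 : ℝ) := by
    rw [real_inner_self_eq_norm_sq, norm_eq_of_mem_sphere x, one_pow]
  have hzz : inner ℝ (z : Euc (k + 3)) (z : Euc (k + 3)) = (1 : ℝ) := by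
    rw [real_inner_self_eq_norm_sq]
    change ‖z‖ ^ 2 = 1
    rw [hz, one_pow]
  have hxz : inner ℝ (x : Euc (k + 3)) (z : Euc (k + 3)) = (0 : ℝ) :=
    Submodule.mem_orthogonal_singleton_iff_inner_right.1 z.2
  have hzx : inner ℝ (z : Euc (k + 3)) (x : Euc (k + 3)) = (0 : ℝ) := by
    rw [real_inner_comm, hxz]
  set e' : Euc (k + 3) := q • (x : Euc (k + 3)) - p • (z : Euc (k + 3)) with he'
  have he'mem : e' ∈ (ofNormal ω).plane := by
    refine Submodule.mem_orthogonal_singleton_iff_inner_right.2 ?_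
    rw [hωc, he']
    simp only [inner_add_left, inner_sub_right, inner_smul_left, inner_smul_right, hxx, hxz, hzx,
      hzz, RCLike.conj_to_real]
    ring
  set e : (ofNormal ω).plane := ⟨e', he'mem⟩ with he
  have hen : ‖e‖ = 1 := by
    rw [← sq_eq_sq₀ (norm_nonneg _) zero_le_one, ← real_inner_self_eq_norm_sq]
    change inner ℝ e' e' = (1 : ℝ) ^ 2
    rw [he']
    simp only [inner_sub_left, inner_sub_right, inner_smul_left, inner_smul_right, hxx, hxz, hzx,
      hzz, RCLike.conj_to_real]
    linear_combination hp2
  have hin : ∀ y : sphere (0 : (ofNormal ω).plane) 1,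
      inner ℝ (x : Euc (k + 3)) ((ofNormal ω).incl y : Euc (k + 3)) =
        q * inner ℝ e (y : (ofNormal ω).plane) := by
    intro y
    have hy0 : inner ℝ (ω : Euc (k + 3)) ((ofNormal ω).incl y : Euc (k + 3)) = (0 : ℝ) :=
      Submodule.mem_orthogonal_singleton_iff_inner_right.1 (y : (ofNormal ω).plane).2
    have hx' : (x : Euc (k + 3)) = p • (ω : Euc (k + 3)) + q • e' := by
      rw [hωc, he', smul_add, smul_sub, smul_smul, smul_smul, smul_smul, smul_smul, mul_comm p q]
      have : (x : Euc (k + 3)) = (p * p + q * q) • (x : Euc (k + 3)) := by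
        rw [show p * p + q * q = 1 by linear_combination hp2, one_smul]
      conv_lhs => rw [this, add_smul]
      abel
    conv_lhs => rw [hx']
    rw [inner_add_left, inner_smul_left, inner_smul_left, hy0, mul_zero, zero_add]
    rfl
  simp only [hin]
  have hfr' : Module.finrank ℝ (ofNormal ω).plane = k + 2 := finrank_plane_ofNormal ω
  exact lintegral_sphere_inner hfr' hen (H := fun s => parallelMean x h (q * s))
    ((measurable_parallelMean x hh).comp (by fun_prop))

/-- Averaging the integrals over all great sub-spheres gives a multiple of the integral over the
sphere. -/
theorem lintegral_lintegral_equatorKernel {k : ℕ} {h : USphere (k + 2) → ℝ≥0∞}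
    (hh : Measurable h) :
    ∫⁻ ω, ∫⁻ y, h y ∂(equatorKernel k ω) ∂(surfaceMeasure (Euc (k + 2))) =
      ENNReal.ofReal (sphereArea (k + 1)) * ∫⁻ y, h y ∂(surfaceMeasure (Euc (k + 2))) := by
  obtain ⟨Ω, hΩ, κ, g, hκ, hg, H⟩ := exists_random_isometry (V := Euc (k + 2))
  obtain ⟨z, hz⟩ := exists_norm_eq (Euc (k + 2)) zero_le_one
  set ω : USphere (k + 2) := ⟨z, by rwa [mem_sphere_zero_iff_norm]⟩
  have hs0 : surfaceMeasure (Euc (k + 2)) univ ≠ 0 := by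
    rw [Ne, Measure.measure_univ_eq_zero]
    exact Measure.toSphere_ne_zero _
  have hg' : Measurable fun p : Ω × sphere (0 : (ofNormal ω).plane) 1 =>
      sphereMap (g p.1) ((ofNormal ω).incl p.2) := by
    have h0 : Measurable fun p : Ω × sphere (0 : (ofNormal ω).plane) 1 =>
        ((ofNormal ω).incl p.2 : Euc (k + 2)) :=
      measurable_subtype_coe.comp ((continuous_incl _).measurable.comp measurable_snd)
    exact Measurable.subtype_mk (hg.comp (measurable_fst.prodMk h0))
  have h1 := H (fun ω => ∫⁻ y, h y ∂(equatorKernel k ω)) hh.lintegral_kernel ω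
  simp only [lintegral_equatorKernel _ hh, lintegral_incl_sphereMap _ _ hh] at h1 ⊢
  rw [lintegral_lintegral_swap (f := fun ρ y => h (sphereMap (g ρ) ((ofNormal ω).incl y)))
    (hh.comp hg').aemeasurable] at h1
  simp only [H h hh, lintegral_const] at h1
  have h2 : surfaceMeasure (ofNormal ω).plane univ = ENNReal.ofReal (sphereArea (k + 1)) := by
    rw [← equatorKernel_univ ω, equatorKernel_apply,
      Measure.map_apply (continuous_incl _).measurable .univ, preimage_univ]
  rw [h2, mul_assoc] at h1
  have h3 := (ENNReal.mul_right_inj (ENNReal.inv_ne_zero.2 (measure_ne_top _ _))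
    (ENNReal.inv_ne_top.2 hs0)).1 h1
  rw [← h3, mul_comm]

end Axis

/-! ### Iterated integrals with respect to the square of the variable -/

section TruncatedPower

/-- The truncated power `(u - v²)_+^n`. -/
noncomputable def truncPow (n : ℕ) (u v : ℝ) : ℝ := if v ^ 2 < u then (u - v ^ 2) ^ n else 0

theorem truncPow_succ (n : ℕ) (u v : ℝ) : truncPow (n + 1) u v = max (u - v ^ 2) 0 ^ (n + 1) := by
  unfold truncPow
  split_ifs with h
  · rw [max_eq_left (by linarith)]
  · rw [max_eq_right (by linarith), zero_pow (by omega)]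

theorem measurable_truncPow (n : ℕ) (u : ℝ) : Measurable (truncPow n u) :=
  Measurable.ite (measurableSet_lt (by fun_prop) (by fun_prop)) (by fun_prop) (by fun_prop)

theorem abs_truncPow_le (n : ℕ) {u v R : ℝ} (hu : |u| ≤ R) : |truncPow n u v| ≤ R ^ n := by
  have hR : 0 ≤ R := (abs_nonneg u).trans hu
  unfold truncPow
  split_ifs with h
  · rw [abs_pow]
    refine pow_le_pow_left₀ (abs_nonneg _) ?_ n
    rw [abs_of_pos (by linarith)]
    linarith [le_abs_self u, sq_nonneg v]
  · simpa using pow_nonneg hR n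

theorem hasDerivAt_truncPow (n : ℕ) {u v : ℝ} (h : v ^ 2 ≠ u) :
    HasDerivAt (fun u => truncPow (n + 1) u v) ((n + 1) * truncPow n u v) u := by
  rcases lt_or_gt_of_ne h with h | h
  · have h1 : HasDerivAt (fun u => (u - v ^ 2) ^ (n + 1)) ((n + 1) * truncPow n u v) u := by
      have := ((hasDerivAt_id' u).sub_const (v ^ 2)).fun_pow (n + 1)
      simpa [truncPow, h] using this
    refine h1.congr_of_eventuallyEq ?_
    filter_upwards [lt_mem_nhds h] with y hy
    simp [truncPow, hy]
  · have h1 : HasDerivAt (fun _ : ℝ => (0 : ℝ)) ((n + 1) * truncPow n u v) u := by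
      simpa [truncPow, not_lt.2 h.le] using hasDerivAt_const u (0 : ℝ)
    refine h1.congr_of_eventuallyEq ?_
    filter_upwards [gt_mem_nhds h] with y hy
    simp [truncPow, not_lt.2 hy.le]

theorem ae_sq_ne (u : ℝ) (μ : Measure ℝ) [NullSingletonClass μ] : ∀ᵐ v : ℝ ∂μ, v ^ 2 ≠ u := by
  have hfin : {v : ℝ | v ^ 2 = u}.Finite := by
    refine (Set.toFinite {√u, -√u}).subset fun v (hv : v ^ 2 = u) => ?_
    have : v ^ 2 = √u ^ 2 := by rw [Real.sq_sqrt (hv ▸ sq_nonneg v), hv]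
    exact sq_eq_sq_iff_eq_or_eq_neg.1 this
  exact compl_mem_ae_iff.2 (hfin.measure_zero μ)

/-- `∫_0^1 F(v) (u - v²)_+^n dv`: up to a constant, a fractional integral of `F` with respect to
`v²`, of integral order `n + 1`. -/
noncomputable def truncMoment (F : ℝ → ℂ) (n : ℕ) (u : ℝ) : ℂ :=
  ∫ v in Ioo (0 : ℝ) 1, (truncPow n u v : ℂ) * F v

variable {F : ℝ → ℂ}

theorem integrable_truncPow_mul (hF : IntegrableOn F (Ioo 0 1)) (n : ℕ) (u : ℝ) :
    IntegrableOn (fun v => (truncPow n u v : ℂ) * F v) (Ioo 0 1) := by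
  refine Integrable.bdd_mul (c := |u| ^ n) hF ?_ ?_
  · exact (Complex.measurable_ofReal.comp (measurable_truncPow n u)).aestronglyMeasurable
  · exact .of_forall fun v => by
      simpa using abs_truncPow_le n (v := v) (le_refl |u|)

/-- `d/du (u - v²)_+^{n+1} = (n + 1) (u - v²)_+^n`, integrated against `F`. -/
theorem hasDerivAt_truncMoment (hF : IntegrableOn F (Ioo 0 1)) (n : ℕ) (u : ℝ) :
    HasDerivAt (truncMoment F (n + 1)) ((n + 1) * truncMoment F n u) u := by
  set R : ℝ := |u| + 1
  have h := hasDerivAt_integral_of_dominated_loc_of_lip (μ := volume.restrict (Ioo (0 : ℝ) 1))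
    (F := fun u v => (truncPow (n + 1) u v : ℂ) * F v) (x₀ := u)
    (F' := fun v => ((n + 1 : ℝ) * truncPow n u v : ℝ) * F v) (s := ball u 1)
    (bound := fun v => (n + 1) * R ^ n * ‖F v‖) (ball_mem_nhds u one_pos)
    (.of_forall fun u => (integrable_truncPow_mul hF _ u).aestronglyMeasurable)
    (integrable_truncPow_mul hF _ u) ?_ ?_ (hF.norm.const_mul _) ?_
  · have h2 := h.2
    have e : ∫ v in Ioo (0 : ℝ) 1, (((n + 1 : ℝ) * truncPow n u v : ℝ) : ℂ) * F v =
        (n + 1) * truncMoment F n u := by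
      rw [truncMoment, ← integral_const_mul]
      refine integral_congr_ae (.of_forall fun v => ?_)
      push_cast
      ring
    rw [e] at h2
    exact h2
  · have := (integrable_truncPow_mul hF n u).const_mul ((n + 1 : ℝ) : ℂ)
    refine this.aestronglyMeasurable.congr (.of_forall fun v => ?_)
    push_cast
    ring
  · refine .of_forall fun v => LipschitzOnWith.of_dist_le_mul fun a ha b hb => ?_
    have hR : ∀ c ∈ ball u 1, |max (c - v ^ 2) 0| ≤ R := by
      intro c hc
      rw [mem_ball, Real.dist_eq] at hc
      have h1 : |c| ≤ R := by
        have := abs_sub_abs_le_abs_sub c u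
        simp only [R]; linarith
      rw [abs_of_nonneg (le_max_right _ _)]
      exact max_le (by linarith [le_abs_self c, sq_nonneg v]) ((abs_nonneg c).trans h1)
    have hR0 : 0 ≤ R := by positivity
    rw [Complex.dist_eq, ← sub_mul, norm_mul, ← Complex.ofReal_sub, Complex.norm_real,
      Real.norm_eq_abs, truncPow_succ, truncPow_succ, Real.coe_nnabs,
      abs_of_nonneg (by positivity : 0 ≤ ((n : ℝ) + 1) * R ^ n * ‖F v‖), Real.dist_eq]
    have h1 := abs_pow_sub_pow_le (max (a - v ^ 2) 0) (max (b - v ^ 2) 0) (n + 1)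
    have h2 : |max (a - v ^ 2) 0 - max (b - v ^ 2) 0| ≤ |a - b| := by
      refine (abs_max_sub_max_le_abs _ _ _).trans (le_of_eq ?_)
      congr 1
      ring
    have h3 : max |max (a - v ^ 2) 0| |max (b - v ^ 2) 0| ^ (n + 1 - 1) ≤ R ^ n :=
      pow_le_pow_left₀ (le_max_of_le_left (abs_nonneg _)) (max_le (hR a ha) (hR b hb)) n
    calc _ ≤ (|max (a - v ^ 2) 0 - max (b - v ^ 2) 0| * ((n + 1 : ℕ) : ℝ) *
          max |max (a - v ^ 2) 0| |max (b - v ^ 2) 0| ^ (n + 1 - 1)) * ‖F v‖ :=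
          mul_le_mul_of_nonneg_right h1 (norm_nonneg _)
      _ ≤ (|a - b| * ((n + 1 : ℕ) : ℝ) * R ^ n) * ‖F v‖ := by gcongr
      _ = _ := by push_cast; ring
  · filter_upwards [ae_sq_ne u (volume.restrict (Ioo (0 : ℝ) 1))] with v hv
    exact ((hasDerivAt_truncPow n hv).ofReal_comp).mul_const (F v)

theorem continuous_truncMoment_zero (hF : IntegrableOn F (Ioo 0 1)) :
    Continuous (truncMoment F 0) := by
  refine continuous_iff_continuousAt.2 fun u => ?_
  refine continuousAt_of_dominated (bound := fun v => ‖F v‖)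
    (.of_forall fun u => (integrable_truncPow_mul hF _ u).aestronglyMeasurable)
    (.of_forall fun u => .of_forall fun v => ?_) hF.norm ?_
  · rw [norm_mul]
    refine mul_le_of_le_one_left (norm_nonneg _) ?_
    simpa using abs_truncPow_le 0 (v := v) (le_refl |u|)
  · filter_upwards [ae_sq_ne u (volume.restrict (Ioo (0 : ℝ) 1))] with v hv
    refine ContinuousAt.mul (Complex.continuous_ofReal.continuousAt.comp ?_) continuousAt_const
    rcases lt_or_gt_of_ne hv with h | h
    · refine (continuousAt_const (y := (1 : ℝ))).congr ?_
      filter_upwards [lt_mem_nhds h] with y hy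
      simp [truncPow, hy]
    · refine (continuousAt_const (y := (0 : ℝ))).congr ?_
      filter_upwards [gt_mem_nhds h] with y hy
      simp [truncPow, not_lt.2 hy.le]

theorem contDiff_truncMoment (hF : IntegrableOn F (Ioo 0 1)) (n : ℕ) :
    ContDiff ℝ n (truncMoment F n) := by
  induction n with
  | zero => exact contDiff_zero.2 (continuous_truncMoment_zero hF)
  | succ n ih =>
    have hd : deriv (truncMoment F (n + 1)) = fun u => ((n : ℂ) + 1) * truncMoment F n u :=
      funext fun u => (hasDerivAt_truncMoment hF n u).deriv
    push_cast
    refine contDiff_succ_iff_deriv.2 ⟨fun u => (hasDerivAt_truncMoment hF n u).differentiableAt,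
      fun h => by simp at h, ?_⟩
    rw [hd]
    exact contDiff_const.mul ih

theorem iteratedDerivWithin_truncMoment (hF : IntegrableOn F (Ioo 0 1)) {n : ℕ} {c : ℂ}
    {H : ℝ → ℂ} (hH : EqOn H (fun u => c * truncMoment F n u) (Ioc 0 1)) {i : ℕ} (hi : i ≤ n) :
    EqOn (iteratedDerivWithin i H (Ioc 0 1))
      (fun u => c * (n.descFactorial i : ℂ) * truncMoment F (n - i) u) (Ioc 0 1) := by
  induction i with
  | zero =>
    intro u hu
    simp [iteratedDerivWithin_zero, hH hu]
  | succ i ih =>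
    have ih := ih (by omega)
    intro u hu
    rw [iteratedDerivWithin_succ, derivWithin_congr ih (ih hu)]
    obtain ⟨j, hj⟩ : ∃ j, n - i = j + 1 := ⟨n - i - 1, by omega⟩
    have hj' : n - (i + 1) = j := by omega
    rw [hj, hj', Nat.descFactorial_succ, hj]
    have hd := ((hasDerivAt_truncMoment hF j u).const_mul (c * (n.descFactorial i : ℂ)))
    rw [hd.hasDerivWithinAt.derivWithin (uniqueDiffOn_Ioc 0 1 u hu)]
    push_cast
    ring

/-- If `F` has the left limit `L` at `1` in the mean, then `∫_0^{√u} F` has the left derivative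
`L / 2` at `u = 1`. -/
theorem hasDerivWithinAt_truncMoment_zero (hF : IntegrableOn F (Ioo 0 1)) {L : ℂ}
    (hL : ∀ ε > 0, ∃ s₀ < 1, ∀ s ∈ Ioo s₀ 1,
      ∫⁻ v in Ioo s 1, ‖F v - L‖ₑ ≤ ENNReal.ofReal (ε * (1 - s))) :
    HasDerivWithinAt (truncMoment F 0) (L / 2) (Ioc 0 1) 1 := by
  rw [hasDerivWithinAt_iff_isLittleO, Asymptotics.isLittleO_iff]
  intro c hc
  obtain ⟨s₀, hs₀, H⟩ := hL (c / 2) (half_pos hc)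
  have hLp : 0 < ‖L‖ + 1 := by positivity
  have hev : ∀ᶠ u in 𝓝 (1 : ℝ), s₀ < u ∧ 1 - c / (‖L‖ + 1) < u :=
    (lt_mem_nhds hs₀).and (lt_mem_nhds (by have := div_pos hc hLp; linarith))
  filter_upwards [mem_nhdsWithin_of_mem_nhds hev, self_mem_nhdsWithin] with u ⟨hu1, hu2⟩ hu
  rcases eq_or_lt_of_le hu.2 with rfl | hlt
  · simp
  set s : ℝ := √u with hs
  have hs2 : s ^ 2 = u := Real.sq_sqrt hu.1.le
  have hs0 : 0 < s := Real.sqrt_pos.2 hu.1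
  have hs1 : s < 1 := by nlinarith
  have hus : u < s := by nlinarith
  have hE := H s ⟨hu1.trans hus, hs1⟩
  have hT1 : truncMoment F 0 1 = ∫ v in Ioo (0 : ℝ) 1, F v := by
    refine setIntegral_congr_fun measurableSet_Ioo fun v hv => ?_
    have : v ^ 2 < 1 := by nlinarith [hv.1, hv.2]
    simp [truncPow, this]
  have hTu : truncMoment F 0 u = ∫ v in Ioo (0 : ℝ) s, F v := by
    have h1 : truncMoment F 0 u = ∫ v in Ioo (0 : ℝ) 1, (Iio s).indicator F v := by
      refine setIntegral_congr_fun measurableSet_Ioo fun v hv => ?_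
      have : v ^ 2 < u ↔ v < s := by
        rw [← hs2]; exact pow_lt_pow_iff_left₀ hv.1.le hs0.le two_ne_zero
      by_cases hvs : v < s
      · simp [truncPow, this, hvs]
      · simp [truncPow, this, hvs]
    rw [h1, setIntegral_indicator measurableSet_Iio]
    congr 2
    ext v
    simp only [mem_inter_iff, mem_Ioo, mem_Iio]
    constructor
    · exact fun h => ⟨h.1.1, h.2⟩
    · exact fun h => ⟨⟨h.1, h.2.trans hs1⟩, h.2⟩
  have hsub : Ioo s 1 ⊆ Ioo (0 : ℝ) 1 := Ioo_subset_Ioo_left hs0.le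
  have hFs : IntegrableOn F (Ioo s 1) := hF.mono_set hsub
  have hsplit : ∫ v in Ioo (0 : ℝ) 1, F v = (∫ v in Ioo (0 : ℝ) s, F v) + ∫ v in Ioo s 1, F v := by
    rw [← integral_Ioc_eq_integral_Ioo (x := (0 : ℝ)) (y := s), ← setIntegral_union
      (Set.disjoint_left.2 fun v hv hv' => not_lt.2 hv.2 hv'.1) measurableSet_Ioo
      (hF.mono_set fun v hv => ⟨hv.1, hv.2.trans_lt hs1⟩) hFs, Ioc_union_Ioo_eq_Ioo hs0.le hs1]
  have hmean : ∫ v in Ioo s 1, F v = (∫ v in Ioo s 1, (F v - L)) + ((1 - s : ℝ) : ℂ) * L := by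
    rw [integral_sub hFs (integrableOn_const (by simp)), setIntegral_const]
    simp [Measure.real, hs1.le]
  have hEn : ‖∫ v in Ioo s 1, (F v - L)‖ ≤ c / 2 * (1 - s) := by
    have := (enorm_integral_le_lintegral_enorm (μ := volume.restrict (Ioo s 1))
      fun v => F v - L).trans hE
    rw [← ofReal_norm] at this
    exact (ENNReal.ofReal_le_ofReal_iff (by nlinarith)).1 this
  have hid : truncMoment F 0 u - truncMoment F 0 1 - (u - 1) • (L / 2) =
      -(∫ v in Ioo s 1, (F v - L)) - ((((1 - s) ^ 2 / 2 : ℝ)) : ℂ) * L := by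
    rw [hT1, hTu, hsplit, hmean, Complex.real_smul, ← hs2]
    push_cast
    ring
  have h2 : (1 - s) * ‖L‖ ≤ c := by
    have h3 : (1 - u) * (‖L‖ + 1) < c := by
      rw [← lt_div_iff₀ hLp]; linarith
    nlinarith [norm_nonneg L]
  rw [hid, Real.norm_eq_abs, abs_of_neg (by linarith : u - 1 < 0)]
  refine (norm_sub_le _ _).trans ?_
  rw [norm_neg, norm_mul, Complex.norm_real, Real.norm_of_nonneg (by positivity)]
  nlinarith [norm_nonneg L]

end TruncatedPower

/-! ### Composition of Abel transforms -/

section AbelKernel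

variable {k : ℕ}

/-- The substitution `τ = (q² - v²) / (t² - v²)` turns this into the Beta integral. -/
theorem lintegral_abel_beta {v t : ℝ} (hv : 0 ≤ v) (hvt : v < t) :
    ∫⁻ q in Ioo v t, ENNReal.ofReal (q * (q ^ 2 - v ^ 2) ^ (((k : ℝ) - 1) / 2) *
      (t ^ 2 - q ^ 2) ^ (((k : ℝ) - 1) / 2)) =
    ENNReal.ofReal (ProbabilityTheory.beta (((k : ℝ) + 1) / 2) (((k : ℝ) + 1) / 2) / 2 *
      (t ^ 2 - v ^ 2) ^ k) := by
  have hk : (0 : ℝ) < ((k : ℝ) + 1) / 2 := by positivity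
  set B := ProbabilityTheory.beta (((k : ℝ) + 1) / 2) (((k : ℝ) + 1) / 2) with hB
  have hBpos : 0 < B := ProbabilityTheory.beta_pos hk hk
  have hb : ((k : ℝ) + 1) / 2 - 1 = ((k : ℝ) - 1) / 2 := by ring
  have h1 := ProbabilityTheory.lintegral_betaPDF_eq_one hk hk
  rw [ProbabilityTheory.lintegral_betaPDF, ← hB, hb] at h1
  set Δ : ℝ := t ^ 2 - v ^ 2 with hΔ
  have hΔpos : 0 < Δ := by simp only [hΔ]; nlinarith
  have him : (fun q : ℝ => (q ^ 2 - v ^ 2) / Δ) '' Ioo v t = Ioo 0 1 := by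
    ext τ
    constructor
    · rintro ⟨q, ⟨hq1, hq2⟩, rfl⟩
      refine ⟨div_pos (by nlinarith) hΔpos, (div_lt_one hΔpos).2 ?_⟩
      simp only [hΔ]; nlinarith
    · rintro ⟨h0, h1⟩
      have hn : 0 ≤ v ^ 2 + Δ * τ := by positivity
      refine ⟨√(v ^ 2 + Δ * τ), ⟨?_, ?_⟩, ?_⟩
      · refine Real.lt_sqrt_of_sq_lt ?_
        nlinarith [mul_pos hΔpos h0]
      · rw [Real.sqrt_lt' (by linarith)]
        have : Δ * τ < Δ := by nlinarith
        linarith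
      · simp only [Real.sq_sqrt hn]
        field_simp
        ring
  rw [← him, lintegral_image_eq_lintegral_abs_deriv_mul measurableSet_Ioo
    (f' := fun q => 2 * q / Δ) (fun q _ => by
      have := (((hasDerivAt_id' q).fun_pow 2).sub_const (v ^ 2)).div_const Δ
      simpa using this.hasDerivWithinAt) (by
      intro p hp q hq hpq
      have h2 : p ^ 2 = q ^ 2 := by
        have := (div_left_inj' hΔpos.ne').1 hpq
        linarith
      exact (sq_eq_sq₀ (by linarith [hp.1]) (by linarith [hq.1])).1 h2)] at h1
  have h3 : ∀ q ∈ Ioo v t, ENNReal.ofReal |2 * q / Δ| * ENNReal.ofReal (1 / B *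
      ((q ^ 2 - v ^ 2) / Δ) ^ (((k : ℝ) - 1) / 2) *
      (1 - (q ^ 2 - v ^ 2) / Δ) ^ (((k : ℝ) - 1) / 2)) =
      ENNReal.ofReal (2 / B / Δ ^ k) * ENNReal.ofReal (q * (q ^ 2 - v ^ 2) ^ (((k : ℝ) - 1) / 2) *
      (t ^ 2 - q ^ 2) ^ (((k : ℝ) - 1) / 2)) := by
    rintro q ⟨hq1, hq2⟩
    have hq0 : 0 < q := by linarith
    have e1 : 1 - (q ^ 2 - v ^ 2) / Δ = (t ^ 2 - q ^ 2) / Δ := by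
      field_simp
      simp only [hΔ]
      ring
    have p1 : 0 < q ^ 2 - v ^ 2 := by nlinarith
    have p2 : 0 < t ^ 2 - q ^ 2 := by nlinarith
    have e2 : Δ * (Δ ^ (((k : ℝ) - 1) / 2) * Δ ^ (((k : ℝ) - 1) / 2)) = Δ ^ k := by
      rw [← Real.rpow_add hΔpos]
      nth_rewrite 1 [← Real.rpow_one Δ]
      rw [← Real.rpow_add hΔpos, ← Real.rpow_natCast]
      congr 1
      ring
    rw [e1, Real.div_rpow p1.le hΔpos.le, Real.div_rpow p2.le hΔpos.le, ← e2,
      abs_of_pos (by positivity), ← ENNReal.ofReal_mul (by positivity),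
      ← ENNReal.ofReal_mul (by positivity)]
    congr 1
    have := (Real.rpow_pos_of_pos hΔpos (((k : ℝ) - 1) / 2)).ne'
    field_simp
  rw [setLIntegral_congr_fun measurableSet_Ioo h3,
    lintegral_const_mul' _ _ ENNReal.ofReal_ne_top, mul_comm] at h1
  rw [ENNReal.eq_inv_of_mul_eq_one_left h1, ← ENNReal.ofReal_inv_of_pos (by positivity)]
  congr 1
  field_simp

/-- The kernel `q (q² - v²)^{(k-1)/2} (t² - q²)^{(k-1)/2}` on the triangle `0 < v < q < t`. It is
the composition of the two Abel type transforms in the inversion formula. -/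
noncomputable def abelKernel (k : ℕ) (t q v : ℝ) : ℝ :=
  if 0 < v ∧ v < q ∧ q < t then
    q * (q ^ 2 - v ^ 2) ^ (((k : ℝ) - 1) / 2) * (t ^ 2 - q ^ 2) ^ (((k : ℝ) - 1) / 2)
  else 0

theorem measurable_abelKernel (t : ℝ) :
    Measurable fun p : ℝ × ℝ => abelKernel k t p.1 p.2 := by
  have h1 : MeasurableSet {p : ℝ × ℝ | 0 < p.2} := measurableSet_lt (by fun_prop) (by fun_prop)
  have h2 : MeasurableSet {p : ℝ × ℝ | p.2 < p.1} := measurableSet_lt (by fun_prop) (by fun_prop)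
  have h3 : MeasurableSet {p : ℝ × ℝ | p.1 < t} := measurableSet_lt (by fun_prop) (by fun_prop)
  exact Measurable.ite (h1.inter (h2.inter h3)) (by fun_prop) (by fun_prop)

theorem abelKernel_nonneg (t q v : ℝ) : 0 ≤ abelKernel k t q v := by
  unfold abelKernel
  split_ifs with h
  · have h1 : 0 < q ^ 2 - v ^ 2 := by nlinarith
    have h2 : 0 < t ^ 2 - q ^ 2 := by nlinarith
    have h3 : 0 < q := by linarith
    positivity
  · exact le_rfl

theorem lintegral_abelKernel (t v : ℝ) :
    ∫⁻ q, ENNReal.ofReal (abelKernel k t q v) = (Ioo 0 t).indicator (fun v => ENNReal.ofReal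
      (ProbabilityTheory.beta (((k : ℝ) + 1) / 2) (((k : ℝ) + 1) / 2) / 2 *
        (t ^ 2 - v ^ 2) ^ k)) v := by
  by_cases hv : v ∈ Ioo 0 t
  · rw [indicator_of_mem hv, ← lintegral_abel_beta hv.1.le hv.2,
      ← lintegral_indicator measurableSet_Ioo]
    refine lintegral_congr fun q => ?_
    unfold abelKernel
    by_cases hq : q ∈ Ioo v t
    · rw [indicator_of_mem hq, if_pos ⟨hv.1, hq.1, hq.2⟩]
    · rw [indicator_of_notMem hq, if_neg (fun h => hq h.2), ENNReal.ofReal_zero]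
  · rw [indicator_of_notMem hv]
    have : ∀ q, abelKernel k t q v = 0 := fun q =>
      if_neg (fun h => hv ⟨h.1, h.2.1.trans h.2.2⟩)
    simp [this]

theorem integral_abelKernel (t v : ℝ) :
    ∫ q, abelKernel k t q v = (Ioo 0 t).indicator (fun v =>
      ProbabilityTheory.beta (((k : ℝ) + 1) / 2) (((k : ℝ) + 1) / 2) / 2 *
        (t ^ 2 - v ^ 2) ^ k) v := by
  have hk : (0 : ℝ) < ((k : ℝ) + 1) / 2 := by positivity
  have hBpos := ProbabilityTheory.beta_pos hk hk
  rw [integral_eq_lintegral_of_nonneg_ae (.of_forall fun q => abelKernel_nonneg t q v)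
    ((measurable_abelKernel t).comp
      (measurable_id.prodMk measurable_const)).aestronglyMeasurable, lintegral_abelKernel]
  by_cases hv : v ∈ Ioo 0 t
  · have : 0 < t ^ 2 - v ^ 2 := by nlinarith [hv.1, hv.2]
    rw [indicator_of_mem hv, indicator_of_mem hv, ENNReal.toReal_ofReal (by positivity)]
  · rw [indicator_of_notMem hv, indicator_of_notMem hv, ENNReal.toReal_zero]

/-- The iterated integral is finite because the integral of the kernel over `q` is bounded. This
gives Fubini's theorem, and all convergence claims about the inner integrals. -/
theorem lintegral_lintegral_abelKernel_lt_top {G : ℝ → ℝ≥0∞} (hG : Measurable G)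
    (hGi : ∫⁻ v in Ioo (0 : ℝ) 1, G v ≠ ⊤) {t : ℝ} (ht : t ≤ 1) :
    ∫⁻ q, ∫⁻ v, ENNReal.ofReal (abelKernel k t q v) * G v < ⊤ := by
  have hk : (0 : ℝ) < ((k : ℝ) + 1) / 2 := by positivity
  have hBpos := ProbabilityTheory.beta_pos hk hk
  rw [lintegral_lintegral_swap]
  swap
  · exact ((measurable_abelKernel t).ennreal_ofReal.mul (hG.comp measurable_snd)).aemeasurable
  have h1 : ∀ v, ∫⁻ q, ENNReal.ofReal (abelKernel k t q v) * G v ≤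
      ENNReal.ofReal (ProbabilityTheory.beta (((k : ℝ) + 1) / 2) (((k : ℝ) + 1) / 2) / 2) *
        (Ioo 0 1).indicator G v := by
    intro v
    have hm : Measurable fun q => ENNReal.ofReal (abelKernel k t q v) :=
      ((measurable_abelKernel t).comp (measurable_id.prodMk measurable_const)).ennreal_ofReal
    rw [lintegral_mul_const _ hm, lintegral_abelKernel]
    by_cases hv : v ∈ Ioo 0 t
    · rw [indicator_of_mem hv, indicator_of_mem (show v ∈ Ioo (0 : ℝ) 1 from
        ⟨hv.1, hv.2.trans_le ht⟩)]
      refine mul_le_mul_left (ENNReal.ofReal_le_ofReal ?_) _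
      refine mul_le_of_le_one_right (by positivity) (pow_le_one₀ ?_ ?_) <;> nlinarith [hv.1, hv.2]
    · rw [indicator_of_notMem hv, zero_mul]
      exact zero_le
  refine (lintegral_mono h1).trans_lt ?_
  rw [lintegral_const_mul _ (hG.indicator measurableSet_Ioo), lintegral_indicator measurableSet_Ioo]
  exact ENNReal.mul_lt_top ENNReal.ofReal_lt_top hGi.lt_top

theorem ae_lintegral_abel_lt_top {G : ℝ → ℝ≥0∞} (hG : Measurable G)
    (hGi : ∫⁻ v in Ioo (0 : ℝ) 1, G v ≠ ⊤) :
    ∀ᵐ q : ℝ, q ∈ Ioo (0 : ℝ) 1 →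
      ∫⁻ v in Ioo 0 q, G v * ENNReal.ofReal ((q ^ 2 - v ^ 2) ^ (((k : ℝ) - 1) / 2)) < ⊤ := by
  have hm : Measurable fun q => ∫⁻ v, ENNReal.ofReal (abelKernel k 1 q v) * G v :=
    Measurable.lintegral_prod_right'
      ((measurable_abelKernel (k := k) 1).ennreal_ofReal.mul (hG.comp measurable_snd))
  filter_upwards [ae_lt_top hm (lintegral_lintegral_abelKernel_lt_top hG hGi le_rfl).ne]
    with q hq hq1
  have h1 : 0 < 1 ^ 2 - q ^ 2 := by nlinarith [hq1.1, hq1.2]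
  have hc : 0 < q * (1 ^ 2 - q ^ 2) ^ (((k : ℝ) - 1) / 2) :=
    mul_pos hq1.1 (Real.rpow_pos_of_pos h1 _)
  have h2 : ∫⁻ v, ENNReal.ofReal (abelKernel k 1 q v) * G v =
      ENNReal.ofReal (q * (1 ^ 2 - q ^ 2) ^ (((k : ℝ) - 1) / 2)) *
      ∫⁻ v in Ioo 0 q, G v * ENNReal.ofReal ((q ^ 2 - v ^ 2) ^ (((k : ℝ) - 1) / 2)) := by
    rw [← lintegral_const_mul' _ _ ENNReal.ofReal_ne_top, ← lintegral_indicator measurableSet_Ioo]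
    refine lintegral_congr fun v => ?_
    unfold abelKernel
    by_cases hv : v ∈ Ioo 0 q
    · rw [indicator_of_mem hv, if_pos ⟨hv.1, hv.2, hq1.2⟩, mul_comm (G v), ← mul_assoc,
        ← ENNReal.ofReal_mul hc.le]
      congr 2
      ring
    · rw [indicator_of_notMem hv, if_neg (fun h => hv ⟨h.1, h.2.1⟩), ENNReal.ofReal_zero, zero_mul]
  rw [h2] at hq
  by_contra hcon
  rw [not_lt_top_iff.1 hcon, ENNReal.mul_top (by simpa using hc)] at hq
  exact lt_irrefl _ hq

variable {F : ℝ → ℂ}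

theorem integrable_abelKernel_mul (hFm : Measurable F) (hF : IntegrableOn F (Ioo 0 1)) {t : ℝ}
    (ht : t ≤ 1) : Integrable (Function.uncurry fun q v => (abelKernel k t q v : ℂ) * F v)
      ((volume : Measure ℝ).prod volume) := by
  have hm : Measurable (Function.uncurry fun q v => (abelKernel k t q v : ℂ) * F v) :=
    (Complex.measurable_ofReal.comp (measurable_abelKernel t)).mul (hFm.comp measurable_snd)
  refine ⟨hm.aestronglyMeasurable, ?_⟩
  rw [hasFiniteIntegral_iff_enorm, lintegral_prod _ hm.enorm.aemeasurable]
  refine lt_of_le_of_lt (le_of_eq ?_) (lintegral_lintegral_abelKernel_lt_top (k := k)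
    hFm.enorm hF.hasFiniteIntegral.ne ht)
  refine lintegral_congr fun q => lintegral_congr fun v => ?_
  rw [Function.uncurry_apply_pair, enorm_mul, ← ofReal_norm (abelKernel k t q v : ℂ),
    Complex.norm_real, Real.norm_of_nonneg (abelKernel_nonneg t q v)]

theorem integral_abelKernel_mul (hFm : Measurable F) (hF : IntegrableOn F (Ioo 0 1)) {t : ℝ}
    (ht0 : 0 < t) (ht : t ≤ 1) :
    ∫ q, ∫ v, (abelKernel k t q v : ℂ) * F v =
      (ProbabilityTheory.beta (((k : ℝ) + 1) / 2) (((k : ℝ) + 1) / 2) / 2 : ℝ) *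
        truncMoment F k (t ^ 2) := by
  rw [integral_integral_swap (integrable_abelKernel_mul hFm hF ht), truncMoment,
    ← integral_const_mul, ← integral_indicator measurableSet_Ioo]
  refine integral_congr_ae (.of_forall fun v => ?_)
  simp only
  rw [integral_mul_const, integral_complex_ofReal, integral_abelKernel]
  by_cases hv : v ∈ Ioo 0 t
  · have h1 : v ^ 2 < t ^ 2 := by nlinarith [hv.1, hv.2]
    rw [indicator_of_mem hv,
      indicator_of_mem (show v ∈ Ioo (0 : ℝ) 1 from ⟨hv.1, hv.2.trans_le ht⟩), truncPow, if_pos h1]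
    push_cast
    ring
  · rw [indicator_of_notMem hv]
    by_cases hv1 : v ∈ Ioo 0 1
    · have h1 : ¬ v ^ 2 < t ^ 2 := by
        have : t ≤ v := not_lt.1 fun h => hv ⟨hv1.1, h⟩
        rw [not_lt]
        exact pow_le_pow_left₀ ht0.le this 2
      rw [indicator_of_mem hv1, truncPow, if_neg h1]
      simp
    · rw [indicator_of_notMem hv1]
      simp

/-- The composition of two Abel type transforms is an iterated integral with respect to `v²`. -/
theorem abel_composition (hFm : Measurable F) (hF : IntegrableOn F (Ioo 0 1)) {D : ℝ → ℂ} {c : ℂ}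
    (hD : ∀ᵐ q : ℝ, q ∈ Ioo (0 : ℝ) 1 → D q = c * (((q ^ k)⁻¹ : ℝ) : ℂ) *
      ∫ v in Ioo 0 q, (((q ^ 2 - v ^ 2) ^ (((k : ℝ) - 1) / 2) : ℝ) : ℂ) * F v)
    {t : ℝ} (ht : t ∈ Ioc (0 : ℝ) 1) :
    IntervalIntegrable (fun q => D q *
      ((q ^ (k + 1) * (t ^ 2 - q ^ 2) ^ (((k : ℝ) - 1) / 2) : ℝ) : ℂ)) volume 0 t ∧
    ∫ q in (0 : ℝ)..t, D q * ((q ^ (k + 1) * (t ^ 2 - q ^ 2) ^ (((k : ℝ) - 1) / 2) : ℝ) : ℂ) =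
      c * (ProbabilityTheory.beta (((k : ℝ) + 1) / 2) (((k : ℝ) + 1) / 2) / 2 : ℝ) *
        truncMoment F k (t ^ 2) := by
  have hint := (integrable_abelKernel_mul (k := k) hFm hF ht.2).integral_prod_left
  simp only [Function.uncurry_apply_pair] at hint
  have hEq : ∀ᵐ q ∂(volume.restrict (Ioo (0 : ℝ) t)),
      c * ∫ v, (abelKernel k t q v : ℂ) * F v = D q *
        ((q ^ (k + 1) * (t ^ 2 - q ^ 2) ^ (((k : ℝ) - 1) / 2) : ℝ) : ℂ) := by
    filter_upwards [ae_restrict_of_ae hD, ae_restrict_mem measurableSet_Ioo] with q hq hq1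
    rw [hq ⟨hq1.1, hq1.2.trans_le ht.2⟩]
    have h1 : ∫ v, (abelKernel k t q v : ℂ) * F v =
        ((q * (t ^ 2 - q ^ 2) ^ (((k : ℝ) - 1) / 2) : ℝ) : ℂ) *
        ∫ v in Ioo 0 q, (((q ^ 2 - v ^ 2) ^ (((k : ℝ) - 1) / 2) : ℝ) : ℂ) * F v := by
      rw [← integral_const_mul, ← integral_indicator measurableSet_Ioo]
      refine integral_congr_ae (.of_forall fun v => ?_)
      simp only [abelKernel]
      by_cases hv : v ∈ Ioo 0 q
      · rw [indicator_of_mem hv, if_pos ⟨hv.1, hv.2, hq1.2⟩]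
        push_cast
        ring
      · rw [indicator_of_notMem hv, if_neg (fun h => hv ⟨h.1, h.2.1⟩), Complex.ofReal_zero,
          zero_mul]
    rw [h1]
    have hq0 : (q : ℂ) ≠ 0 := Complex.ofReal_ne_zero.2 hq1.1.ne'
    push_cast
    field_simp
    ring
  have hzero : ∀ q ∉ Ioo 0 t, c * ∫ v, (abelKernel k t q v : ℂ) * F v = 0 := by
    intro q hq
    have : ∀ v, abelKernel k t q v = 0 := fun v =>
      if_neg (fun h => hq ⟨h.1.trans h.2.1, h.2.2⟩)
    simp [this]
  constructor
  · rw [intervalIntegrable_iff_integrableOn_Ioo_of_le ht.1.le]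
    exact (hint.const_mul c).integrableOn.congr hEq
  · rw [intervalIntegral.integral_of_le ht.1.le, integral_Ioc_eq_integral_Ioo,
      ← integral_congr_ae hEq, setIntegral_eq_integral_of_forall_compl_eq_zero hzero,
      integral_const_mul, integral_abelKernel_mul hFm hF ht.1 ht.2, mul_assoc]

end AbelKernel

/-! ### Scaling of the Abel weight -/

section Scaling

variable {k : ℕ}

/-- The substitution `v = |q s|`. -/
theorem lintegral_comp_abs_mul {q : ℝ} (hq : 0 < q) (φ : ℝ → ℝ≥0∞) :
    ∫⁻ s in Ioo (-1 : ℝ) 1, φ |q * s| * ENNReal.ofReal ((1 - s ^ 2) ^ (((k : ℝ) - 1) / 2)) =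
      ENNReal.ofReal (2 * (q ^ k)⁻¹) *
        ∫⁻ v in Ioo 0 q, φ v * ENNReal.ofReal ((q ^ 2 - v ^ 2) ^ (((k : ℝ) - 1) / 2)) := by
  have hpos : ∫⁻ s in Ioo (0 : ℝ) 1, φ |q * s| *
      ENNReal.ofReal ((1 - s ^ 2) ^ (((k : ℝ) - 1) / 2)) = ENNReal.ofReal ((q ^ k)⁻¹) *
        ∫⁻ v in Ioo 0 q, φ v * ENNReal.ofReal ((q ^ 2 - v ^ 2) ^ (((k : ℝ) - 1) / 2)) := by
    have him : (fun s : ℝ => q * s) '' Ioo 0 1 = Ioo 0 q := by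
      have := Set.image_mul_left_Ioo hq 0 1
      simpa using this
    rw [← him, lintegral_image_eq_lintegral_abs_deriv_mul measurableSet_Ioo (f' := fun _ => q)
      (fun s _ => by simpa using ((hasDerivAt_id' s).const_mul q).hasDerivWithinAt)
      (fun a _ b _ h => mul_left_cancel₀ hq.ne' h),
      ← lintegral_const_mul' _ _ ENNReal.ofReal_ne_top]
    refine setLIntegral_congr_fun measurableSet_Ioo fun s hs => ?_
    have h1 : 0 < 1 - s ^ 2 := by nlinarith [hs.1, hs.2]
    have h2 : q ^ 2 - (q * s) ^ 2 = q ^ (2 : ℝ) * (1 - s ^ 2) := by rw [Real.rpow_two]; ring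
    have h3 : (q ^ k)⁻¹ * (q * (q ^ (2 : ℝ)) ^ (((k : ℝ) - 1) / 2)) = 1 := by
      rw [← Real.rpow_mul hq.le]
      nth_rewrite 2 [← Real.rpow_one q]
      rw [← Real.rpow_add hq, show (1 : ℝ) + 2 * (((k : ℝ) - 1) / 2) = k by ring,
        Real.rpow_natCast, inv_mul_cancel₀ (by positivity)]
    rw [abs_of_pos (mul_pos hq hs.1), abs_of_pos hq, h2,
      Real.mul_rpow (by positivity) h1.le, ENNReal.ofReal_mul (by positivity),
      mul_left_comm (φ _), ← mul_assoc, ← mul_assoc, mul_assoc (ENNReal.ofReal _),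
      ← ENNReal.ofReal_mul hq.le, ← ENNReal.ofReal_mul (by positivity), h3, ENNReal.ofReal_one,
      one_mul]
  have hneg : ∫⁻ s in Ioo (-1 : ℝ) 0, φ |q * s| *
      ENNReal.ofReal ((1 - s ^ 2) ^ (((k : ℝ) - 1) / 2)) = ∫⁻ s in Ioo (0 : ℝ) 1, φ |q * s| *
      ENNReal.ofReal ((1 - s ^ 2) ^ (((k : ℝ) - 1) / 2)) := by
    have him : (fun s : ℝ => -s) '' Ioo 0 1 = Ioo (-1) 0 := by simp
    rw [← him, lintegral_image_eq_lintegral_abs_deriv_mul measurableSet_Ioo (f' := fun _ => -1)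
      (fun s _ => (hasDerivAt_neg s).hasDerivWithinAt) (fun a _ b _ h => neg_injective h)]
    simp
  have hsplit : Ioo (-1 : ℝ) 1 =ᵐ[volume] (Ioo (-1 : ℝ) 0 ∪ Ioo 0 1 : Set ℝ) := by
    rw [← Ioc_union_Ioo_eq_Ioo (show (-1 : ℝ) ≤ 0 by norm_num) one_pos]
    exact Ioo_ae_eq_Ioc.symm.union (ae_eq_refl _)
  rw [setLIntegral_congr hsplit, lintegral_union measurableSet_Ioo
    (Set.disjoint_left.2 fun s h1 h2 => lt_asymm h1.2 h2.1), hneg, hpos, ← two_mul, ← mul_assoc,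
    ENNReal.ofReal_mul zero_le_two, ENNReal.ofReal_ofNat]

theorem integral_comp_abs_mul {q : ℝ} (hq : 0 < q) {F : ℝ → ℂ} (hF : Measurable F) :
    ∫ s in Ioo (-1 : ℝ) 1, (((1 - s ^ 2) ^ (((k : ℝ) - 1) / 2) : ℝ) : ℂ) * F |q * s| =
      2 * (((q ^ k)⁻¹ : ℝ) : ℂ) *
        ∫ v in Ioo 0 q, (((q ^ 2 - v ^ 2) ^ (((k : ℝ) - 1) / 2) : ℝ) : ℂ) * F v := by
  have hwm : Measurable fun s : ℝ => ENNReal.ofReal ((1 - s ^ 2) ^ (((k : ℝ) - 1) / 2)) := by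
    fun_prop
  have hwm' : Measurable fun v : ℝ =>
      ENNReal.ofReal ((q ^ 2 - v ^ 2) ^ (((k : ℝ) - 1) / 2)) := by fun_prop
  have habs : Measurable fun s : ℝ => |q * s| := by fun_prop
  have hμ : ((volume.restrict (Ioo (-1 : ℝ) 1)).withDensity
      fun s => ENNReal.ofReal ((1 - s ^ 2) ^ (((k : ℝ) - 1) / 2))).map (fun s => |q * s|) =
      ENNReal.ofReal (2 * (q ^ k)⁻¹) • (volume.restrict (Ioo 0 q)).withDensity
        fun v => ENNReal.ofReal ((q ^ 2 - v ^ 2) ^ (((k : ℝ) - 1) / 2)) := by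
    refine Measure.ext_of_lintegral _ fun φ hφ => ?_
    have hφ' : Measurable fun s : ℝ => φ |q * s| := hφ.comp habs
    rw [lintegral_map hφ habs, lintegral_withDensity_eq_lintegral_mul _ hwm hφ',
      lintegral_smul_measure, lintegral_withDensity_eq_lintegral_mul _ hwm' hφ]
    have h := lintegral_comp_abs_mul (k := k) hq φ
    simp only [mul_comm (φ _)] at h
    exact h
  have h1 : ∫ s, F s ∂(((volume.restrict (Ioo (-1 : ℝ) 1)).withDensity
      fun s => ENNReal.ofReal ((1 - s ^ 2) ^ (((k : ℝ) - 1) / 2))).map (fun s => |q * s|)) =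
      ∫ s in Ioo (-1 : ℝ) 1, (((1 - s ^ 2) ^ (((k : ℝ) - 1) / 2) : ℝ) : ℂ) * F |q * s| := by
    rw [integral_map habs.aemeasurable hF.aestronglyMeasurable,
      integral_withDensity_eq_integral_toReal_smul hwm (.of_forall fun _ => ENNReal.ofReal_lt_top)]
    refine setIntegral_congr_fun measurableSet_Ioo fun s hs => ?_
    have h1 : 0 < 1 - s ^ 2 := by nlinarith [hs.1, hs.2]
    rw [ENNReal.toReal_ofReal (by positivity), Complex.real_smul]
  rw [← h1, hμ, integral_smul_measure,
    integral_withDensity_eq_integral_toReal_smul hwm' (.of_forall fun _ => ENNReal.ofReal_lt_top),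
    ENNReal.toReal_ofReal (by positivity), Complex.real_smul]
  push_cast
  congr 1
  refine setIntegral_congr_fun measurableSet_Ioo fun v hv => ?_
  have h1 : 0 < q ^ 2 - v ^ 2 := by nlinarith [hv.1, hv.2]
  rw [ENNReal.toReal_ofReal (by positivity), Complex.real_smul]

end Scaling

/-! ### Means of even functions over parallels -/

section Parity

variable {m : ℕ}

theorem measurePreserving_neg_equatorMeasure (x : USphere m) :
    MeasurePreserving (sphereMap (LinearIsometryEquiv.neg ℝ)) (equatorMeasure x)
      (equatorMeasure x) := by
  refine ⟨Continuous.measurable ?_, ?_⟩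
  · exact ((LinearIsometryEquiv.neg ℝ (E := (ofNormal x).plane)).continuous.comp
      continuous_subtype_val).subtype_mk _
  · rw [equatorMeasure, Measure.map_smul, map_surfaceMeasure]

theorem tilt_neg (x : USphere m) (v : ℝ) (η : sphere (0 : (ofNormal x).plane) 1) :
    tilt x (Real.arcsin (-v)) (sphereMap (LinearIsometryEquiv.neg ℝ) η) =
      -tilt x (Real.arcsin v) η := by
  refine Subtype.ext ?_
  rw [coe_neg_sphere]
  simp only [tilt, incl, sphereMap, Real.arcsin_neg, Real.sin_neg, Real.cos_neg]
  simp
  abel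

theorem measurable_tilt (x : USphere m) (r : ℝ) : Measurable (tilt x r) :=
  ((continuous_tilt x).comp (continuous_const.prodMk continuous_id)).measurable

theorem parallelMean_neg (x : USphere m) {h : USphere m → ℝ≥0∞} (hh : Measurable h)
    (heven : ∀ y, h (-y) = h y) (v : ℝ) : parallelMean x h (-v) = parallelMean x h v := by
  have hm : Measurable fun η => h (tilt x (Real.arcsin (-v)) η) := hh.comp (measurable_tilt x _)
  rw [parallelMean, ← (measurePreserving_neg_equatorMeasure x).lintegral_comp hm]
  simp only [tilt_neg, heven]
  rfl

theorem parallelMean_abs (x : USphere m) {h : USphere m → ℝ≥0∞} (hh : Measurable h)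
    (heven : ∀ y, h (-y) = h y) (v : ℝ) : parallelMean x h |v| = parallelMean x h v := by
  rcases abs_choice v with h | h <;> rw [h]
  exact parallelMean_neg x hh heven v

/-- The mean of a complex function over the parallel `{y | ⟨x, y⟩ = v}`. -/
noncomputable def parallelIntegral (x : USphere m) (g : USphere m → ℂ) (v : ℝ) : ℂ :=
  ∫ η, g (tilt x (Real.arcsin v) η) ∂(equatorMeasure x)

theorem parallelIntegral_abs (x : USphere m) {g : USphere m → ℂ} (hg : Measurable g)
    (heven : ∀ y, g (-y) = g y) (v : ℝ) : parallelIntegral x g |v| = parallelIntegral x g v := by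
  have hneg : parallelIntegral x g (-v) = parallelIntegral x g v := by
    have hm : Measurable fun η => g (tilt x (Real.arcsin (-v)) η) := hg.comp (measurable_tilt x _)
    rw [parallelIntegral]
    nth_rewrite 1 [← (measurePreserving_neg_equatorMeasure x).map_eq]
    rw [integral_map (measurePreserving_neg_equatorMeasure x).aemeasurable
      hm.aestronglyMeasurable]
    simp only [tilt_neg, heven]
    rfl
  rcases abs_choice v with h | h <;> rw [h]
  exact hneg

theorem measurable_parallelIntegral (x : USphere (m + 2)) {g : USphere (m + 2) → ℂ}
    (hg : Measurable g) : Measurable (parallelIntegral x g) :=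
  (StronglyMeasurable.integral_prod_right'
    (hg.comp (measurable_tilt_arcsin x)).stronglyMeasurable).measurable

theorem enorm_parallelIntegral_le (x : USphere m) (g : USphere m → ℂ) (v : ℝ) :
    ‖parallelIntegral x g v‖ₑ ≤ parallelMean x (fun y => ‖g y‖ₑ) v :=
  enorm_integral_le_lintegral_enorm _

theorem enorm_parallelIntegral_sub_le (x : USphere (m + 2)) {g : USphere (m + 2) → ℂ}
    (hg : Measurable g) (L : ℂ) (v : ℝ) :
    ‖parallelIntegral x g v - L‖ₑ ≤ parallelMean x (fun y => ‖g y - L‖ₑ) v := by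
  by_cases htop : parallelMean x (fun y => ‖g y - L‖ₑ) v = ⊤
  · rw [htop]
    exact le_top
  · have h1 : Integrable (fun η => g (tilt x (Real.arcsin v) η) - L) (equatorMeasure x) :=
      ⟨((hg.comp (measurable_tilt x _)).sub_const L).aestronglyMeasurable,
        lt_top_iff_ne_top.2 htop⟩
    have h2 : parallelIntegral x g v - L =
        ∫ η, (g (tilt x (Real.arcsin v) η) - L) ∂(equatorMeasure x) := by
      have h3 : Integrable (fun η => g (tilt x (Real.arcsin v) η)) (equatorMeasure x) := by
        exact (h1.add (integrable_const L)).congr (.of_forall fun η => by simp)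
      rw [integral_sub h3 (integrable_const L)]
      simp [parallelIntegral]
    rw [h2]
    exact enorm_integral_le_lintegral_enorm _

end Parity

/-! ### The dual transform and the inversion formula under mean convergence -/

section DualRadon

variable {k : ℕ}

theorem radon_ofNormal {g : USphere (k + 2) → ℂ} (hg : Measurable g) (ω : USphere (k + 2)) :
    radon g (ofNormal ω) = ∫ y, g y ∂(equatorKernel k ω) := by
  rw [equatorKernel_apply, integral_map (continuous_incl _).aemeasurable hg.aestronglyMeasurable]
  rfl

theorem measurable_radon {g : USphere (k + 2) → ℂ} (hg : Measurable g) : Measurable (radon g) := by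
  intro s hs
  change MeasurableSet (ofNormal ⁻¹' (radon g ⁻¹' s))
  have h : (fun ω => radon g (ofNormal ω)) = fun ω => ∫ y, g y ∂(equatorKernel k ω) :=
    funext fun ω => radon_ofNormal hg ω
  have hm : Measurable fun ω => radon g (ofNormal ω) := by
    rw [h]
    exact hg.stronglyMeasurable.integral_kernel.measurable
  exact hm hs

theorem measurable_ofNormal {m : ℕ} : Measurable (ofNormal : USphere m → GreatSubsphere m) :=
  fun _ hs => hs

theorem measurable_tilt_arcsin_mul {m : ℕ} (x : USphere m) (q : ℝ) :
    Measurable fun p : ℝ × sphere (0 : (ofNormal x).plane) 1 =>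
      tilt x (Real.arcsin (q * p.1)) p.2 := by
  have h : Continuous fun p : ℝ × sphere (0 : (ofNormal x).plane) 1 =>
      (Real.arcsin (q * p.1), p.2) :=
    (Real.continuous_arcsin.comp (continuous_fst.const_mul q)).prodMk continuous_snd
  exact ((continuous_tilt x).comp h).measurable

/-- The averages over the great sub-spheres at distance `arccos q` from `x` as averages over
parallels, as an identity of measures on the sphere. -/
theorem equatorKernel_comp_tilt (x : USphere (k + 3)) {q : ℝ} (hq : q ∈ Ioo (0 : ℝ) 1) :
    (equatorKernel (k + 1) ∘ₖ Kernel.const Unit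
      ((equatorMeasure x).map (tilt x (Real.arccos q)))) () =
    ENNReal.ofReal (sphereArea (k + 1)) • ((((volume.restrict (Ioo (-1 : ℝ) 1)).withDensity
      fun s => ENNReal.ofReal ((1 - s ^ 2) ^ (((k : ℝ) - 1) / 2))).prod (equatorMeasure x)).map
        fun p => tilt x (Real.arcsin (q * p.1)) p.2) := by
  have hTm := measurable_tilt_arcsin_mul x q
  refine Measure.ext_of_lintegral _ fun h hh => ?_
  have hhT : Measurable fun p : ℝ × sphere (0 : (ofNormal x).plane) 1 =>
      h (tilt x (Real.arcsin (q * p.1)) p.2) := hh.comp hTm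
  rw [Kernel.lintegral_comp _ _ _ hh, Kernel.const_apply,
    lintegral_map hh.lintegral_kernel (measurable_tilt x _),
    lintegral_equatorKernel_tilt x ⟨by linarith [hq.1], hq.2.le⟩ hh, lintegral_smul_measure,
    lintegral_map hh hTm, lintegral_prod _ hhT.aemeasurable,
    lintegral_withDensity_eq_lintegral_mul _ (by fun_prop) hhT.lintegral_prod_right', smul_eq_mul]
  congr 1
  refine lintegral_congr fun s => ?_
  rw [Pi.mul_apply, mul_comm, parallelMean]

theorem integrable_equatorKernel_comp_tilt {g : USphere (k + 3) → ℂ} (hg : Measurable g)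
    (heven : ∀ y, g (-y) = g y) (x : USphere (k + 3)) {q : ℝ} (hq : q ∈ Ioo (0 : ℝ) 1)
    (hfin : ∫⁻ v in Ioo 0 q, parallelMean x (fun y => ‖g y‖ₑ) v *
      ENNReal.ofReal ((q ^ 2 - v ^ 2) ^ (((k : ℝ) - 1) / 2)) < ⊤) :
    Integrable g ((equatorKernel (k + 1) ∘ₖ Kernel.const Unit
      ((equatorMeasure x).map (tilt x (Real.arccos q)))) ()) := by
  have hgm : Measurable fun y => ‖g y‖ₑ := hg.enorm
  refine ⟨hg.aestronglyMeasurable, ?_⟩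
  rw [hasFiniteIntegral_iff_enorm, Kernel.lintegral_comp _ _ _ hgm, Kernel.const_apply,
    lintegral_map hgm.lintegral_kernel (measurable_tilt x _),
    lintegral_equatorKernel_tilt x ⟨by linarith [hq.1], hq.2.le⟩ hgm]
  refine ENNReal.mul_lt_top ENNReal.ofReal_lt_top ?_
  have h1 : ∀ s, parallelMean x (fun y => ‖g y‖ₑ) (q * s) =
      parallelMean x (fun y => ‖g y‖ₑ) |q * s| := fun s =>
    (parallelMean_abs x hgm (fun y => by rw [heven]) (q * s)).symm
  simp only [h1]
  rw [lintegral_comp_abs_mul hq.1]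
  exact ENNReal.mul_lt_top ENNReal.ofReal_lt_top hfin

theorem integral_equatorKernel_comp_tilt {g : USphere (k + 3) → ℂ} (hg : Measurable g)
    (heven : ∀ y, g (-y) = g y) (x : USphere (k + 3)) {q : ℝ} (hq : q ∈ Ioo (0 : ℝ) 1)
    (hint : Integrable g ((equatorKernel (k + 1) ∘ₖ Kernel.const Unit
      ((equatorMeasure x).map (tilt x (Real.arccos q)))) ())) :
    ∫ y, g y ∂((equatorKernel (k + 1) ∘ₖ Kernel.const Unit
      ((equatorMeasure x).map (tilt x (Real.arccos q)))) ()) = 2 * (sphereArea (k + 1) : ℂ) *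
      (((q ^ k)⁻¹ : ℝ) : ℂ) * ∫ v in Ioo 0 q,
        (((q ^ 2 - v ^ 2) ^ (((k : ℝ) - 1) / 2) : ℝ) : ℂ) * parallelIntegral x g v := by
  have hσ : 0 < sphereArea (k + 1) := sphereArea_pos (by omega)
  have hTm := measurable_tilt_arcsin_mul x q
  rw [equatorKernel_comp_tilt x hq] at hint ⊢
  rw [integrable_smul_measure (by simpa using hσ) ENNReal.ofReal_ne_top,
    integrable_map_measure hg.aestronglyMeasurable hTm.aemeasurable] at hint
  have hint2 : Integrable (fun p : ℝ × sphere (0 : (ofNormal x).plane) 1 =>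
      g (tilt x (Real.arcsin (q * p.1)) p.2)) _ := hint
  rw [integral_smul_measure, integral_map hTm.aemeasurable hg.aestronglyMeasurable,
    integral_prod _ hint2, ENNReal.toReal_ofReal hσ.le,
    integral_withDensity_eq_integral_toReal_smul (by fun_prop)
      (.of_forall fun _ => ENNReal.ofReal_lt_top)]
  have h2 := integral_comp_abs_mul (k := k) hq.1 (measurable_parallelIntegral x hg)
  rw [mul_assoc, mul_assoc, mul_left_comm, ← mul_assoc 2, ← h2, Complex.real_smul]
  congr 1
  refine setIntegral_congr_fun measurableSet_Ioo fun s hs => ?_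
  have h1 : 0 < 1 - s ^ 2 := by nlinarith [hs.1, hs.2]
  simp only
  rw [parallelIntegral_abs x hg heven, ENNReal.toReal_ofReal (by positivity), Complex.real_smul,
    parallelIntegral]

/-- For an even function, the average of its Radon transform over the sub-spheres at distance
`arccos q` from `x` is an Abel transform of its means over the parallels. -/
theorem dualRadon_radon {g : USphere (k + 3) → ℂ} (hg : Measurable g)
    (heven : ∀ y, g (-y) = g y) (x : USphere (k + 3)) {q : ℝ} (hq : q ∈ Ioo (0 : ℝ) 1)
    (hfin : ∫⁻ v in Ioo 0 q, parallelMean x (fun y => ‖g y‖ₑ) v *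
      ENNReal.ofReal ((q ^ 2 - v ^ 2) ^ (((k : ℝ) - 1) / 2)) < ⊤) :
    Integrable (radon g) (avgMeasure x (Real.arccos q)) ∧
    dualRadon (radon g) (Real.arccos q) x = 2 * (sphereArea (k + 1) : ℂ) *
      (((q ^ k)⁻¹ : ℝ) : ℂ) * ∫ v in Ioo 0 q,
        (((q ^ 2 - v ^ 2) ^ (((k : ℝ) - 1) / 2) : ℝ) : ℂ) * parallelIntegral x g v := by
  have hint := integrable_equatorKernel_comp_tilt hg heven x hq hfin
  have hmap : avgMeasure x (Real.arccos q) =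
      ((equatorMeasure x).map (tilt x (Real.arccos q))).map ofNormal :=
    (Measure.map_map measurable_ofNormal (measurable_tilt x _)).symm
  have hcomp : (radon g ∘ ofNormal) = fun ω => ∫ y, g y ∂(equatorKernel (k + 1) ω) :=
    funext fun ω => radon_ofNormal hg ω
  constructor
  · rw [hmap, integrable_map_measure (measurable_radon hg).aestronglyMeasurable
      measurable_ofNormal.aemeasurable, hcomp]
    exact hint.integral_comp
  · rw [← integral_equatorKernel_comp_tilt hg heven x hq hint, Kernel.integral_comp hint,
      dualRadon, hmap, integral_map measurable_ofNormal.aemeasurable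
      (measurable_radon hg).aestronglyMeasurable, Kernel.const_apply]
    exact integral_congr_ae (.of_forall fun ω => radon_ofNormal hg ω)

/-- The duplication formula for the Gamma function, in terms of sphere areas. -/
theorem sphereArea_succ_succ (k : ℕ) :
    2 ^ k * sphereArea (k + 1) *
      ProbabilityTheory.beta (((k : ℝ) + 1) / 2) (((k : ℝ) + 1) / 2) = sphereArea (k + 2) := by
  have hG := Real.Gamma_mul_Gamma_add_half (((k : ℝ) + 1) / 2)
  have h1 : (0 : ℝ) < ((k : ℝ) + 1) / 2 := by positivity
  have hp1 := Real.Gamma_pos_of_pos h1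
  have hp2 := Real.Gamma_pos_of_pos (add_pos h1 (by norm_num : (0 : ℝ) < 1 / 2))
  have hp3 := Real.Gamma_pos_of_pos (add_pos h1 h1)
  have e1 : 2 * (((k : ℝ) + 1) / 2) = ((k : ℝ) + 1) / 2 + ((k : ℝ) + 1) / 2 := by ring
  have e2 : ((k : ℝ) + 2) / 2 = ((k : ℝ) + 1) / 2 + 1 / 2 := by ring
  have e3 : (1 : ℝ) - (((k : ℝ) + 1) / 2 + ((k : ℝ) + 1) / 2) = -(k : ℝ) := by ring
  rw [e1, e3, Real.rpow_neg zero_le_two, Real.rpow_natCast, Real.sqrt_eq_rpow] at hG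
  unfold sphereArea ProbabilityTheory.beta
  push_cast
  rw [e2, Real.rpow_add Real.pi_pos]
  field_simp at hG ⊢
  linear_combination hG

/-- The inversion formula at a point at which the means of an even function over small parallels
converge to its value. -/
theorem inversion_of_mean {g : USphere (k + 3) → ℂ} (hg : Measurable g)
    (heven : ∀ y, g (-y) = g y) (x : USphere (k + 3))
    (hfin : ∫⁻ v in Ioo (0 : ℝ) 1, parallelMean x (fun y => ‖g y‖ₑ) v ≠ ⊤)
    (hmean : ∀ ε > 0, ∃ s₀ < 1, ∀ s ∈ Ioo s₀ 1,
      ∫⁻ v in Ioo s 1, parallelMean x (fun y => ‖g y - g x‖ₑ) v ≤ ENNReal.ofReal (ε * (1 - s))) :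
    InversionDefinedAt g x ∧
      g x = ((2 ^ (k + 3 - 2) / ((k + 3 - 3).factorial * sphereArea (k + 3 - 1)) : ℝ) : ℂ) *
        sqDerivAtOne (k + 3 - 2) (inversionIntegral g x) := by
  set F := parallelIntegral x g with hFdef
  have hFm : Measurable F := measurable_parallelIntegral x hg
  have hF : IntegrableOn F (Ioo 0 1) :=
    ⟨hFm.aestronglyMeasurable, (lintegral_mono fun v => enorm_parallelIntegral_le x g v).trans_lt
      hfin.lt_top⟩
  have hL : ∀ ε > 0, ∃ s₀ < 1, ∀ s ∈ Ioo s₀ 1,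
      ∫⁻ v in Ioo s 1, ‖F v - g x‖ₑ ≤ ENNReal.ofReal (ε * (1 - s)) := by
    intro ε hε
    obtain ⟨s₀, h0, H⟩ := hmean ε hε
    exact ⟨s₀, h0, fun s hs => (lintegral_mono fun v =>
      enorm_parallelIntegral_sub_le x hg (g x) v).trans (H s hs)⟩
  have hae := ae_lintegral_abel_lt_top (k := k)
    (measurable_parallelMean x (h := fun y => ‖g y‖ₑ) hg.enorm) hfin
  have hD : ∀ᵐ q : ℝ, q ∈ Ioo (0 : ℝ) 1 → dualRadon (radon g) (Real.arccos q) x =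
      2 * (sphereArea (k + 1) : ℂ) * (((q ^ k)⁻¹ : ℝ) : ℂ) *
      ∫ v in Ioo 0 q, (((q ^ 2 - v ^ 2) ^ (((k : ℝ) - 1) / 2) : ℝ) : ℂ) * F v := by
    filter_upwards [hae] with q hq hq1
    exact (dualRadon_radon hg heven x hq1 (hq hq1)).2
  have hexp : (((k + 3 : ℕ) : ℝ) - 4) / 2 = ((k : ℝ) - 1) / 2 := by push_cast; ring
  have habel : ∀ t ∈ Ioc (0 : ℝ) 1, IntervalIntegrable (inversionIntegrand g x t) volume 0 t ∧
      inversionIntegral g x t = 2 * (sphereArea (k + 1) : ℂ) *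
        (ProbabilityTheory.beta (((k : ℝ) + 1) / 2) (((k : ℝ) + 1) / 2) / 2 : ℝ) *
        truncMoment F k (t ^ 2) := by
    intro t ht
    have h := abel_composition hFm hF hD ht
    unfold inversionIntegral inversionIntegrand
    rw [hexp]
    exact h
  set C : ℂ := 2 * (sphereArea (k + 1) : ℂ) *
        (ProbabilityTheory.beta (((k : ℝ) + 1) / 2) (((k : ℝ) + 1) / 2) / 2 : ℝ) with hC
  have hH : EqOn (fun u : ℝ => inversionIntegral g x (√u)) (fun u => C * truncMoment F k u)
      (Ioc 0 1) := by
    intro u hu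
    have h := (habel (√u) ⟨Real.sqrt_pos.2 hu.1, by simpa using hu.2⟩).2
    rw [Real.sq_sqrt hu.1.le] at h
    exact h
  have h1mem : (1 : ℝ) ∈ Ioc (0 : ℝ) 1 := ⟨one_pos, le_rfl⟩
  have hlast : HasDerivWithinAt
      (iteratedDerivWithin k (fun u : ℝ => inversionIntegral g x (√u)) (Ioc 0 1))
      (C * (k.factorial : ℂ) * (g x / 2)) (Ioc 0 1) 1 := by
    have h1 := (hasDerivWithinAt_truncMoment_zero hF hL).const_mul (C * (k.factorial : ℂ))
    have h2 := iteratedDerivWithin_truncMoment hF hH (le_refl k)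
    rw [Nat.descFactorial_self, Nat.sub_self] at h2
    exact h1.congr h2 (h2 h1mem)
  refine ⟨⟨?_, fun t ht => (habel t ht).1, fun i hi => ⟨?_, ?_⟩⟩, ?_⟩
  · filter_upwards [hae] with q hq hq1
    exact (dualRadon_radon hg heven x hq1 (hq hq1)).1
  · have hi' : i ≤ k := by omega
    refine ContDiffOn.congr (ContDiff.contDiffOn ?_) hH
    exact contDiff_const.mul ((contDiff_truncMoment hF k).of_le (by exact_mod_cast hi'))
  · rcases eq_or_lt_of_le (show i ≤ k by omega) with rfl | hlt
    · exact hlast.differentiableWithinAt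
    · have h2 := iteratedDerivWithin_truncMoment hF hH hlt.le
      refine DifferentiableWithinAt.congr ?_ h2 (h2 h1mem)
      obtain ⟨j, hj⟩ : ∃ j, k - i = j + 1 := ⟨k - i - 1, by omega⟩
      rw [hj]
      exact ((hasDerivAt_truncMoment hF j 1).const_mul _).differentiableAt.differentiableWithinAt
  · change _ = ((2 ^ (k + 1) / (k.factorial * sphereArea (k + 2)) : ℝ) : ℂ) *
      iteratedDerivWithin (k + 1) (fun u : ℝ => inversionIntegral g x (√u)) (Ioc 0 1) 1
    rw [iteratedDerivWithin_succ, hlast.derivWithin (uniqueDiffOn_Ioc 0 1 1 h1mem), hC,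
      ← sphereArea_succ_succ]
    have hk : (0 : ℝ) < ((k : ℝ) + 1) / 2 := by positivity
    have hB : (ProbabilityTheory.beta (((k : ℝ) + 1) / 2) (((k : ℝ) + 1) / 2) : ℂ) ≠ 0 :=
      Complex.ofReal_ne_zero.2 (ProbabilityTheory.beta_pos hk hk).ne'
    have hσ : (sphereArea (k + 1) : ℂ) ≠ 0 :=
      Complex.ofReal_ne_zero.2 (sphereArea_pos (by omega)).ne'
    have hfac : (k.factorial : ℂ) ≠ 0 := by exact_mod_cast k.factorial_ne_zero
    push_cast
    field_simp
    ring

end DualRadon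

/-! ### Removing the weight of the geographic coordinates -/

section Dyadic

/-- A weighted integral over `(s, 1)` that is small compared with the weight controls the
unweighted one: cut `(s, 1)` into the dyadic pieces `2^{-n-1} (1 - s) ≤ 1 - v ≤ 2^{-n} (1 - s)`. -/
theorem lintegral_le_of_weighted {k : ℕ} {N : ℝ → ℝ≥0∞}
    (hN : ∀ ε > 0, ∃ s₀ < 1, ∀ s ∈ Ioo s₀ 1, ∫⁻ v in Ioo s 1, N v *
      ENNReal.ofReal ((1 - v ^ 2) ^ ((k : ℝ) / 2)) ≤
        ENNReal.ofReal (ε * (1 - s) ^ ((k : ℝ) / 2 + 1))) :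
    ∀ ε > 0, ∃ s₀ < 1, ∀ s ∈ Ioo s₀ 1,
      ∫⁻ v in Ioo s 1, N v ≤ ENNReal.ofReal (ε * (1 - s)) := by
  intro ε hε
  set ε' : ℝ := ε / (2 * 2 ^ ((k : ℝ) / 2)) with hε'
  have hε'pos : 0 < ε' := by positivity
  obtain ⟨s₀, h0, H⟩ := hN ε' hε'pos
  refine ⟨max s₀ 0, max_lt h0 one_pos, fun s hs => ?_⟩
  have hs0 : s₀ < s := (le_max_left _ _).trans_lt hs.1
  have hspos : 0 < s := (le_max_right _ _).trans_lt hs.1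
  set δ : ℝ := 1 - s with hδ
  have hδpos : 0 < δ := by linarith [hs.2]
  have hcover : Ioo s 1 ⊆ ⋃ n : ℕ, Ico (1 - δ * (1 / 2) ^ n) (1 - δ * (1 / 2) ^ (n + 1)) := by
    intro v hv
    obtain ⟨n, hn1, hn2⟩ := exists_nat_pow_near_of_lt_one (x := (1 - v) / δ) (y := (1 / 2 : ℝ))
      (div_pos (by linarith [hv.2]) hδpos) ((div_le_one hδpos).2 (by linarith [hv.1]))
      (by norm_num) (by norm_num)
    rw [lt_div_iff₀ hδpos] at hn1
    rw [div_le_iff₀ hδpos] at hn2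
    exact mem_iUnion.2 ⟨n, by linarith, by linarith⟩
  have hpiece : ∀ n : ℕ, ∫⁻ v in Ico (1 - δ * (1 / 2) ^ n) (1 - δ * (1 / 2) ^ (n + 1)), N v ≤
      ENNReal.ofReal (ε / 2 * δ) * ENNReal.ofReal (1 / 2) ^ n := by
    intro n
    set d : ℝ := δ * (1 / 2) ^ n with hd
    have hdpos : 0 < d := by positivity
    have hdδ : d ≤ δ := mul_le_of_le_one_right hδpos.le (pow_le_one₀ (by norm_num) (by norm_num))
    have hd2 : δ * (1 / 2) ^ (n + 1) = d / 2 := by rw [hd, pow_succ]; ring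
    have hc : 0 < (d / 2) ^ ((k : ℝ) / 2) := by positivity
    have h1 : ENNReal.ofReal ((d / 2) ^ ((k : ℝ) / 2)) *
        ∫⁻ v in Ico (1 - d) (1 - d / 2), N v ≤
          ENNReal.ofReal (ε' * d ^ ((k : ℝ) / 2 + 1)) := by
      calc _ = ∫⁻ v in Ico (1 - d) (1 - d / 2),
              ENNReal.ofReal ((d / 2) ^ ((k : ℝ) / 2)) * N v :=
            (lintegral_const_mul' _ _ ENNReal.ofReal_ne_top).symm
        _ ≤ ∫⁻ v in Ico (1 - d) (1 - d / 2), N v *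
              ENNReal.ofReal ((1 - v ^ 2) ^ ((k : ℝ) / 2)) := by
            refine setLIntegral_mono' measurableSet_Ico fun v hv => ?_
            rw [mul_comm]
            refine mul_le_mul_right (ENNReal.ofReal_le_ofReal ?_) _
            refine Real.rpow_le_rpow (by positivity) ?_ (by positivity)
            nlinarith [hv.1, hv.2]
        _ ≤ ∫⁻ v in Ico (1 - d) 1, N v * ENNReal.ofReal ((1 - v ^ 2) ^ ((k : ℝ) / 2)) :=
            lintegral_mono_set (Ico_subset_Ico_right (by linarith))
        _ = ∫⁻ v in Ioo (1 - d) 1, N v * ENNReal.ofReal ((1 - v ^ 2) ^ ((k : ℝ) / 2)) :=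
            (setLIntegral_congr Ioo_ae_eq_Ico).symm
        _ ≤ _ := by
            have := H (1 - d) ⟨by linarith, by linarith⟩
            rwa [sub_sub_cancel] at this
    rw [hd2, ← ENNReal.ofReal_pow (by norm_num), ← ENNReal.ofReal_mul (by positivity)]
    have h2 : ε / 2 * δ * (1 / 2) ^ n =
        ε' * d ^ ((k : ℝ) / 2 + 1) / (d / 2) ^ ((k : ℝ) / 2) := by
      rw [Real.rpow_add hdpos, Real.rpow_one, Real.div_rpow hdpos.le zero_le_two, hε', mul_assoc,
        ← hd]
      field_simp
    rw [h2, ENNReal.ofReal_div_of_pos hc]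
    rw [ENNReal.le_div_iff_mul_le (Or.inl (by simpa using hc)) (Or.inl ENNReal.ofReal_ne_top),
      mul_comm]
    exact h1
  calc ∫⁻ v in Ioo s 1, N v ≤ ∫⁻ v in ⋃ n : ℕ,
        Ico (1 - δ * (1 / 2) ^ n) (1 - δ * (1 / 2) ^ (n + 1)), N v := lintegral_mono_set hcover
    _ ≤ ∑' n : ℕ, ∫⁻ v in Ico (1 - δ * (1 / 2) ^ n) (1 - δ * (1 / 2) ^ (n + 1)), N v :=
        lintegral_iUnion_le _ _
    _ ≤ ∑' n : ℕ, ENNReal.ofReal (ε / 2 * δ) * ENNReal.ofReal (1 / 2) ^ n :=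
        ENNReal.tsum_le_tsum hpiece
    _ = ENNReal.ofReal (ε * δ) := by
        have h3 : (1 : ℝ≥0∞) - ENNReal.ofReal (1 / 2) = ENNReal.ofReal (1 / 2) := by
          rw [← ENNReal.ofReal_one, ← ENNReal.ofReal_sub _ (by norm_num)]
          norm_num
        rw [ENNReal.tsum_mul_left, ENNReal.tsum_geometric, h3,
          ← ENNReal.ofReal_inv_of_pos (by norm_num), ← ENNReal.ofReal_mul (by positivity)]
        congr 1
        ring

end Dyadic

/-! ### Mean convergence at continuity points and Lebesgue points -/

section LebesguePoint

variable {k : ℕ}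

theorem inner_tilt_arcsin {m : ℕ} (x : USphere m) {v : ℝ} (hv : v ∈ Ioo (-1 : ℝ) 1)
    (η : sphere (0 : (ofNormal x).plane) 1) :
    inner ℝ (x : Euc m) (tilt x (Real.arcsin v) η : Euc m) = v := by
  rw [inner_tilt, Real.sin_arcsin hv.1.le hv.2.le]

theorem dist_sq_eq_inner {m : ℕ} (x y : USphere m) :
    dist y x ^ 2 = 2 * (1 - inner ℝ (x : Euc m) (y : Euc m)) := by
  rw [Subtype.dist_eq, dist_eq_norm, norm_sub_sq_real, norm_eq_of_mem_sphere x,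
    norm_eq_of_mem_sphere y, real_inner_comm]
  ring

/-- The integral over the spherical cap `⟨x, y⟩ > s` in geographic coordinates. -/
theorem lintegral_cap (x : USphere (k + 2)) {h : USphere (k + 2) → ℝ≥0∞} (hh : Measurable h)
    {s : ℝ} (hs : -1 ≤ s) :
    ∫⁻ y in {y : USphere (k + 2) | s < inner ℝ (x : Euc (k + 2)) (y : Euc (k + 2))}, h y
        ∂(surfaceMeasure (Euc (k + 2))) =
      ENNReal.ofReal (sphereArea (k + 1)) * ∫⁻ v in Ioo s 1, parallelMean x h v *
        ENNReal.ofReal ((1 - v ^ 2) ^ (((k : ℝ) - 1) / 2)) := by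
  have hms : MeasurableSet
      {y : USphere (k + 2) | s < inner ℝ (x : Euc (k + 2)) (y : Euc (k + 2))} :=
    measurableSet_lt (by fun_prop) (by fun_prop)
  rw [← lintegral_indicator hms, lintegral_surfaceMeasure x (hh.indicator hms)]
  congr 1
  have h1 : ∀ v ∈ Ioo (-1 : ℝ) 1, parallelMean x (indicator
      {y : USphere (k + 2) | s < inner ℝ (x : Euc (k + 2)) (y : Euc (k + 2))} h) v *
        ENNReal.ofReal ((1 - v ^ 2) ^ (((k : ℝ) - 1) / 2)) =
      (Ioi s).indicator (fun v => parallelMean x h v *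
        ENNReal.ofReal ((1 - v ^ 2) ^ (((k : ℝ) - 1) / 2))) v := by
    intro v hv
    by_cases hsv : s < v
    · rw [indicator_of_mem (show v ∈ Ioi s from hsv), parallelMean, parallelMean]
      congr 1
      refine lintegral_congr fun η => indicator_of_mem ?_ _
      change s < inner ℝ _ _
      rwa [inner_tilt_arcsin x hv]
    · rw [indicator_of_notMem (show v ∉ Ioi s from hsv), parallelMean]
      have h2 : ∀ η, indicator
          {y : USphere (k + 2) | s < inner ℝ (x : Euc (k + 2)) (y : Euc (k + 2))} h
          (tilt x (Real.arcsin v) η) = 0 := by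
        intro η
        refine indicator_of_notMem ?_ _
        change ¬ s < inner ℝ _ _
        rwa [inner_tilt_arcsin x hv]
      simp [h2]
  rw [setLIntegral_congr_fun measurableSet_Ioo h1, setLIntegral_indicator measurableSet_Ioi]
  congr 2
  ext v
  simp only [mem_inter_iff, mem_Ioi, mem_Ioo]
  constructor
  · exact fun h => ⟨h.1, h.2.2⟩
  · exact fun h => ⟨h.1, by linarith, h.2⟩

/-- The parallel means are integrable up to the pole: away from the pole the weight of the
geographic coordinates is bounded below, and near it they are close to `g x` in the mean. -/
theorem lintegral_parallelMean_ne_top {g : USphere (k + 3) → ℂ} (hg : Measurable g)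
    (hgi : ∫⁻ y, ‖g y‖ₑ ∂(surfaceMeasure (Euc (k + 3))) ≠ ⊤) (x : USphere (k + 3))
    (hmean : ∀ ε > 0, ∃ s₀ < 1, ∀ s ∈ Ioo s₀ 1,
      ∫⁻ v in Ioo s 1, parallelMean x (fun y => ‖g y - g x‖ₑ) v ≤ ENNReal.ofReal (ε * (1 - s))) :
    ∫⁻ v in Ioo (0 : ℝ) 1, parallelMean x (fun y => ‖g y‖ₑ) v ≠ ⊤ := by
  have hgm : Measurable fun y => ‖g y‖ₑ := hg.enorm
  obtain ⟨s₀, h0, H⟩ := hmean 1 one_pos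
  obtain ⟨s, hs1, hs2⟩ := exists_between (max_lt h0 one_pos)
  have hs0 : 0 < s := (le_max_right _ _).trans_lt hs1
  have H := H s ⟨(le_max_left _ _).trans_lt hs1, hs2⟩
  have hsplit : Ioo (0 : ℝ) 1 ⊆ Ioc 0 s ∪ Ioo s 1 :=
    (Ioc_union_Ioo_eq_Ioo hs0.le hs2).symm.subset
  have h1 : ∫⁻ v in Ioo s 1, parallelMean x (fun y => ‖g y‖ₑ) v < ⊤ := by
    have h2 : ∀ v, parallelMean x (fun y => ‖g y‖ₑ) v ≤
        parallelMean x (fun y => ‖g y - g x‖ₑ) v + ‖g x‖ₑ := by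
      intro v
      calc parallelMean x (fun y => ‖g y‖ₑ) v ≤
          ∫⁻ η, (‖g (tilt x (Real.arcsin v) η) - g x‖ₑ + ‖g x‖ₑ) ∂(equatorMeasure x) := by
            refine lintegral_mono fun η => ?_
            calc ‖g (tilt x (Real.arcsin v) η)‖ₑ =
                ‖(g (tilt x (Real.arcsin v) η) - g x) + g x‖ₑ := by rw [sub_add_cancel]
              _ ≤ _ := enorm_add_le _ _
        _ = _ := by
            rw [lintegral_add_right _ measurable_const]
            simp [parallelMean]
    refine (lintegral_mono h2).trans_lt ?_
    rw [lintegral_add_right _ measurable_const]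
    refine ENNReal.add_lt_top.2 ⟨H.trans_lt ENNReal.ofReal_lt_top, ?_⟩
    simp [ENNReal.mul_lt_top_iff]
  have h2 : ∫⁻ v in Ioc 0 s, parallelMean x (fun y => ‖g y‖ₑ) v < ⊤ := by
    have h3 := lintegral_surfaceMeasure (k := k + 1) x hgm
    have hexp : (((k + 1 : ℕ) : ℝ) - 1) / 2 = (k : ℝ) / 2 := by push_cast; ring
    rw [hexp] at h3
    have hσ : 0 < sphereArea (k + 1 + 1) := sphereArea_pos (by omega)
    have h4 : ∫⁻ v in Ioo (-1 : ℝ) 1, parallelMean x (fun y => ‖g y‖ₑ) v *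
        ENNReal.ofReal ((1 - v ^ 2) ^ ((k : ℝ) / 2)) < ⊤ := by
      by_contra hcon
      rw [not_lt_top_iff.1 hcon, ENNReal.mul_top (by simpa using hσ)] at h3
      exact hgi h3
    have hc : 0 < (1 - s ^ 2) ^ ((k : ℝ) / 2) := Real.rpow_pos_of_pos (by nlinarith) _
    have h5 : ENNReal.ofReal ((1 - s ^ 2) ^ ((k : ℝ) / 2)) *
        ∫⁻ v in Ioc 0 s, parallelMean x (fun y => ‖g y‖ₑ) v < ⊤ := by
      rw [← lintegral_const_mul' _ _ ENNReal.ofReal_ne_top]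
      refine lt_of_le_of_lt ?_ h4
      refine (setLIntegral_mono' measurableSet_Ioc fun v hv => ?_).trans
        (lintegral_mono_set (t := Ioo (-1 : ℝ) 1) fun v hv =>
          ⟨by linarith [hv.1], hv.2.trans_lt hs2⟩)
      rw [mul_comm]
      refine mul_le_mul_right (ENNReal.ofReal_le_ofReal ?_) _
      refine Real.rpow_le_rpow (by nlinarith) ?_ (by positivity)
      nlinarith [hv.1, hv.2]
    by_contra hcon
    rw [not_lt_top_iff.1 hcon, ENNReal.mul_top (by simpa using hc)] at h5
    exact lt_irrefl _ h5
  exact (((lintegral_mono_set hsplit).trans (lintegral_union_le _ _ _)).trans_lt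
    (ENNReal.add_lt_top.2 ⟨h2, h1⟩)).ne

/-- At a Lebesgue point `x` of `g`, the means of `g` over the parallels converge to `g x` in the
mean. -/
theorem mean_of_lebesgue_point {g : USphere (k + 3) → ℂ} (hg : Measurable g) (x : USphere (k + 3))
    (hx : ∀ ε > 0, ∃ θ₀ > 0, ∀ θ ∈ Ioo 0 θ₀, ∫⁻ y in closedBall x θ, ‖g y - g x‖ₑ
      ∂(surfaceMeasure (Euc (k + 3))) ≤ ENNReal.ofReal (ε * θ ^ (k + 2))) :
    ∀ ε > 0, ∃ s₀ < 1, ∀ s ∈ Ioo s₀ 1,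
      ∫⁻ v in Ioo s 1, parallelMean x (fun y => ‖g y - g x‖ₑ) v ≤ ENNReal.ofReal (ε * (1 - s)) := by
  refine lintegral_le_of_weighted (k := k) fun ε hε => ?_
  have hσ : 0 < sphereArea (k + 1 + 1) := sphereArea_pos (by omega)
  have h2 : (0 : ℝ) < 2 ^ ((k : ℝ) / 2 + 1) := by positivity
  obtain ⟨θ₀, hθ₀, H⟩ := hx (ε * sphereArea (k + 1 + 1) / 2 ^ ((k : ℝ) / 2 + 1)) (by positivity)
  refine ⟨max (1 - θ₀ ^ 2 / 2) (-1), max_lt (by have := pow_pos hθ₀ 2; linarith) (by norm_num),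
    fun s hs => ?_⟩
  have hs1 : 1 - θ₀ ^ 2 / 2 < s := (le_max_left _ _).trans_lt hs.1
  have hs2 : -1 < s := (le_max_right _ _).trans_lt hs.1
  have hpos : 0 < 2 * (1 - s) := by linarith [hs.2]
  -- The cap `⟨x, y⟩ > s` is the ball around `x` of this radius, in the Euclidean distance.
  set θ : ℝ := √(2 * (1 - s)) with hθ
  have hθ2 : θ ^ 2 = 2 * (1 - s) := Real.sq_sqrt hpos.le
  have hθpos : 0 < θ := Real.sqrt_pos.2 hpos
  have hθlt : θ < θ₀ := by
    rw [hθ, Real.sqrt_lt' hθ₀]; linarith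
  have hsub : {y : USphere (k + 3) | s < inner ℝ (x : Euc (k + 3)) (y : Euc (k + 3))} ⊆
      closedBall x θ := by
    intro y (hy : s < _)
    rw [mem_closedBall, ← sq_le_sq₀ dist_nonneg hθpos.le, dist_sq_eq_inner, hθ2]
    linarith
  have h3 := (lintegral_mono_set (f := fun y => ‖g y - g x‖ₑ)
    (μ := surfaceMeasure (Euc (k + 3))) hsub).trans (H θ ⟨hθpos, hθlt⟩)
  have h4 := lintegral_cap (k := k + 1) x (h := fun y => ‖g y - g x‖ₑ)
    ((hg.sub_const _).enorm) hs2.le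
  have hexp : (((k + 1 : ℕ) : ℝ) - 1) / 2 = (k : ℝ) / 2 := by push_cast; ring
  have hθk : θ ^ (k + 2) = 2 ^ ((k : ℝ) / 2 + 1) * (1 - s) ^ ((k : ℝ) / 2 + 1) := by
    rw [← Real.mul_rpow zero_le_two (by linarith), ← hθ2, ← Real.rpow_natCast θ 2,
      ← Real.rpow_mul hθpos.le, ← Real.rpow_natCast]
    congr 1
    push_cast
    ring
  rw [hexp] at h4
  have h5 := h4.symm.trans_le h3
  rw [hθk, show ε * sphereArea (k + 1 + 1) / 2 ^ ((k : ℝ) / 2 + 1) *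
    (2 ^ ((k : ℝ) / 2 + 1) * (1 - s) ^ ((k : ℝ) / 2 + 1)) =
    sphereArea (k + 1 + 1) * (ε * (1 - s) ^ ((k : ℝ) / 2 + 1)) by field_simp,
    ENNReal.ofReal_mul hσ.le] at h5
  exact (ENNReal.mul_le_mul_iff_right (by simpa using hσ) ENNReal.ofReal_ne_top).1 h5

theorem mean_of_continuousAt {g : USphere (k + 3) → ℂ} (x : USphere (k + 3))
    (hx : ContinuousAt g x) :
    ∀ ε > 0, ∃ s₀ < 1, ∀ s ∈ Ioo s₀ 1,
      ∫⁻ v in Ioo s 1, parallelMean x (fun y => ‖g y - g x‖ₑ) v ≤ ENNReal.ofReal (ε * (1 - s)) := by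
  intro ε hε
  obtain ⟨θ, hθ, H⟩ := Metric.continuousAt_iff.1 hx ε hε
  refine ⟨max (1 - θ ^ 2 / 2) (-1), max_lt (by have := pow_pos hθ 2; linarith) (by norm_num),
    fun s hs => ?_⟩
  have hs1 : 1 - θ ^ 2 / 2 < s := (le_max_left _ _).trans_lt hs.1
  have hs2 : -1 < s := (le_max_right _ _).trans_lt hs.1
  have h1 : ∀ v ∈ Ioo s 1, parallelMean x (fun y => ‖g y - g x‖ₑ) v ≤ ENNReal.ofReal ε := by
    intro v hv
    have h2 : ∀ η, ‖g (tilt x (Real.arcsin v) η) - g x‖ₑ ≤ ENNReal.ofReal ε := by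
      intro η
      rw [← ofReal_norm]
      refine ENNReal.ofReal_le_ofReal ?_
      rw [← dist_eq_norm]
      refine (H ?_).le
      rw [← sq_lt_sq₀ dist_nonneg hθ.le, dist_sq_eq_inner,
        inner_tilt_arcsin x ⟨hs2.trans hv.1, hv.2⟩]
      linarith [hv.1]
    calc _ ≤ ∫⁻ _, ENNReal.ofReal ε ∂(equatorMeasure x) := lintegral_mono h2
      _ = _ := by simp
  calc _ ≤ ∫⁻ _ in Ioo s 1, ENNReal.ofReal ε := setLIntegral_mono' measurableSet_Ioo h1
    _ = _ := by rw [setLIntegral_const, Real.volume_Ioo, ENNReal.ofReal_mul hε.le]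

end LebesguePoint

/-! ### Lebesgue differentiation on the sphere -/

section LebesgueDifferentiation

variable {k : ℕ}

theorem measurable_comp_direction {m : ℕ} {α : Type*} [MeasurableSpace α] (p : USphere m)
    {h : USphere m → α} (hh : Measurable h) : Measurable fun v => h (direction p v) :=
  hh.comp (measurable_direction.comp (measurable_const.prodMk measurable_id))

/-- The extension of an integrable function on the sphere to a homogeneous function of degree `0`
is locally integrable. -/
theorem locallyIntegrable_comp_direction {g : USphere (k + 2) → ℂ} (hg : Measurable g)
    (hgi : ∫⁻ y, ‖g y‖ₑ ∂(surfaceMeasure (Euc (k + 2))) ≠ ⊤) (p : USphere (k + 2)) :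
    LocallyIntegrable (fun v => g (direction p v)) := by
  have h1 := lintegral_sphere_mul_gaussianMoment (V := Euc (k + 2)) (n := k + 1)
    (finrank_euclideanSpace_fin) (h := fun v => ‖g (direction p v)‖ₑ)
    (measurable_comp_direction p hg.enorm) (fun r hr v => by rw [direction_smul p hr])
  simp only [direction_coe] at h1
  have h2 := ENNReal.mul_ne_top hgi (gaussianMoment_ne_top (k + 1))
  rw [h1] at h2
  rw [locallyIntegrable_iff]
  intro K hK
  obtain ⟨R, hR⟩ := hK.isBounded.subset_closedBall 0
  refine ⟨(measurable_comp_direction p hg).aestronglyMeasurable, ?_⟩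
  rw [hasFiniteIntegral_iff_enorm]
  have h3 : ENNReal.ofReal (Real.exp (-R ^ 2)) * ∫⁻ v in K, ‖g (direction p v)‖ₑ < ⊤ := by
    rw [← lintegral_const_mul' _ _ ENNReal.ofReal_ne_top]
    refine ((setLIntegral_mono' hK.measurableSet fun v hv => ?_).trans
      (setLIntegral_le_lintegral K _)).trans_lt h2.lt_top
    rw [mul_comm]
    refine mul_le_mul_right (ENNReal.ofReal_le_ofReal (Real.exp_le_exp.2 (neg_le_neg ?_))) _
    have := mem_closedBall_zero_iff.1 (hR hv)
    gcongr
  by_contra hcon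
  rw [not_lt_top_iff.1 hcon, ENNReal.mul_top (by simpa using Real.exp_pos _)] at h3
  exact lt_irrefl _ h3

/-- A property of almost all vectors holds somewhere on almost every ray from the origin. -/
theorem ae_exists_smul {P : Euc (k + 2) → Prop} (hP : ∀ᵐ v, P v) :
    ∀ᵐ y : USphere (k + 2) ∂(surfaceMeasure (Euc (k + 2))),
      ∃ r : ℝ, 0 < r ∧ P (r • (y : Euc (k + 2))) := by
  set T : Set (Euc (k + 2)) := toMeasurable volume {v | ¬ P v} with hT
  have hT0 : volume T = 0 := (measure_toMeasurable _).trans hP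
  have hTm : MeasurableSet T := measurableSet_toMeasurable _ _
  have h1 := lintegral_polar (V := Euc (k + 2)) (Ψ := T.indicator 1)
    (measurable_one.indicator hTm)
  rw [lintegral_indicator_one hTm, hT0] at h1
  have hm : Measurable fun q : USphere (k + 2) × ℝ => ENNReal.ofReal
      (q.2 ^ (Module.finrank ℝ (Euc (k + 2)) - 1)) * T.indicator 1 (q.2 • (q.1 : Euc (k + 2))) := by
    refine Measurable.mul (by fun_prop) ?_
    exact (measurable_one.indicator hTm).comp (f := fun q : USphere (k + 2) × ℝ =>
      q.2 • (q.1 : Euc (k + 2))) (by fun_prop)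
  have h2 := (lintegral_eq_zero_iff hm.lintegral_prod_right').1 h1.symm
  filter_upwards [h2] with y hy
  have hy' := (lintegral_eq_zero_iff (hm.comp measurable_prodMk_left)).1 hy
  have hne : NeBot (ae ((volume : Measure ℝ).restrict (Ioi 0))) := by
    rw [ae_neBot, Ne, Measure.restrict_eq_zero]
    simp
  obtain ⟨r, hr, hr0 : 0 < r⟩ := (hy'.and (ae_restrict_mem measurableSet_Ioi)).exists
  refine ⟨r, hr0, ?_⟩
  by_contra hcon
  have hmem : r • (y : Euc (k + 2)) ∈ T := subset_toMeasurable _ _ hcon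
  simp only [Function.comp_apply, indicator_of_mem hmem, Pi.one_apply, mul_one, Pi.zero_apply,
    ENNReal.ofReal_eq_zero] at hr
  exact absurd hr (not_le.2 (pow_pos hr0 _))

/-- The truncated cone over a cap of radius `θ` around `y` with radial coordinate in
`[r, r + r θ]` lies in the ball of radius `2 r θ` around `r • y`. -/
theorem lintegral_closedBall_ge {h : USphere (k + 2) → ℝ≥0∞} (hh : Measurable h)
    (p y : USphere (k + 2)) {r : ℝ} (hr : 0 < r) (θ : ℝ) :
    ENNReal.ofReal (r ^ (k + 1) * (r * θ)) *
        ∫⁻ z in closedBall y θ, h z ∂(surfaceMeasure (Euc (k + 2))) ≤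
      ∫⁻ v in closedBall (r • (y : Euc (k + 2))) (2 * (r * θ)), h (direction p v) := by
  have hm := measurable_comp_direction p hh
  rw [← lintegral_indicator (f := fun v => h (direction p v)) isClosed_closedBall.measurableSet,
    lintegral_polar (hm.indicator isClosed_closedBall.measurableSet),
    ← lintegral_const_mul' _ _ ENNReal.ofReal_ne_top]
  refine le_trans ?_ (setLIntegral_le_lintegral (closedBall y θ) _)
  refine setLIntegral_mono' isClosed_closedBall.measurableSet fun z hz => ?_
  have hfin : Module.finrank ℝ (Euc (k + 2)) - 1 = k + 1 := by
    rw [finrank_euclideanSpace_fin]; rfl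
  rw [hfin]
  calc ENNReal.ofReal (r ^ (k + 1) * (r * θ)) * h z =
        ∫⁻ _ in Icc r (r + r * θ), ENNReal.ofReal (r ^ (k + 1)) * h z := by
        rw [setLIntegral_const, Real.volume_Icc, add_sub_cancel_left,
          ENNReal.ofReal_mul (by positivity)]
        ring
    _ ≤ ∫⁻ ρ in Icc r (r + r * θ), ENNReal.ofReal (ρ ^ (k + 1)) *
          (closedBall (r • (y : Euc (k + 2))) (2 * (r * θ))).indicator
            (fun v => h (direction p v)) (ρ • (z : Euc (k + 2))) := by
        refine setLIntegral_mono' measurableSet_Icc fun ρ hρ => ?_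
        have hρ0 : 0 < ρ := hr.trans_le hρ.1
        have hmem : ρ • (z : Euc (k + 2)) ∈ closedBall (r • (y : Euc (k + 2))) (2 * (r * θ)) := by
          have hz' : ‖(z : Euc (k + 2)) - y‖ ≤ θ := by
            rw [← dist_eq_norm]; exact hz
          have e : ρ • (z : Euc (k + 2)) - r • (y : Euc (k + 2)) =
              (ρ - r) • (z : Euc (k + 2)) + r • ((z : Euc (k + 2)) - y) := by
            rw [sub_smul, smul_sub]; abel
          rw [mem_closedBall, dist_eq_norm, e]
          refine (norm_add_le _ _).trans ?_
          rw [norm_smul, norm_smul, norm_eq_of_mem_sphere z, Real.norm_of_nonneg hr.le,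
            Real.norm_of_nonneg (by linarith [hρ.1])]
          have := mul_le_mul_of_nonneg_left hz' hr.le
          linarith [hρ.2]
        rw [indicator_of_mem hmem, direction_smul p hρ0, direction_coe]
        gcongr
        exact hρ.1
    _ ≤ _ := lintegral_mono_set fun ρ hρ => hr.trans_le hρ.1

/-- Almost every point of the sphere is a Lebesgue point of an integrable function. -/
theorem ae_lebesgue_point {g : USphere (k + 2) → ℂ} (hg : Measurable g)
    (hgi : ∫⁻ y, ‖g y‖ₑ ∂(surfaceMeasure (Euc (k + 2))) ≠ ⊤) :
    ∀ᵐ x ∂(surfaceMeasure (Euc (k + 2))), ∀ ε > 0, ∃ θ₀ > 0, ∀ θ ∈ Ioo 0 θ₀,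
      ∫⁻ y in closedBall x θ, ‖g y - g x‖ₑ ∂(surfaceMeasure (Euc (k + 2))) ≤
        ENNReal.ofReal (ε * θ ^ (k + 1)) := by
  obtain ⟨p⟩ : Nonempty (USphere (k + 2)) := (NormedSpace.sphere_nonempty.2 zero_le_one).to_subtype
  have hloc := locallyIntegrable_comp_direction hg hgi p
  have hleb := IsUnifLocDoublingMeasure.ae_tendsto_average_norm_sub volume hloc 1
  filter_upwards [ae_exists_smul hleb] with y hy
  obtain ⟨r, hr, H⟩ := hy
  intro ε hε
  have hgr : g (direction p (r • (y : Euc (k + 2)))) = g y := by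
    rw [direction_smul p hr, direction_coe]
  set c : ℝ := volume.real (ball (0 : Euc (k + 2)) 1) with hc
  have hcpos : 0 < c := ENNReal.toReal_pos (measure_ball_pos _ _ one_pos).ne' measure_ball_lt_top.ne
  have H1 := H (l := 𝓝[>] (0 : ℝ)) (fun _ => r • (y : Euc (k + 2))) id tendsto_id (by
    filter_upwards [self_mem_nhdsWithin] with δ (hδ : 0 < δ)
    exact mem_closedBall_self (by rw [one_mul]; exact hδ.le))
  -- The ball below has radius `2 r θ` and volume `c (2 r θ)^{k+2}`.
  have hε' : 0 < ε / (2 ^ (k + 2) * c) := by positivity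
  obtain ⟨δ₀, hδ₀ : 0 < δ₀, H2⟩ := mem_nhdsGT_iff_exists_Ioo_subset.1 (H1.eventually_lt_const hε')
  refine ⟨δ₀ / (2 * r), by positivity, fun θ hθ => ?_⟩
  have hθ0 : 0 < θ := hθ.1
  have hδ : 2 * (r * θ) ∈ Ioo 0 δ₀ := by
    refine ⟨by positivity, ?_⟩
    have := (lt_div_iff₀ (by positivity)).1 hθ.2
    linarith
  have H3 := H2 hδ
  simp only [mem_ofPred_eq, id] at H3
  rw [hgr, setAverage_eq, Measure.addHaar_real_closedBall _ _ hδ.1.le, finrank_euclideanSpace_fin,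
    smul_eq_mul, ← hc, inv_mul_lt_iff₀ (by positivity)] at H3
  have hint : IntegrableOn (fun v => g (direction p v) - g y)
      (closedBall (r • (y : Euc (k + 2))) (2 * (r * θ))) :=
    (hloc.integrableOn_isCompact (isCompact_closedBall _ _)).sub
      (integrableOn_const (measure_closedBall_lt_top.ne))
  have H4 := ENNReal.ofReal_le_ofReal H3.le
  rw [ofReal_integral_norm_eq_lintegral_enorm hint] at H4
  have H5 := (lintegral_closedBall_ge (h := fun z => ‖g z - g y‖ₑ) (hg.sub_const _).enorm p y hr
    θ).trans H4
  have e : (2 * (r * θ)) ^ (k + 2) * c * (ε / (2 ^ (k + 2) * c)) =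
      r ^ (k + 1) * (r * θ) * (ε * θ ^ (k + 1)) := by
    field_simp
    ring
  have hpos : 0 < r ^ (k + 1) * (r * θ) := by positivity
  rw [e, ENNReal.ofReal_mul hpos.le] at H5
  exact (ENNReal.mul_le_mul_iff_right (by simpa using hpos) ENNReal.ofReal_ne_top).1 H5

end LebesgueDifferentiation

/-! ### Modification on null sets -/

section Modification

variable {k : ℕ}

/-- For every `x`, almost all sub-spheres at a given distance from `x` meet a null set of the
sphere in a null set. -/
theorem ae_equatorKernel_tilt_eq_zero {N : Set (USphere (k + 3))} (hN : MeasurableSet N)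
    (hN0 : surfaceMeasure (Euc (k + 3)) N = 0) (x : USphere (k + 3)) {q : ℝ}
    (hq : q ∈ Ioo (0 : ℝ) 1) :
    ∀ᵐ η ∂(equatorMeasure x), equatorKernel (k + 1) (tilt x (Real.arccos q) η) N = 0 := by
  have hm : Measurable (N.indicator (1 : USphere (k + 3) → ℝ≥0∞)) := measurable_one.indicator hN
  have hσ : 0 < sphereArea (k + 1 + 1) := sphereArea_pos (by omega)
  have hmm : Measurable fun v => parallelMean x (N.indicator 1) v *
      ENNReal.ofReal ((1 - v ^ 2) ^ ((((k + 1 : ℕ) : ℝ) - 1) / 2)) :=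
    (measurable_parallelMean x hm).mul (by fun_prop)
  have h1 := lintegral_surfaceMeasure (k := k + 1) x hm
  rw [lintegral_indicator_one hN, hN0, eq_comm, mul_eq_zero,
    or_iff_right (by simpa using hσ), lintegral_eq_zero_iff hmm, EventuallyEq,
    ae_restrict_iff' measurableSet_Ioo] at h1
  have h2 : ∀ᵐ v : ℝ, v ∈ Ioo (-1 : ℝ) 1 → parallelMean x (N.indicator 1) v = 0 := by
    filter_upwards [h1] with v hv hv1
    have h3 : 0 < (1 - v ^ 2) ^ ((((k + 1 : ℕ) : ℝ) - 1) / 2) :=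
      Real.rpow_pos_of_pos (by nlinarith [hv1.1, hv1.2]) _
    exact (mul_eq_zero.1 (hv hv1)).resolve_right (by simpa using h3)
  have h3 : ∀ᵐ s : ℝ, q * s ∈ Ioo (-1 : ℝ) 1 → parallelMean x (N.indicator 1) (q * s) = 0 := by
    refine ae_of_ae_map (f := fun s => q * s) (by fun_prop)
      (p := fun v => v ∈ Ioo (-1 : ℝ) 1 → parallelMean x (N.indicator 1) v = 0) ?_
    rw [Real.map_volume_mul_left hq.1.ne']
    exact Measure.ae_smul_measure h2 _
  have h4 := lintegral_equatorKernel_tilt x ⟨by linarith [hq.1], hq.2.le⟩ hm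
  have h5 : ∫⁻ s in Ioo (-1 : ℝ) 1, parallelMean x (N.indicator 1) (q * s) *
      ENNReal.ofReal ((1 - s ^ 2) ^ (((k : ℝ) - 1) / 2)) = 0 := by
    rw [← lintegral_zero (μ := (volume : Measure ℝ).restrict (Ioo (-1) 1))]
    refine setLIntegral_congr_fun_ae measurableSet_Ioo ?_
    filter_upwards [h3] with s hs hs1
    rw [hs ⟨by nlinarith [hq.1, hq.2, hs1.1, hs1.2], by nlinarith [hq.1, hq.2, hs1.1, hs1.2]⟩,
      zero_mul]
  rw [h5, mul_zero] at h4
  simp only [lintegral_indicator_one hN] at h4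
  exact (lintegral_eq_zero_iff (((equatorKernel (k + 1)).measurable_coe hN).comp
    (measurable_tilt x _))).1 h4

/-- For every `x`, the averages of the Radon transform over the sub-spheres at a given distance from
`x` do not see changes of the function on null sets. -/
theorem radon_ae_eq {f g : USphere (k + 3) → ℂ} (hfg : f =ᵐ[surfaceMeasure (Euc (k + 3))] g)
    (x : USphere (k + 3)) {q : ℝ} (hq : q ∈ Ioo (0 : ℝ) 1) :
    radon f =ᵐ[avgMeasure x (Real.arccos q)] radon g := by
  set N := toMeasurable (surfaceMeasure (Euc (k + 3))) {y | ¬ f y = g y} with hNdef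
  have hN : MeasurableSet N := measurableSet_toMeasurable _ _
  have hN0 : surfaceMeasure (Euc (k + 3)) N = 0 := (measure_toMeasurable _).trans hfg
  set S : Set (GreatSubsphere (k + 3)) := {ξ | (surfaceMeasure ξ.plane).map ξ.incl N = 0}
  have hS : MeasurableSet S := by
    change MeasurableSet (ofNormal ⁻¹' S)
    have : ofNormal ⁻¹' S = {ω | equatorKernel (k + 1) ω N = 0} := by
      ext ω
      rw [mem_ofPred_eq, equatorKernel_apply]
      rfl
    rw [this]
    exact (equatorKernel (k + 1)).measurable_coe hN (measurableSet_singleton 0)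
  have h1 : ∀ᵐ ξ ∂(avgMeasure x (Real.arccos q)), ξ ∈ S := by
    refine (ae_map_iff (measurable_ofNormal_tilt x _).aemeasurable hS).2 ?_
    filter_upwards [ae_equatorKernel_tilt_eq_zero hN hN0 x hq] with η hη
    rw [equatorKernel_apply] at hη
    exact hη
  filter_upwards [h1] with ξ hξ
  refine integral_congr_ae (ae_of_ae_map (continuous_incl ξ).aemeasurable
    (p := fun y => f y = g y) ?_)
  exact measure_mono_null (subset_toMeasurable _ _) hξ

/-- Changing a function on a null set changes neither the meaning nor the value of the right-hand
side of the inversion formula, at any point. -/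
theorem inversion_congr {f g : USphere (k + 3) → ℂ}
    (hfg : f =ᵐ[surfaceMeasure (Euc (k + 3))] g) (x : USphere (k + 3))
    (hg : InversionDefinedAt g x) :
    InversionDefinedAt f x ∧ ∀ n, sqDerivAtOne n (inversionIntegral f x) =
      sqDerivAtOne n (inversionIntegral g x) := by
  have hI : ∀ t ∈ Ioc (0 : ℝ) 1, inversionIntegrand f x t =ᵐ[volume.restrict (Ioc 0 t)]
      inversionIntegrand g x t := by
    intro t ht
    rw [Ioo_ae_eq_Ioc.symm |> Measure.restrict_congr_set]
    filter_upwards [ae_restrict_mem measurableSet_Ioo] with q hq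
    unfold inversionIntegrand dualRadon
    rw [integral_congr_ae (radon_ae_eq hfg x ⟨hq.1, hq.2.trans_le ht.2⟩)]
  have hH : EqOn (fun u : ℝ => inversionIntegral f x √u) (fun u : ℝ => inversionIntegral g x √u)
      (Ioc 0 1) := by
    intro u hu
    have ht : √u ∈ Ioc (0 : ℝ) 1 := ⟨Real.sqrt_pos.2 hu.1, by simpa using hu.2⟩
    unfold inversionIntegral
    simp only
    rw [intervalIntegral.integral_of_le ht.1.le, intervalIntegral.integral_of_le ht.1.le]
    exact integral_congr_ae (hI _ ht)
  have h1 : (1 : ℝ) ∈ Ioc (0 : ℝ) 1 := ⟨one_pos, le_rfl⟩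
  obtain ⟨hg1, hg2, hg3⟩ := hg
  refine ⟨⟨?_, fun t ht => ?_, fun i hi => ⟨(hg3 i hi).1.congr hH, ?_⟩⟩, fun n => ?_⟩
  · filter_upwards [hg1] with q hq hq1
    exact (hq hq1).congr (radon_ae_eq hfg x hq1).symm
  · refine (hg2 t ht).congr_ae ?_
    rw [uIoc_of_le ht.1.le]
    exact (hI t ht).symm
  · have h2 := iteratedDerivWithin_congr (n := i) hH
    exact (hg3 i hi).2.congr h2 (h2 h1)
  · exact iteratedDerivWithin_congr hH h1

end Modification

/-! ### The inversion formula for square integrable functions -/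

section InversionFormula

variable {k : ℕ}

/-- Fubini's theorem for the incidence relation of points and great sub-spheres. -/
theorem ae_integrable_incl {f : USphere (k + 2) → ℂ}
    (hf : Integrable f (surfaceMeasure (Euc (k + 2)))) :
    ∀ᵐ ω ∂(surfaceMeasure (Euc (k + 2))), Integrable (fun y => f ((ofNormal ω).incl y))
      (surfaceMeasure (ofNormal ω).plane) := by
  set g := hf.1.mk f with hgdef
  have hg : Measurable g := hf.1.measurable_mk
  have hgi : Integrable g (surfaceMeasure (Euc (k + 2))) := hf.congr hf.1.ae_eq_mk
  set N := toMeasurable (surfaceMeasure (Euc (k + 2))) {y | ¬ f y = g y} with hNdef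
  have hN : MeasurableSet N := measurableSet_toMeasurable _ _
  have hN0 : surfaceMeasure (Euc (k + 2)) N = 0 := (measure_toMeasurable _).trans hf.1.ae_eq_mk
  have h1 := lintegral_lintegral_equatorKernel (k := k)
    (measurable_one.indicator hN : Measurable (N.indicator (1 : USphere (k + 2) → ℝ≥0∞)))
  simp only [lintegral_indicator_one hN, hN0, mul_zero] at h1
  have h2 := (lintegral_eq_zero_iff ((equatorKernel k).measurable_coe hN)).1 h1
  have h3 : ∫⁻ ω, ∫⁻ y, ‖g y‖ₑ ∂(equatorKernel k ω) ∂(surfaceMeasure (Euc (k + 2))) ≠ ⊤ := by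
    rw [lintegral_lintegral_equatorKernel hg.enorm]
    exact ENNReal.mul_ne_top ENNReal.ofReal_ne_top hgi.2.ne
  filter_upwards [h2, ae_lt_top hg.enorm.lintegral_kernel h3] with ω hω hω2
  have h4 : Integrable g (equatorKernel k ω) := ⟨hg.aestronglyMeasurable, hω2⟩
  rw [Pi.zero_apply, equatorKernel_apply] at hω
  rw [equatorKernel_apply, integrable_map_measure hg.aestronglyMeasurable
    (continuous_incl _).aemeasurable] at h4
  refine h4.congr (ae_of_ae_map (continuous_incl (ofNormal ω)).aemeasurable
    (p := fun y => g y = f y) ?_)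
  refine measure_mono_null (fun y hy => subset_toMeasurable _ _ ?_) hω
  exact fun h => hy h.symm

theorem measurePreserving_neg {m : ℕ} :
    MeasurePreserving (fun y : USphere m => -y) (surfaceMeasure (Euc m))
      (surfaceMeasure (Euc m)) :=
  ⟨continuous_neg.measurable, map_surfaceMeasure (LinearIsometryEquiv.neg ℝ)⟩

/-- An almost everywhere even function agrees almost everywhere with a measurable function that is
even without exceptions. -/
theorem exists_measurable_even {m : ℕ} {f : USphere m → ℂ}
    (hf : AEStronglyMeasurable f (surfaceMeasure (Euc m)))
    (heven : ∀ᵐ x ∂(surfaceMeasure (Euc m)), f (-x) = f x) :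
    ∃ g : USphere m → ℂ, Measurable g ∧ (∀ y, g (-y) = g y) ∧
      f =ᵐ[surfaceMeasure (Euc m)] g := by
  have hm : Measurable (hf.mk f) := hf.measurable_mk
  refine ⟨fun y => (hf.mk f y + hf.mk f (-y)) / 2,
    (hm.add (hm.comp continuous_neg.measurable)).div_const 2, fun y => ?_, ?_⟩
  · simp only [neg_neg]
    rw [add_comm]
  · have h1 := measurePreserving_neg.quasiMeasurePreserving.ae hf.ae_eq_mk
    filter_upwards [heven, hf.ae_eq_mk, h1] with y h2 h3 h4
    rw [← h3, ← h4, h2]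
    ring

theorem inversion_ae {f : USphere (k + 3) → ℂ}
    (hf : Integrable f (surfaceMeasure (Euc (k + 3))))
    (heven : ∀ᵐ x ∂(surfaceMeasure (Euc (k + 3))), f (-x) = f x) :
    ∀ᵐ x ∂(surfaceMeasure (Euc (k + 3))), InversionDefinedAt f x ∧
      f x = ((2 ^ (k + 3 - 2) / ((k + 3 - 3).factorial * sphereArea (k + 3 - 1)) : ℝ) : ℂ) *
        sqDerivAtOne (k + 3 - 2) (inversionIntegral f x) := by
  obtain ⟨g, hg, hge, hfg⟩ := exists_measurable_even hf.1 heven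
  have hgi := (hf.congr hfg).2.ne
  filter_upwards [hfg, ae_lebesgue_point hg hgi] with x hx hleb
  have hmean := mean_of_lebesgue_point hg x hleb
  obtain ⟨h1, h2⟩ := inversion_of_mean hg hge x (lintegral_parallelMean_ne_top hg hgi x hmean) hmean
  obtain ⟨h3, h4⟩ := inversion_congr hfg x h1
  exact ⟨h3, by rw [hx, h4]; exact h2⟩

theorem inversion_of_continuous {f : USphere (k + 3) → ℂ} (hf : Continuous f)
    (heven : ∀ᵐ x ∂(surfaceMeasure (Euc (k + 3))), f (-x) = f x) (x : USphere (k + 3)) :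
    InversionDefinedAt f x ∧
      f x = ((2 ^ (k + 3 - 2) / ((k + 3 - 3).factorial * sphereArea (k + 3 - 1)) : ℝ) : ℂ) *
        sqDerivAtOne (k + 3 - 2) (inversionIntegral f x) := by
  have hpos : (surfaceMeasure (Euc (k + 3))).IsOpenPosMeasure := by
    unfold surfaceMeasure; infer_instance
  have he : (fun y => f (-y)) = f :=
    Measure.eq_of_ae_eq heven (hf.comp continuous_neg) hf
  have hfi : Integrable f (surfaceMeasure (Euc (k + 3))) :=
    hf.integrable_of_hasCompactSupport (HasCompactSupport.of_compactSpace f)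
  have hmean := mean_of_continuousAt x hf.continuousAt
  exact inversion_of_mean hf.measurable (congrFun he) x
    (lintegral_parallelMean_ne_top hf.measurable hfi.2.ne x hmean) hmean

end InversionFormula

end SphericalRadon

theorem theorem4p2 (m : ℕ) (hm : 3 ≤ m) (f : USphere m → ℂ)
    (hf : MemLp f 2 (surfaceMeasure (Euc m)))
    (heven : ∀ᵐ x ∂(surfaceMeasure (Euc m)), f (-x) = f x) :
    (∀ᵐ ω ∂(surfaceMeasure (Euc m)),
      Integrable (fun y => f ((GreatSubsphere.ofNormal ω).incl y))
        (surfaceMeasure (GreatSubsphere.ofNormal ω).plane)) ∧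
    (∀ᵐ x ∂(surfaceMeasure (Euc m)),
      InversionDefinedAt f x ∧
      f x = ((2 ^ (m - 2) / ((m - 3).factorial * sphereArea (m - 1)) : ℝ) : ℂ) *
        sqDerivAtOne (m - 2) (inversionIntegral f x)) ∧
    (Continuous f → ∀ x : USphere m,
      InversionDefinedAt f x ∧
      f x = ((2 ^ (m - 2) / ((m - 3).factorial * sphereArea (m - 1)) : ℝ) : ℂ) *
        sqDerivAtOne (m - 2) (inversionIntegral f x)) := by
  obtain ⟨k, rfl⟩ : ∃ k, m = k + 3 := ⟨m - 3, by omega⟩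
  have hfi : Integrable f (surfaceMeasure (Euc (k + 3))) := hf.integrable one_le_two
  exact ⟨SphericalRadon.ae_integrable_incl hfi, SphericalRadon.inversion_ae hfi heven,
    fun hc => SphericalRadon.inversion_of_continuous hc heven⟩
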